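/- **Theorem.** For every dimension $d\ge 1$ there is a constant $C=C(d)>0$ such that for all constants $f\ge 1$ and $0<\varepsilon<\tfrac12$ the following holds. The geometric knapsack problem, restricted to instances in which every input object is an $f$-fat convex object $P\subset\mathbb{R}^d$ with circumradius $r^{\mathrm{out}}(P)\le\varepsilon$, has a polynomial-time $(1+C\varepsilon)$-approximation algorithm without resource augmentation. Here an instance consists of finitely many compact convex sets $P_1,\dots,P_n\subset\mathbb{R}^d$ with rational profits $w_1,\dots,w_n\ge 0$. The numbers $r^{\mathrm{out}}(P)$ and $r^{\mathrm{in}}(P)$ are the radius of the smallest Euclidean ball containing $P$ and of the largest Euclidean ball contained in $P$; $P$ is $f$-fat if $r^{\mathrm{in}}(P)>0$ and $r^{\mathrm{out}}(P)/r^{\mathrm{in}}(P)\le f$. A feasible solution is a set $S\subseteq\{1,\dots,n\}$ with translation vectors $t_i\in\mathbb{R}^d$ $(i\in S)$ such that every $P_i+t_i$ $(i\in S)$ is contained in $[0,1]^d$ and the interiors of the sets $P_i+t_i$ are pairwise disjoint (no rotations); its profit is $\sum_{i\in S}w_i$, and $w(\mathrm{OPT})$ is the maximum profit of a feasible solution.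 Each object is given as in the usual oracle model for convex bodies: the input lists, for each $i$, the profit $w_i$ and a rational center and rational radius $>0$ of some ball contained in $P_i$ (numbers in binary), and $P_i$ itself is accessed through a weak membership oracle, which, for a rational point $y$ and a rational $\delta>0$, answers "yes" or "no" such that "yes" implies that $y$ has distance at most $\delta$ from $P_i$, and "no" implies that the closed $\delta$-ball around $y$ is not contained in $P_i$. An algorithm as claimed is one deterministic program (which may depend on $d,f,\varepsilon$) that, for each such instance and each such oracle, outputs a feasible solution with rational translation vectors and profit at least $w(\mathrm{OPT})/(1+C\varepsilon)$, and whose number of bit operations and oracle calls is bounded by a polynomial (which may depend on $d,f,\varepsilon$) in the bit length of the input. -/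

import Mathlib

open scoped Pointwise

namespace GeoKnapsack

/-! ### A machine model with a step count

Programs of an imperative language (assignment, sequencing, branching, unbounded loops, oracle
queries) work on finite trees with rational leaves. Every operation is charged the bit sizes of the
values involved (logarithmic cost), so polynomial time here is polynomial time on oracle Turing
machines. -/

/-- The data of the machine: binary trees with rational leaves. -/
inductive Val where
  | num (q : ℚ) : Val
  | nil : Val
  | cons (a b : Val) : Val

namespace Val

/-- The bit size of a value. -/
def size : Val → ℕ
  | num q => 1 + Nat.size q.num.natAbs + Nat.size q.den
  | nil => 1
  | cons a b => 1 + a.size + b.size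

/-- Numerical reading of a value; a value that is not a number reads as `0`. -/
def toRat : Val → ℚ
  | num q => q
  | _ => 0

def head : Val → Val
  | cons a _ => a
  | _ => nil

def tail : Val → Val
  | cons _ b => b
  | _ => nil

/-- Truth values: `nil` is false, everything else is true. -/
def truth : Val → Bool
  | nil => false
  | _ => true

def ofBool : Bool → Val
  | true => num 1
  | false => nil

def isNum : Val → Bool
  | num _ => true
  | _ => false

/-- Lists are represented by nested pairs. -/
def ofList : List Val → Val
  | [] => nil
  | v :: vs => cons v (ofList vs)

/-- A rational vector, as the list of its coordinates. -/
def ofVec {d : ℕ} (y : Fin d → ℚ) : Val :=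
  ofList (List.ofFn fun k => num (y k))

end Val

/-- Unary operations. -/
inductive UnOp where
  | head | tail | isNum | floor

/-- Binary operations. -/
inductive BinOp where
  | cons | add | sub | mul | div | le

def UnOp.apply : UnOp → Val → Val
  | .head, v => v.head
  | .tail, v => v.tail
  | .isNum, v => Val.ofBool v.isNum
  | .floor, v => .num (⌊v.toRat⌋ : ℤ)

def BinOp.apply : BinOp → Val → Val → Val
  | .cons, v, w => .cons v w
  | .add, v, w => .num (v.toRat + w.toRat)
  | .sub, v, w => .num (v.toRat - w.toRat)
  | .mul, v, w => .num (v.toRat * w.toRat)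
  | .div, v, w => .num (v.toRat / w.toRat)
  | .le, v, w => Val.ofBool (decide (v.toRat ≤ w.toRat))

/-- Expressions; program variables are natural numbers. -/
inductive Expr where
  | var (x : ℕ) : Expr
  | lit (q : ℚ) : Expr
  | nil : Expr
  | un (o : UnOp) (e : Expr) : Expr
  | bin (o : BinOp) (e₁ e₂ : Expr) : Expr

/-- A memory state. -/
abbrev State := ℕ → Val

namespace Expr

def eval (σ : State) : Expr → Val
  | var x => σ x
  | lit q => .num q
  | nil => .nil
  | un o e => o.apply (e.eval σ)
  | bin o e₁ e₂ => o.apply (e₁.eval σ) (e₂.eval σ)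

/-- Time to evaluate an expression: every node is charged one more than the bit size of its
value. -/
def cost (σ : State) : Expr → ℕ
  | var x => 1 + (σ x).size
  | lit q => 1 + (Val.num q).size
  | nil => 1 + Val.nil.size
  | un o e => e.cost σ + (1 + ((un o e).eval σ).size)
  | bin o e₁ e₂ => e₁.cost σ + e₂.cost σ + (1 + ((bin o e₁ e₂).eval σ).size)

end Expr

/-- Programs. `query x e` asks the oracle about the value of `e` and stores the one-bit answer in
the variable `x`. -/
inductive Cmd where
  | skip : Cmd
  | assign (x : ℕ) (e : Expr) : Cmd
  | query (x : ℕ) (e : Expr) : Cmd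
  | seq (c₁ c₂ : Cmd) : Cmd
  | ite (e : Expr) (c₁ c₂ : Cmd) : Cmd
  | loop (e : Expr) (c : Cmd) : Cmd

/-- `Exec O c σ t σ'`: with oracle `O`, the program `c` started in state `σ` halts after exactly
`t` time units in state `σ'`. -/
inductive Exec (O : Val → Bool) : Cmd → State → ℕ → State → Prop where
  | skip (σ : State) : Exec O .skip σ 1 σ
  | assign (σ : State) (x : ℕ) (e : Expr) :
      Exec O (.assign x e) σ (1 + e.cost σ) (Function.update σ x (e.eval σ))
  | query (σ : State) (x : ℕ) (e : Expr) :
      Exec O (.query x e) σ (1 + e.cost σ) (Function.update σ x (Val.ofBool (O (e.eval σ))))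
  | seq {σ σ₁ σ₂ : State} {t₁ t₂ : ℕ} {c₁ c₂ : Cmd} :
      Exec O c₁ σ t₁ σ₁ → Exec O c₂ σ₁ t₂ σ₂ → Exec O (.seq c₁ c₂) σ (t₁ + t₂) σ₂
  | iteTrue {σ σ' : State} {t : ℕ} {e : Expr} {c₁ c₂ : Cmd} :
      (e.eval σ).truth = true → Exec O c₁ σ t σ' →
      Exec O (.ite e c₁ c₂) σ (1 + e.cost σ + t) σ'
  | iteFalse {σ σ' : State} {t : ℕ} {e : Expr} {c₁ c₂ : Cmd} :
      (e.eval σ).truth = false → Exec O c₂ σ t σ' →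
      Exec O (.ite e c₁ c₂) σ (1 + e.cost σ + t) σ'
  | loopTrue {σ σ₁ σ₂ : State} {t₁ t₂ : ℕ} {e : Expr} {c : Cmd} :
      (e.eval σ).truth = true → Exec O c σ t₁ σ₁ → Exec O (.loop e c) σ₁ t₂ σ₂ →
      Exec O (.loop e c) σ (1 + e.cost σ + t₁ + t₂) σ₂
  | loopFalse {σ : State} {e : Expr} {c : Cmd} :
      (e.eval σ).truth = false → Exec O (.loop e c) σ (1 + e.cost σ) σ

/-- The initial state: the input is in variable `0`, all other variables hold `nil`. -/
def startState (input : Val) : State := fun x => if x = 0 then input else .nil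

/-! ### Convex objects -/

/-- Euclidean space of dimension `d`. -/
abbrev E (d : ℕ) := EuclideanSpace ℝ (Fin d)

/-- A rational vector, seen as a point of Euclidean space. -/
noncomputable def toPoint {d : ℕ} (y : Fin d → ℚ) : E d := WithLp.toLp 2 fun k => (y k : ℝ)

/-- The radius of the smallest ball that contains the body. -/
noncomputable def circumradius {d : ℕ} (K : ConvexBody (E d)) : ℝ :=
  sInf {r : ℝ | 0 ≤ r ∧ ∃ c : E d, (K : Set (E d)) ⊆ Metric.closedBall c r}

/-- The radius of the largest ball that is contained in the body. -/
noncomputable def inradius {d : ℕ} (K : ConvexBody (E d)) : ℝ :=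
  sSup {r : ℝ | 0 ≤ r ∧ ∃ c : E d, Metric.closedBall c r ⊆ (K : Set (E d))}

/-- `f`-fat bodies. -/
def IsFat {d : ℕ} (f : ℝ) (K : ConvexBody (E d)) : Prop :=
  0 < inradius K ∧ circumradius K / inradius K ≤ f

/-- The knapsack `[0,1]^d`. -/
def knapsack (d : ℕ) : Set (E d) := {x | ∀ k, 0 ≤ x k ∧ x k ≤ 1}

/-! ### The geometric knapsack problem -/

/-- An instance: finitely many convex bodies with rational profits. A body need not have a finite
description. Its explicit part is a rational ball that it contains; apart from that it is accessed
by a weak membership oracle (see `IsOracle`). -/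
structure Instance (d : ℕ) where
  n : ℕ
  body : Fin n → ConvexBody (E d)
  profit : Fin n → ℚ
  profit_nonneg : ∀ i, 0 ≤ profit i
  center : Fin n → Fin d → ℚ
  radius : Fin n → ℚ
  radius_pos : ∀ i, 0 < radius i
  ball_subset : ∀ i, Metric.closedBall (toPoint (center i)) (radius i : ℝ) ⊆ (body i : Set (E d))

namespace Instance

variable {d : ℕ}

/-- The explicit part of the input: for every object its profit and its inner ball. -/
def code (I : Instance d) : Val :=
  Val.ofList (List.ofFn fun i : Fin I.n =>
    Val.cons (.num (I.profit i)) (Val.cons (.num (I.radius i)) (Val.ofVec (I.center i))))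

/-- The query whether the point `y` is in the `i`-th object, up to precision `δ`. -/
def queryCode (I : Instance d) (i : Fin I.n) (y : Fin d → ℚ) (δ : ℚ) : Val :=
  Val.cons (.num ((i : ℕ) : ℚ)) (Val.cons (.num δ) (Val.ofVec y))

/-- `O` is a weak membership oracle for the objects: if it answers yes, the point has distance at
most `δ` from the object; if it answers no, the `δ`-ball around the point is not contained in the
object. In all other cases either answer is possible. -/
def IsOracle (I : Instance d) (O : Val → Bool) : Prop :=
  ∀ (i : Fin I.n) (y : Fin d → ℚ) (δ : ℚ), 0 < δ →
    (O (I.queryCode i y δ) = true → toPoint y ∈ Metric.cthickening (δ : ℝ) (I.body i : Set (E d))) ∧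
    (O (I.queryCode i y δ) = false →
      ¬ Metric.closedBall (toPoint y) (δ : ℝ) ⊆ (I.body i : Set (E d)))

/-- A placement `pl` selects the objects `i` with `pl i = some t` and translates them by `t`. It is
feasible if the translated objects are in the knapsack and do not overlap. -/
def Feasible (I : Instance d) (pl : Fin I.n → Option (E d)) : Prop :=
  (∀ i t, pl i = some t → t +ᵥ (I.body i : Set (E d)) ⊆ knapsack d) ∧
  ∀ i j s t, i ≠ j → pl i = some s → pl j = some t →
    Disjoint (interior (s +ᵥ (I.body i : Set (E d)))) (interior (t +ᵥ (I.body j : Set (E d))))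

/-- The total profit of the selected objects. -/
def totalProfit {α : Type*} (I : Instance d) (pl : Fin I.n → Option α) : ℚ :=
  ∑ i, if (pl i).isSome then I.profit i else 0

end Instance

/-- The output format for a placement with rational translation vectors: the list that has `nil`
for every object that is not selected and a pair of `nil` and the translation vector for every
object that is. -/
def placementCode {d n : ℕ} (pl : Fin n → Option (Fin d → ℚ)) : Val :=
  Val.ofList (List.ofFn fun i =>
    match pl i with
    | none => Val.nil
    | some t => Val.cons .nil (Val.ofVec t))

/-- The instances in the class `𝒞` have a polynomial-time `ρ`-approximation: one program computes
for each of them, with every weak membership oracle for its objects, a feasible placement whose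
profit is at least `1 / ρ` times that of every feasible placement, in time polynomial in the size of
the input. -/
def HasPolyTimeApprox (d : ℕ) (𝒞 : Set (Instance d)) (ρ : ℝ) : Prop :=
  ∃ (c : Cmd) (p : Polynomial ℕ), ∀ I ∈ 𝒞, ∀ O : Val → Bool, I.IsOracle O →
    ∃ (t : ℕ) (σ : State) (pl : Fin I.n → Option (Fin d → ℚ)),
      Exec O c (startState I.code) t σ ∧
      t ≤ p.eval I.code.size ∧
      σ 0 = placementCode pl ∧
      I.Feasible (fun i => (pl i).map toPoint) ∧
      ∀ pl' : Fin I.n → Option (E d), I.Feasible pl' →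
        (I.totalProfit pl' : ℝ) ≤ ρ * (I.totalProfit pl : ℝ)

end GeoKnapsack

/-! An optimal placement is compared with placements that respect a hierarchical grid, and the best
of the latter are found by dynamic programming. Write `h l` for `P.res l`. The cells of level `0`
are the unit cube, those of level `l + 1` have side `h l`, and each cell is divided into a constant
number of cells of the next level. An object is treated at the first level at which an accepted test
point is at sup-distance at least `Kf * h l` from its given center. Its size is then at least a
constant times `h l`, so by convexity and fatness the oracle's answers at constantly many grid
points describe it up to an error of order `h l`. Hence it can be replaced by a union of cells of
side `h l`, and only constantly many shapes (labels) occur.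

Dynamic program. A cell is opened by one of finitely many configurations, each of which packs it
with disjoint shapes and with whole cells of the next level. Free regions with the same label are
translates of each other and thus interchangeable, so a partial solution matters only through the
number of its regions of each label and through its profit. There are polynomially many vectors of
such numbers, and one best solution is kept for each. The number of levels is a constant plus a sum
of bit lengths taken from the inner radii. Soundness is `regionInv`: regions and placed objects stay
disjoint and inside the cube. Completeness is `GridPacking.hasState`: every placement on the grid is
matched in profit. For the running time, `PT` is closed under the usual program constructions, and
`sizeInv` with `TableOK.length_le` bounds all data along the run, which gives `PT.solve`.

A good grid placement exists (`Constants.exists_gridPacking`) by averaging arguments that each cost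
a factor `1 + 4ε` (`exists_good_choice`). (1) In each coordinate there is room for about `1/(2ε)`
candidate strips such that no object obstructs two of them. Deleting the obstructing objects of a
cheap strip and closing it gains slack `η`, which replaces resource augmentation
(`Separated.exists_slack`). The slack is spent on dilating the positions, which separates fat
objects by a distance proportional to their size and pushes them away from the boundary
(`Separated.exists_spread`). (2) Of `N` offsets for the sequence of resolutions, one makes most
objects much smaller than the cells of their level (`exists_offset`). (3) Of `m` translations of the
whole placement, one keeps most objects away from the boundaries of the cells of their level
(`exists_shift`). The program tries all offsets; the translation occurs only in the analysis. With
`d` coordinates the total loss is `(1 + 4ε) ^ (d + 2)`, which is at most `1 + 4 * 4 ^ (d + 2) * ε`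
since `ε < 1/2`. -/

namespace GeoKnapsack

/-! ### Typed data and their codes -/

/-- Types whose elements are represented by values of the machine. -/
class Enc (α : Type) where
  enc : α → Val

open Enc

instance : Enc Val := ⟨id⟩
instance : Enc ℚ := ⟨Val.num⟩
instance : Enc ℕ := ⟨fun n => .num n⟩
instance : Enc ℤ := ⟨fun n => .num n⟩
instance : Enc Bool := ⟨Val.ofBool⟩
instance : Enc Unit := ⟨fun _ => .nil⟩
instance {α β : Type} [Enc α] [Enc β] : Enc (α × β) := ⟨fun p => .cons (enc p.1) (enc p.2)⟩
instance {α : Type} [Enc α] : Enc (List α) := ⟨fun l => Val.ofList (l.map enc)⟩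
instance {α : Type} [Enc α] : Enc (Option α) :=
  ⟨fun o => match o with
    | none => .nil
    | some a => .cons .nil (enc a)⟩
instance {α : Type} [Enc α] {d : ℕ} : Enc (Fin d → α) :=
  ⟨fun v => Val.ofList (List.ofFn fun k => enc (v k))⟩

/-- The bit size of the code of an element. -/
def esize {α : Type} [Enc α] (a : α) : ℕ := (enc a).size

/-! ### Bit sizes of codes and of rational arithmetic -/

section Sizes

variable {α β : Type} [Enc α] [Enc β]

theorem esize_pair (a : α) (b : β) : esize (a, b) = 1 + esize a + esize b := rfl

theorem esize_nil : esize ([] : List α) = 1 := rfl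

theorem esize_cons (a : α) (l : List α) : esize (a :: l) = 1 + esize a + esize l := rfl

theorem esize_list (l : List α) : esize l = 1 + (l.map fun a => 1 + esize a).sum := by
  induction l with
  | nil => rfl
  | cons a l ih => rw [esize_cons, ih]; simp; omega

theorem esize_append (l m : List α) : esize (l ++ m) + 1 = esize l + esize m := by
  simp only [esize_list, List.map_append, List.sum_append]; omega

theorem esize_reverse (l : List α) : esize l.reverse = esize l := by
  simp [esize_list, List.map_reverse, List.sum_reverse]

theorem esize_le_of_sublist {l m : List α} (h : l.Sublist m) : esize l ≤ esize m := by
  induction h with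
  | slnil => rfl
  | cons a _ ih => rw [esize_cons]; omega
  | cons_cons a _ ih => rw [esize_cons, esize_cons]; omega

theorem esize_perm {l m : List α} (h : l.Perm m) : esize l = esize m := by
  rw [esize_list, esize_list, (h.map _).sum_eq]

theorem esize_mem {a : α} {l : List α} (h : a ∈ l) : esize a < esize l := by
  induction l with
  | nil => simp at h
  | cons b l ih =>
    rw [esize_cons]
    rcases List.mem_cons.1 h with rfl | h
    · omega
    · have := ih h; omega

theorem length_lt_esize (l : List α) : l.length < esize l := by
  induction l with
  | nil => simp [esize_nil]
  | cons b l ih => rw [esize_cons, List.length_cons]; omega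

theorem esize_list_le {l : List α} {B : ℕ} (h : ∀ a ∈ l, esize a ≤ B) :
    esize l ≤ 1 + l.length * (1 + B) := by
  induction l with
  | nil => simp [esize_nil]
  | cons b l ih =>
    have h1 := h b (by simp)
    have h2 := ih fun a ha => h a (by simp [ha])
    rw [esize_cons, List.length_cons, Nat.succ_mul]; omega

theorem esize_bool_le (b : Bool) : esize b ≤ 3 := by
  cases b <;> decide

theorem esize_vec_le {d : ℕ} {v : Fin d → α} {B : ℕ} (h : ∀ k, esize (v k) ≤ B) :
    esize v ≤ 1 + d * (1 + B) := by
  have : esize v = esize (List.ofFn v) := by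
    simp only [esize, enc, List.map_ofFn]; rfl
  rw [this]
  refine (esize_list_le (B := B) ?_).trans (by simp)
  intro a ha
  obtain ⟨k, rfl⟩ := (List.mem_ofFn' v a).1 ha
  exact h k

theorem esize_vec_apply_le {d : ℕ} (v : Fin d → α) (k : Fin d) : esize (v k) ≤ esize v := by
  have : esize v = esize (List.ofFn v) := by
    simp only [esize, enc, List.map_ofFn]; rfl
  rw [this]
  exact (esize_mem ((List.mem_ofFn' v _).2 ⟨k, rfl⟩)).le

theorem esize_rat (q : ℚ) : esize q = 1 + Nat.size q.num.natAbs + Nat.size q.den := rfl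

theorem esize_nat (n : ℕ) : esize n = 2 + Nat.size n := by
  change esize (n : ℚ) = _
  rw [esize_rat]; simp; omega

end Sizes

theorem Nat.size_mul_le (a b : ℕ) : Nat.size (a * b) ≤ Nat.size a + Nat.size b := by
  rw [Nat.size_le, pow_add]
  exact Nat.mul_lt_mul'' (Nat.lt_size_self a) (Nat.lt_size_self b)

theorem Nat.size_add_le (a b : ℕ) : Nat.size (a + b) ≤ max (Nat.size a) (Nat.size b) + 1 := by
  rw [Nat.size_le, pow_succ]
  have h1 : a < 2 ^ max (Nat.size a) (Nat.size b) :=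
    (Nat.lt_size_self a).trans_le (Nat.pow_le_pow_right (by norm_num) (le_max_left _ _))
  have h2 : b < 2 ^ max (Nat.size a) (Nat.size b) :=
    (Nat.lt_size_self b).trans_le (Nat.pow_le_pow_right (by norm_num) (le_max_right _ _))
  omega

theorem Nat.size_le_self_add_one (a : ℕ) : Nat.size a ≤ a := by
  rw [Nat.size_le]; exact Nat.lt_two_pow_self

/-- The size of a fraction that need not be in lowest terms. -/
theorem esize_div_le (z : ℤ) (D : ℕ) (hD : 0 < D) :
    esize ((z : ℚ) / D) ≤ 1 + Nat.size z.natAbs + Nat.size D := by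
  rw [esize_rat]
  have h1 : (((z : ℚ) / (D : ℤ)).den : ℤ) ∣ (D : ℤ) := by
    simpa [Rat.divInt_eq_div] using Rat.den_dvd z D
  have h2 : ((z : ℚ) / (D : ℤ)).num ∣ z := by
    simpa [Rat.divInt_eq_div] using Rat.num_dvd z (b := (D : ℤ)) (by exact_mod_cast hD.ne')
  have h3 : ((z : ℚ) / (D : ℤ)) = (z : ℚ) / D := by norm_cast
  rw [h3] at h1 h2
  have h4 : ((z : ℚ) / D).den ≤ D := Nat.le_of_dvd hD (by exact_mod_cast h1)
  have h5 : ((z : ℚ) / D).num.natAbs ≤ z.natAbs := by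
    rcases eq_or_ne z 0 with rfl | hz
    · simp
    · exact Nat.le_of_dvd (Int.natAbs_pos.2 hz) (Int.natAbs_dvd_natAbs.2 h2)
  have := Nat.size_le_size h4
  have := Nat.size_le_size h5
  omega

/-- Numerator and denominator of the sum can each be about as long as both summands together, whence
the factor 2. Iterating this bound gives exponential growth, so sums accumulated in a loop need a
separate size bound. -/
theorem esize_add_le (a b : ℚ) : esize (a + b) ≤ 2 * (esize a + esize b) := by
  have h : a + b = ((a.num * b.den + b.num * a.den : ℤ) : ℚ) / ((a.den * b.den : ℕ) : ℚ) := by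
    conv_lhs => rw [← Rat.num_div_den a, ← Rat.num_div_den b]
    have h1 : (a.den : ℚ) ≠ 0 := by exact_mod_cast a.den_ne_zero
    have h2 : (b.den : ℚ) ≠ 0 := by exact_mod_cast b.den_ne_zero
    push_cast
    field_simp
  rw [h]
  refine (esize_div_le _ _ (Nat.mul_pos a.den_pos b.den_pos)).trans ?_
  have h1 := Nat.size_mul_le a.den b.den
  have h2 : Nat.size (a.num * b.den + b.num * a.den).natAbs ≤
      max (Nat.size a.num.natAbs + Nat.size b.den) (Nat.size b.num.natAbs + Nat.size a.den) + 1 := by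
    refine (Nat.size_le_size (Int.natAbs_add_le _ _)).trans ((Nat.size_add_le _ _).trans ?_)
    rw [Int.natAbs_mul, Int.natAbs_mul, Int.natAbs_natCast, Int.natAbs_natCast]
    have := Nat.size_mul_le a.num.natAbs b.den
    have := Nat.size_mul_le b.num.natAbs a.den
    omega
  rw [esize_rat, esize_rat]
  omega

theorem esize_neg (a : ℚ) : esize (-a) = esize a := by
  simp [esize_rat]

theorem esize_sub_le (a b : ℚ) : esize (a - b) ≤ 2 * (esize a + esize b) := by
  rw [sub_eq_add_neg, ← esize_neg b]; exact esize_add_le _ _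

theorem esize_mul_le (a b : ℚ) : esize (a * b) ≤ esize a + esize b := by
  have h : a * b = ((a.num * b.num : ℤ) : ℚ) / ((a.den * b.den : ℕ) : ℚ) := by
    conv_lhs => rw [← Rat.num_div_den a, ← Rat.num_div_den b]
    push_cast
    rw [div_mul_div_comm]
  rw [h]
  refine (esize_div_le _ _ (Nat.mul_pos a.den_pos b.den_pos)).trans ?_
  have h1 := Nat.size_mul_le a.den b.den
  rw [Int.natAbs_mul]
  have h2 := Nat.size_mul_le a.num.natAbs b.num.natAbs
  rw [esize_rat, esize_rat]
  omega

theorem esize_inv (a : ℚ) : esize a⁻¹ ≤ esize a + 1 := by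
  rw [esize_rat, esize_rat]
  rcases eq_or_ne a 0 with rfl | ha
  · simp
  · rw [Rat.num_inv, Rat.den_inv_of_ne_zero ha]
    have : (a.num.sign * a.den).natAbs = a.den := by
      rw [Int.natAbs_mul, Int.natAbs_sign_of_ne_zero (Rat.num_ne_zero.2 ha)]; simp
    rw [this]; omega

theorem esize_div_rat_le (a b : ℚ) : esize (a / b) ≤ esize a + esize b + 1 := by
  rw [div_eq_mul_inv]
  have := esize_mul_le a b⁻¹
  have := esize_inv b
  omega

/-! ### Quantities computable in polynomial time -/

/-- A family of machine inputs: a measure for the running time and an oracle for each index. -/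
structure Ctx (ι : Type) where
  size : ι → ℕ
  oracle : ι → Val → Bool

namespace Ctx

variable {ι κ : Type}

def comap (K : Ctx ι) (g : κ → ι) : Ctx κ := ⟨fun i => K.size (g i), fun i => K.oracle (g i)⟩

/-- Numbers that are polynomially bounded in the measure. -/
def Bd (K : Ctx ι) (g : ι → ℕ) : Prop := ∃ p : Polynomial ℕ, ∀ i, g i ≤ p.eval (K.size i)

variable {K : Ctx ι} {g h : ι → ℕ}

theorem Bd.mono (hg : K.Bd g) (hle : ∀ i, h i ≤ g i) : K.Bd h :=
  let ⟨p, hp⟩ := hg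
  ⟨p, fun i => (hle i).trans (hp i)⟩

theorem Bd.const (n : ℕ) : K.Bd fun _ => n := ⟨Polynomial.C n, fun i => by simp⟩

theorem Bd.add (hg : K.Bd g) (hh : K.Bd h) : K.Bd fun i => g i + h i := by
  obtain ⟨p, hp⟩ := hg
  obtain ⟨q, hq⟩ := hh
  exact ⟨p + q, fun i => by rw [Polynomial.eval_add]; exact add_le_add (hp i) (hq i)⟩

theorem Bd.mul (hg : K.Bd g) (hh : K.Bd h) : K.Bd fun i => g i * h i := by
  obtain ⟨p, hp⟩ := hg
  obtain ⟨q, hq⟩ := hh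
  exact ⟨p * q, fun i => by rw [Polynomial.eval_mul]; exact Nat.mul_le_mul (hp i) (hq i)⟩

theorem Bd.pow (hg : K.Bd g) (n : ℕ) : K.Bd fun i => g i ^ n := by
  obtain ⟨p, hp⟩ := hg
  exact ⟨p ^ n, fun i => by rw [Polynomial.eval_pow]; exact Nat.pow_le_pow_left (hp i) n⟩

theorem Bd.comap (hg : K.Bd g) (u : κ → ι) : (K.comap u).Bd fun i => g (u i) :=
  let ⟨p, hp⟩ := hg
  ⟨p, fun i => hp (u i)⟩

end Ctx

/-- `PT K X Y`: some program computes (the code of) `Y` from (the code of) `X` in polynomial time.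
It works in the variables from number `b` on, whatever their contents are. -/
structure PT {ι α β : Type} [Enc α] [Enc β] (K : Ctx ι) (X : ι → α) (Y : ι → β) : Prop where
  run : ∀ b : ℕ, ∃ c : Cmd, ∃ T : ι → ℕ, K.Bd T ∧ ∀ i σ, σ b = enc (X i) →
    ∃ t σ', Exec (K.oracle i) c σ t σ' ∧ t ≤ T i ∧ σ' b = enc (Y i) ∧ ∀ x < b, σ' x = σ x
  bd_left : K.Bd fun i => esize (X i)
  bd_right : K.Bd fun i => esize (Y i)

namespace PT

variable {ι κ α β γ δ : Type} [Enc α] [Enc β] [Enc γ] [Enc δ] {K : Ctx ι}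
  {X : ι → α} {Y : ι → β} {Z : ι → γ}

/-- The polynomials are uniform in the index, so any reindexing is harmless. Bodies of loops are
treated by passing to an index type that also records the position in the loop. -/
theorem comap (h : PT K X Y) (g : κ → ι) : PT (K.comap g) (fun i => X (g i)) fun i => Y (g i) where
  run b := by
    obtain ⟨c, T, hT, hc⟩ := h.run b
    exact ⟨c, fun i => T (g i), hT.comap g, fun i σ hσ => hc (g i) σ hσ⟩
  bd_left := h.bd_left.comap g
  bd_right := h.bd_right.comap g

theorem congr (h : PT K X Y) {Y' : ι → γ} (e : ∀ i, enc (Y' i) = enc (Y i)) : PT K X Y' where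
  run b := by
    obtain ⟨c, T, hT, hc⟩ := h.run b
    refine ⟨c, T, hT, fun i σ hσ => ?_⟩
    rw [e]
    exact hc i σ hσ
  bd_left := h.bd_left
  bd_right := h.bd_right.mono fun i => by rw [esize, e]; rfl

theorem comp (h : PT K X Y) (h' : PT K Y Z) : PT K X Z where
  run b := by
    obtain ⟨c, T, hT, hc⟩ := h.run b
    obtain ⟨c', T', hT', hc'⟩ := h'.run b
    refine ⟨.seq c c', _, hT.add hT', fun i σ hσ => ?_⟩
    obtain ⟨t, σ₁, e, ht, hY, hf⟩ := hc i σ hσ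
    obtain ⟨t', σ₂, e', ht', hZ, hf'⟩ := hc' i σ₁ hY
    exact ⟨_, σ₂, .seq e e', add_le_add ht ht', hZ, fun x hx => (hf' x hx).trans (hf x hx)⟩
  bd_left := h.bd_left
  bd_right := h'.bd_right

theorem of_expr (hX : K.Bd fun i => esize (X i)) (hY : K.Bd fun i => esize (Y i))
    (e : ℕ → Expr) (T : ι → ℕ) (hT : K.Bd T)
    (h : ∀ (b : ℕ) (i : ι) (σ : State), σ b = enc (X i) →
      (e b).eval σ = enc (Y i) ∧ (e b).cost σ ≤ T i) : PT K X Y where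
  run b := by
    refine ⟨.assign b (e b), _, (Ctx.Bd.const 1).add hT, fun i σ hσ => ?_⟩
    obtain ⟨h1, h2⟩ := h b i σ hσ
    refine ⟨_, _, .assign σ b (e b), by omega, by simp [h1], fun x hx => ?_⟩
    rw [Function.update_of_ne hx.ne]
  bd_left := hX
  bd_right := hY

theorem id (hX : K.Bd fun i => esize (X i)) : PT K X X :=
  of_expr hX hX .var _ ((Ctx.Bd.const 1).add hX) fun b i σ hσ => by
    simp [Expr.eval, Expr.cost, hσ, esize]

theorem exists_expr (v : Val) : ∃ e : Expr, ∃ T, ∀ σ, e.eval σ = v ∧ e.cost σ = T := by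
  induction v with
  | num q => exact ⟨.lit q, _, fun σ => ⟨rfl, rfl⟩⟩
  | nil => exact ⟨.nil, _, fun σ => ⟨rfl, rfl⟩⟩
  | cons a b iha ihb =>
    obtain ⟨e, T, h⟩ := iha
    obtain ⟨e', T', h'⟩ := ihb
    refine ⟨.bin .cons e e', T + T' + (1 + (Val.cons a b).size), fun σ => ⟨?_, ?_⟩⟩
    · simp [Expr.eval, BinOp.apply, h, h']
    · simp [Expr.eval, Expr.cost, BinOp.apply, h, h']

theorem const (hX : K.Bd fun i => esize (X i)) (a : β) : PT K X fun _ => a := by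
  obtain ⟨e, T, h⟩ := exists_expr (enc a)
  exact of_expr hX (.const _) (fun _ => e) (fun _ => T) (.const _) fun b i σ _ =>
    ⟨(h σ).1, (h σ).2.le⟩

theorem unop (o : UnOp) (h : PT K X Y) (hZ : ∀ i, enc (Z i) = o.apply (enc (Y i)))
    (hb : K.Bd fun i => esize (Z i)) : PT K X Z := by
  refine h.comp (of_expr h.bd_right hb (fun b => .un o (.var b)) _
    (((Ctx.Bd.const 1).add h.bd_right).add ((Ctx.Bd.const 1).add hb)) fun b i σ hσ => ?_)
  simp only [Expr.eval, Expr.cost, hσ, esize, hZ]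
  exact ⟨trivial, le_rfl⟩

/-- Each component is computed on its own copy of the input, in `b + 1` and then in `b + 2`; since a
program leaves the variables below its base alone, the input in `b` and the first result survive. -/
theorem pair (h : PT K X Y) (h' : PT K X Z) : PT K X fun i => (Y i, Z i) where
  run b := by
    obtain ⟨c, T, hT, hc⟩ := h.run (b + 1)
    obtain ⟨c', T', hT', hc'⟩ := h'.run (b + 2)
    refine ⟨.seq (.assign (b + 1) (.var b)) (.seq c (.seq (.assign (b + 2) (.var b)) (.seq c'
      (.assign b (.bin .cons (.var (b + 1)) (.var (b + 2))))))),
      fun i => 5 + 2 * esize (X i) + T i + T' i + (4 + (2 * esize (Y i) + 2 * esize (Z i))),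
      ((((Ctx.Bd.const 5).add ((Ctx.Bd.const 2).mul h.bd_left)).add hT).add hT').add
      ((Ctx.Bd.const 4).add (((Ctx.Bd.const 2).mul h.bd_right).add
        ((Ctx.Bd.const 2).mul h'.bd_right))), fun i σ hσ => ?_⟩
    obtain ⟨t, σ₁, e, ht, hY, hf⟩ := hc i (Function.update σ (b + 1) ((Expr.var b).eval σ))
      (by simp [Expr.eval, hσ])
    have hb1 : σ₁ b = enc (X i) := by
      rw [hf b (by omega), Function.update_of_ne (by omega), hσ]
    obtain ⟨t', σ₂, e', ht', hZ, hf'⟩ := hc' i (Function.update σ₁ (b + 2) ((Expr.var b).eval σ₁))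
      (by simp [Expr.eval, hb1])
    have hb2 : σ₂ (b + 1) = enc (Y i) := by
      rw [hf' _ (by omega), Function.update_of_ne (by omega), hY]
    refine ⟨_, _, .seq (.assign _ _ _) (.seq e (.seq (.assign _ _ _) (.seq e' (.assign _ _ _)))),
      ?_, ?_, fun x hx => ?_⟩
    · simp only [Expr.cost, Expr.eval, hσ, hb1, hb2, hZ, BinOp.apply, Val.size, esize]
      omega
    · simp [Expr.eval, hb2, hZ, BinOp.apply, enc]
    · rw [Function.update_of_ne hx.ne, hf' x (by omega), Function.update_of_ne (by omega),
        hf x (by omega), Function.update_of_ne (by omega)]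
  bd_left := h.bd_left
  bd_right := ((Ctx.Bd.const 1).add (h.bd_right.add h'.bd_right)).mono fun i => by
    rw [esize_pair]; omega

theorem fst {Y : ι → β × γ} (h : PT K X Y) : PT K X fun i => (Y i).1 :=
  h.unop .head (fun _ => rfl) (h.bd_right.mono fun i => by
    change _ ≤ esize ((Y i).1, (Y i).2); rw [esize_pair]; omega)

theorem snd {Y : ι → β × γ} (h : PT K X Y) : PT K X fun i => (Y i).2 :=
  h.unop .tail (fun _ => rfl) (h.bd_right.mono fun i => by
    change _ ≤ esize ((Y i).1, (Y i).2); rw [esize_pair]; omega)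

theorem binop {W : ι → δ} (o : BinOp) (h : PT K X Y) (h' : PT K X Z)
    (hW : ∀ i, enc (W i) = o.apply (enc (Y i)) (enc (Z i)))
    (hb : K.Bd fun i => esize (W i)) : PT K X W := by
  have hp := h.pair h'
  refine hp.comp (of_expr hp.bd_right hb
    (fun b => .bin o (.un .head (.var b)) (.un .tail (.var b))) _
    (((Ctx.Bd.const 6).add ((Ctx.Bd.const 3).mul hp.bd_right)).add ((Ctx.Bd.const 1).add hb))
    fun b i σ hσ => ?_)
  simp only [Expr.eval, Expr.cost, hσ, esize, UnOp.apply, hW, enc, Val.head, Val.tail, Val.size]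
  refine ⟨trivial, by omega⟩

theorem query (h : PT K X Y) : PT K X fun i => K.oracle i (enc (Y i)) := by
  refine h.comp ⟨fun b => ⟨.query b (.var b), _, (Ctx.Bd.const 2).add h.bd_right,
    fun i σ hσ => ⟨_, _, .query _ _ _, ?_, ?_, fun x hx => ?_⟩⟩, h.bd_right,
    (Ctx.Bd.const 3).mono fun i => esize_bool_le _⟩
  · simp only [Expr.cost, hσ, esize]; omega
  · simp [Expr.eval, hσ]; rfl
  · rw [Function.update_of_ne hx.ne]

/-- Case distinction by the truth value of a code. -/
theorem ite_truth (h : PT K X Y) (p : ι → Prop) [DecidablePred p]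
    (hp : ∀ i, (enc (Y i)).truth = decide (p i))
    {A B : ι → γ} (hA : PT (K.comap fun i : {i // p i} => i.1) (fun i => X i.1) fun i => A i.1)
    (hB : PT (K.comap fun i : {i // ¬ p i} => i.1) (fun i => X i.1) fun i => B i.1) :
    PT K X fun i => if p i then A i else B i where
  run b := by
    obtain ⟨c, T, hT, hc⟩ := h.run (b + 1)
    obtain ⟨c₁, T₁, ⟨p₁, hT₁⟩, hc₁⟩ := hA.run b
    obtain ⟨c₂, T₂, ⟨p₂, hT₂⟩, hc₂⟩ := hB.run b
    refine ⟨.seq (.assign (b + 1) (.var b)) (.seq c (.ite (.var (b + 1)) c₁ c₂)),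
      fun i => 4 + esize (X i) + T i + esize (Y i) +
        (p₁.eval (K.size i) + p₂.eval (K.size i)),
      ((((Ctx.Bd.const 4).add h.bd_left).add hT).add h.bd_right).add
        (Ctx.Bd.add ⟨p₁, fun _ => le_rfl⟩ ⟨p₂, fun _ => le_rfl⟩), fun i σ hσ => ?_⟩
    obtain ⟨t, σ₁, e, ht, hY, hf⟩ := hc i (Function.update σ (b + 1) ((Expr.var b).eval σ))
      (by simp [Expr.eval, hσ])
    have hb1 : σ₁ b = enc (X i) := by
      rw [hf b (by omega), Function.update_of_ne (by omega), hσ]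
    have hfr : ∀ x < b, σ₁ x = σ x := fun x hx => by
      rw [hf x (by omega), Function.update_of_ne (by omega)]
    have htr : ((Expr.var (b + 1)).eval σ₁).truth = decide (p i) := by
      simp [Expr.eval, hY, hp]
    by_cases hpi : p i
    · obtain ⟨t₁, σ₂, e₁, ht₁, hA₁, hf₁⟩ := hc₁ ⟨i, hpi⟩ σ₁ hb1
      refine ⟨_, σ₂, .seq (.assign _ _ _) (.seq e (.iteTrue (by simp [htr, hpi]) e₁)), ?_, ?_,
        fun x hx => (hf₁ x hx).trans (hfr x hx)⟩
      · have := hT₁ ⟨i, hpi⟩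
        simp only [Expr.cost, hσ, hY, esize, Ctx.comap] at *
        omega
      · simp [hpi, hA₁]
    · obtain ⟨t₁, σ₂, e₁, ht₁, hA₁, hf₁⟩ := hc₂ ⟨i, hpi⟩ σ₁ hb1
      refine ⟨_, σ₂, .seq (.assign _ _ _) (.seq e (.iteFalse (by simp [htr, hpi]) e₁)), ?_, ?_,
        fun x hx => (hf₁ x hx).trans (hfr x hx)⟩
      · have := hT₂ ⟨i, hpi⟩
        simp only [Expr.cost, hσ, hY, esize, Ctx.comap] at *
        omega
      · simp [hpi, hA₁]
  bd_left := h.bd_left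
  bd_right := by
    obtain ⟨p₁, h₁⟩ := hA.bd_right
    obtain ⟨p₂, h₂⟩ := hB.bd_right
    refine ⟨p₁ + p₂, fun i => ?_⟩
    rw [Polynomial.eval_add]
    by_cases hpi : p i
    · have := h₁ ⟨i, hpi⟩
      simp only [hpi, if_true, Ctx.comap] at *
      omega
    · have := h₂ ⟨i, hpi⟩
      simp only [hpi, if_false, Ctx.comap] at *
      omega

theorem ite {p : ι → Prop} [DecidablePred p] (h : PT K X fun i => decide (p i))
    {A B : ι → γ} (hA : PT K X A) (hB : PT K X B) : PT K X fun i => if p i then A i else B i :=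
  h.ite_truth p (fun i => by simp only [enc]; cases decide (p i) <;> rfl) (hA.comap _) (hB.comap _)

/-- Loops. The `j`-th state of the loop is `S i j`. -/
theorem loop {S : ι → ℕ → β} {k : ι → ℕ} {Z : ι → ℕ → γ}
    (h0 : PT K X fun i => S i 0) (hk : K.Bd k)
    (hS : (K.comap fun q : {q : ι × ℕ // q.2 ≤ k q.1} => q.1.1).Bd fun q => esize (S q.1.1 q.1.2))
    (hZ : PT (K.comap fun q : {q : ι × ℕ // q.2 ≤ k q.1} => q.1.1)
      (fun q => (X q.1.1, S q.1.1 q.1.2)) fun q => Z q.1.1 q.1.2)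
    (ht : ∀ i, ∀ j ≤ k i, (enc (Z i j)).truth = decide (j < k i))
    (hf : PT (K.comap fun q : {q : ι × ℕ // q.2 < k q.1} => q.1.1)
      (fun q => (X q.1.1, S q.1.1 q.1.2)) fun q => S q.1.1 (q.1.2 + 1)) :
    PT K X fun i => S i (k i) where
  run b := by
    obtain ⟨c₀, T₀, hT₀, hc₀⟩ := h0.run (b + 1)
    obtain ⟨c₁, T₁, ⟨p₁, hT₁⟩, hc₁⟩ := hZ.run (b + 2)
    obtain ⟨c₂, T₂, ⟨p₂, hT₂⟩, hc₂⟩ := hf.run (b + 2)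
    obtain ⟨pS, hpS⟩ := hS
    obtain ⟨pZ, hpZ⟩ := hZ.bd_right
    have hpS' : ∀ i j, j ≤ k i → esize (S i j) ≤ pS.eval (K.size i) := fun i j hj => hpS ⟨(i, j), hj⟩
    have hpZ' : ∀ i j, j ≤ k i → esize (Z i j) ≤ pZ.eval (K.size i) := fun i j hj => hpZ ⟨(i, j), hj⟩
    -- Variable `b` keeps the input and `b + 1` the loop state; `b + 2` is scratch space for
    -- arguments and holds the value of the loop condition between rounds.
    let tst : Cmd := .seq (.assign (b + 2) (.bin .cons (.var b) (.var (b + 1)))) c₁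
    let body : Cmd := .seq (.assign (b + 2) (.bin .cons (.var b) (.var (b + 1))))
      (.seq c₂ (.seq (.assign (b + 1) (.var (b + 2))) tst))
    let τ : ι → ℕ := fun i => 5 + 2 * esize (X i) + 2 * pS.eval (K.size i) + p₁.eval (K.size i)
    let τ' : ι → ℕ := fun i => 10 + 2 * esize (X i) + 3 * pS.eval (K.size i) +
      p₂.eval (K.size i) + τ i
    have hev : ∀ p : Polynomial ℕ, K.Bd fun i => p.eval (K.size i) := fun p => ⟨p, fun _ => le_rfl⟩
    have hτ : K.Bd τ := ((((Ctx.Bd.const 5).add ((Ctx.Bd.const 2).mul h0.bd_left)).add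
      ((Ctx.Bd.const 2).mul (hev pS))).add (hev p₁))
    have hτ' : K.Bd τ' := ((((Ctx.Bd.const 10).add ((Ctx.Bd.const 2).mul h0.bd_left)).add
      ((Ctx.Bd.const 3).mul (hev pS))).add (hev p₂)).add hτ
    have htst : ∀ i j, j ≤ k i → ∀ σ : State, σ b = enc (X i) → σ (b + 1) = enc (S i j) →
        ∃ t σ', Exec (K.oracle i) tst σ t σ' ∧ t ≤ τ i ∧ σ' (b + 2) = enc (Z i j) ∧
          ∀ x < b + 2, σ' x = σ x := by
      intro i j hj σ h1 h2
      obtain ⟨t, σ', e, ht, hz, hfr⟩ := hc₁ ⟨(i, j), hj⟩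
        (Function.update σ (b + 2) (.cons (σ b) (σ (b + 1)))) (by simp [h1, h2, enc])
      refine ⟨_, σ', .seq (.assign _ _ _) e, ?_, hz, fun x hx => ?_⟩
      · have := hT₁ ⟨(i, j), hj⟩
        have := hpS' i j hj
        simp only [Expr.cost, Expr.eval, BinOp.apply, h1, h2, esize, Ctx.comap, Val.size, τ] at *
        omega
      · rw [hfr x hx, Function.update_of_ne (by omega)]
    -- Here `m` is the number of remaining rounds; the condition is evaluated once more than the
    -- body, whence `m + 1`.
    have hloop : ∀ i m j, j + m = k i → ∀ σ : State, σ b = enc (X i) → σ (b + 1) = enc (S i j) →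
        σ (b + 2) = enc (Z i j) → ∃ t σ', Exec (K.oracle i) (.loop (.var (b + 2)) body) σ t σ' ∧
          t ≤ (m + 1) * (2 + pZ.eval (K.size i)) + m * τ' i ∧ σ' (b + 1) = enc (S i (k i)) ∧
          ∀ x < b + 1, σ' x = σ x := by
      intro i m
      induction m with
      | zero =>
        intro j hj σ h1 h2 h3
        have hjk : j = k i := by omega
        subst hjk
        refine ⟨_, σ, .loopFalse ?_, ?_, h2, fun _ _ => rfl⟩
        · simp [Expr.eval, h3, ht i (k i) le_rfl]
        · have := hpZ' i (k i) le_rfl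
          simp only [Expr.cost, h3, esize] at *
          omega
      | succ m ih =>
        intro j hj σ h1 h2 h3
        have hjk : j < k i := by omega
        obtain ⟨t₂, σ₂, e₂, ht₂, hs₂, hfr₂⟩ := hc₂ ⟨(i, j), hjk⟩
          (Function.update σ (b + 2) (.cons (σ b) (σ (b + 1)))) (by simp [h1, h2, enc])
        have hfr2' : ∀ x < b + 2, σ₂ x = σ x := fun x hx => by
          rw [hfr₂ x hx, Function.update_of_ne (by omega)]
        obtain ⟨t₃, σ₃, e₃, ht₃, hs₃, hfr₃⟩ := htst i (j + 1) hjk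
          (Function.update σ₂ (b + 1) (σ₂ (b + 2)))
          (by rw [Function.update_of_ne (by omega), hfr2' b (by omega), h1])
          (by simp [hs₂])
        have hX3 : σ₃ b = enc (X i) := by
          rw [hfr₃ b (by omega), Function.update_of_ne (by omega), hfr2' b (by omega), h1]
        have hS3 : σ₃ (b + 1) = enc (S i (j + 1)) := by
          rw [hfr₃ (b + 1) (by omega)]; simp [hs₂]
        obtain ⟨t₄, σ₄, e₄, ht₄, hs₄, hfr₄⟩ := ih (j + 1) (by omega) σ₃ hX3 hS3 hs₃
        have hbody : Exec (K.oracle i) body σ _ σ₃ :=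
          .seq (.assign _ _ _) (.seq e₂ (.seq (.assign _ _ _) e₃))
        refine ⟨_, σ₄, .loopTrue ?_ hbody e₄, ?_, hs₄, fun x hx => ?_⟩
        · simp [Expr.eval, h3, ht i j hjk.le, hjk]
        · have a1 := hT₂ ⟨(i, j), hjk⟩
          have a2 := hpS' i j hjk.le
          have a3 := hpS' i (j + 1) hjk
          have a4 := hpZ' i j hjk.le
          have a5 : (m + 1 + 1) * (2 + pZ.eval (K.size i)) + (m + 1) * τ' i =
            ((m + 1) * (2 + pZ.eval (K.size i)) + m * τ' i) + ((2 + pZ.eval (K.size i)) + τ' i) := by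
            ring
          rw [a5]
          simp only [Expr.cost, Expr.eval, BinOp.apply, h1, h2, h3, hs₂, esize, Ctx.comap,
            Val.size, τ'] at *
          omega
        · rw [hfr₄ x hx, hfr₃ x (by omega), Function.update_of_ne (by omega), hfr2' x (by omega)]
    refine ⟨.seq (.assign (b + 1) (.var b)) (.seq c₀ (.seq tst (.seq (.loop (.var (b + 2)) body)
      (.assign b (.var (b + 1)))))), fun i => 10 + esize (X i) + T₀ i + τ i +
        ((k i + 1) * (2 + pZ.eval (K.size i)) + k i * τ' i) + pS.eval (K.size i), ?_,
        fun i σ hσ => ?_⟩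
    · exact ((((Ctx.Bd.const 10).add h0.bd_left).add hT₀).add hτ).add
        (((hk.add (.const 1)).mul ((Ctx.Bd.const 2).add (hev pZ))).add (hk.mul hτ')) |>.add (hev pS)
    · obtain ⟨t₀, σ₀, e₀, ht₀, hs₀, hfr₀⟩ := hc₀ i
        (Function.update σ (b + 1) ((Expr.var b).eval σ)) (by simp [Expr.eval, hσ])
      have hX0 : σ₀ b = enc (X i) := by
        rw [hfr₀ b (by omega), Function.update_of_ne (by omega), hσ]
      obtain ⟨t₁, σ₁, e₁, ht₁, hs₁, hfr₁⟩ := htst i 0 (by omega) σ₀ hX0 hs₀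
      obtain ⟨t₂, σ₂, e₂, ht₂, hs₂, hfr₂⟩ := hloop i (k i) 0 (by omega) σ₁
        (by rw [hfr₁ b (by omega), hX0]) (by rw [hfr₁ _ (by omega), hs₀]) hs₁
      refine ⟨_, _, .seq (.assign _ _ _) (.seq e₀ (.seq e₁ (.seq e₂ (.assign _ _ _)))), ?_, ?_,
        fun x hx => ?_⟩
      · have := hpS' i (k i) le_rfl
        simp only [Expr.cost, hσ, hs₂, esize] at *
        omega
      · simp [Expr.eval, hs₂]
      · rw [Function.update_of_ne hx.ne, hfr₂ x (by omega), hfr₁ x (by omega),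
          hfr₀ x (by omega), Function.update_of_ne (by omega)]
  bd_left := h0.bd_left
  bd_right := by
    obtain ⟨p, hp⟩ := hS
    exact ⟨p, fun i => hp ⟨(i, k i), le_rfl⟩⟩

end PT

namespace PT

variable {ι κ α β γ δ : Type} [Enc α] [Enc β] [Enc γ] [Enc δ] {K : Ctx ι}
  {X : ι → α} {Y : ι → β} {Z : ι → γ}

/-! ### Arithmetic and truth values -/

theorem add {a b : ι → ℚ} (ha : PT K X a) (hb : PT K X b) : PT K X fun i => a i + b i :=
  ha.binop .add hb (fun _ => rfl)
    (((Ctx.Bd.const 2).mul (ha.bd_right.add hb.bd_right)).mono fun _ => esize_add_le _ _)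

theorem sub {a b : ι → ℚ} (ha : PT K X a) (hb : PT K X b) : PT K X fun i => a i - b i :=
  ha.binop .sub hb (fun _ => rfl)
    (((Ctx.Bd.const 2).mul (ha.bd_right.add hb.bd_right)).mono fun _ => esize_sub_le _ _)

theorem mul {a b : ι → ℚ} (ha : PT K X a) (hb : PT K X b) : PT K X fun i => a i * b i :=
  ha.binop .mul hb (fun _ => rfl)
    ((ha.bd_right.add hb.bd_right).mono fun _ => esize_mul_le _ _)

theorem div {a b : ι → ℚ} (ha : PT K X a) (hb : PT K X b) : PT K X fun i => a i / b i :=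
  ha.binop .div hb (fun _ => rfl)
    (((ha.bd_right.add hb.bd_right).add (.const 1)).mono fun _ => esize_div_rat_le _ _)

theorem le {a b : ι → ℚ} (ha : PT K X a) (hb : PT K X b) :
    PT K X fun i => decide (a i ≤ b i) :=
  ha.binop .le hb (fun _ => rfl) ((Ctx.Bd.const 3).mono fun _ => esize_bool_le _)

theorem ratCast {a : ι → ℕ} (ha : PT K X a) : PT K X fun i => (a i : ℚ) := ha.congr fun _ => rfl

theorem intRatCast {a : ι → ℤ} (ha : PT K X a) : PT K X fun i => (a i : ℚ) :=
  ha.congr fun _ => rfl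

theorem natAdd {a b : ι → ℕ} (ha : PT K X a) (hb : PT K X b) : PT K X fun i => a i + b i :=
  (ha.ratCast.add hb.ratCast).congr fun i => by simp [enc]

theorem natMul {a b : ι → ℕ} (ha : PT K X a) (hb : PT K X b) : PT K X fun i => a i * b i :=
  (ha.ratCast.mul hb.ratCast).congr fun i => by simp [enc]

theorem natLe {a b : ι → ℕ} (ha : PT K X a) (hb : PT K X b) :
    PT K X fun i => decide (a i ≤ b i) :=
  (ha.ratCast.le hb.ratCast).congr fun i => by simp

theorem floorNat {a : ι → ℚ} (ha : PT K X a) (h0 : ∀ i, 0 ≤ a i) : PT K X fun i => ⌊a i⌋₊ := by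
  refine ha.unop .floor (fun i => ?_) ?_
  · simp only [enc, UnOp.apply, Val.toRat]
    rw [← Int.natCast_floor_eq_floor (h0 i)]; simp
  · refine (((Ctx.Bd.const 2).add ha.bd_right)).mono fun i => ?_
    rw [esize_nat, esize_rat]
    have : ⌊a i⌋₊ ≤ (a i).num.natAbs := by
      have h1 : a i ≤ (a i).num.natAbs := by
        have h2 : ((a i).num.natAbs : ℚ) = (a i).num := by
          rw [Nat.cast_natAbs, abs_of_nonneg (Rat.num_nonneg.2 (h0 i))]
        rw [h2]
        conv_lhs => rw [← Rat.num_div_den (a i)]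
        refine div_le_self (by exact_mod_cast Rat.num_nonneg.2 (h0 i)) ?_
        exact_mod_cast (a i).den_pos
      exact_mod_cast (Nat.floor_le (h0 i)).trans h1
    have := Nat.size_le_size this
    omega

theorem andD {p q : ι → Prop} [DecidablePred p] [DecidablePred q]
    (hp : PT K X fun i => decide (p i)) (hq : PT K X fun i => decide (q i)) :
    PT K X fun i => decide (p i ∧ q i) :=
  (hp.ite hq (.const hp.bd_left false)).congr fun i => by
    by_cases h : p i <;> simp [h]

theorem natEq {a b : ι → ℕ} (ha : PT K X a) (hb : PT K X b) :
    PT K X fun i => decide (a i = b i) :=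
  ((ha.natLe hb).andD (hb.natLe ha)).congr fun i => by
    congr 1; simp [le_antisymm_iff]

theorem decideBool {c : ι → Bool} (hc : PT K X c) : PT K X fun i => decide (c i = true) :=
  hc.congr fun i => by simp

/-! ### Vectors -/

theorem vecCons {d : ℕ} {v : ι → Fin (d + 1) → β} (h0 : PT K X fun i => v i 0)
    (h : PT K X fun i => fun k : Fin d => v i k.succ) : PT K X v := by
  refine h0.binop .cons h (fun i => ?_) ?_
  · simp [enc, BinOp.apply, List.ofFn_succ, Val.ofList]
  · refine ((Ctx.Bd.const 1).add (h0.bd_right.add h.bd_right)).mono fun i => ?_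
    simp [esize, enc, List.ofFn_succ, Val.ofList, Val.size]
    omega

theorem vec {d : ℕ} {v : ι → Fin d → β} (hX : K.Bd fun i => esize (X i))
    (h : ∀ k, PT K X fun i => v i k) : PT K X v := by
  induction d with
  | zero =>
    refine (PT.const (β := Val) hX .nil).congr fun i => ?_
    simp [enc, Val.ofList]
  | succ d ih => exact vecCons (h 0) (ih fun k => h k.succ)

theorem vecTail {d : ℕ} {v : ι → Fin (d + 1) → β} (h : PT K X v) :
    PT K X fun i => fun k : Fin d => v i k.succ := by
  refine h.unop .tail (fun i => ?_) ?_
  · simp [enc, UnOp.apply, List.ofFn_succ, Val.ofList, Val.tail]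
  · refine h.bd_right.mono fun i => ?_
    simp [esize, enc, List.ofFn_succ, Val.ofList, Val.size]

theorem coord {d : ℕ} {v : ι → Fin d → β} (h : PT K X v) (k : Fin d) :
    PT K X fun i => v i k := by
  induction d with
  | zero => exact k.elim0
  | succ d ih =>
    refine Fin.cases ?_ (fun k => ih (v := fun i k => v i k.succ) h.vecTail k) k
    refine h.unop .head (fun i => ?_) (h.bd_right.mono fun i => esize_vec_apply_le _ _)
    simp [enc, UnOp.apply, List.ofFn_succ, Val.ofList, Val.head]

/-! ### Lists -/

theorem cons {l : ι → List β} (h : PT K X Y) (hl : PT K X l) : PT K X fun i => Y i :: l i :=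
  h.binop .cons hl (fun _ => rfl)
    (((Ctx.Bd.const 1).add (h.bd_right.add hl.bd_right)).mono fun i => by
      rw [esize_cons]; omega)

/-- Quantities of the outer context, seen in an inner context. -/
theorem ofFst {g : κ → ι} {V : κ → γ} (hV : (K.comap g).Bd fun q => esize (V q))
    (hY : PT K X Y) : PT (K.comap g) (fun q => (X (g q), V q)) fun q => Y (g q) := by
  refine (PT.fst (PT.id (X := fun q => (X (g q), V q)) ?_)).comp (hY.comap g)
  exact ((Ctx.Bd.const 1).add ((hY.bd_left.comap g).add hV)).mono fun i => by
    rw [esize_pair]; omega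

theorem ofSnd {g : κ → ι} {V : κ → γ} (hV : (K.comap g).Bd fun q => esize (V q))
    (hX : K.Bd fun i => esize (X i)) : PT (K.comap g) (fun q => (X (g q), V q)) V :=
  PT.snd (PT.id (((Ctx.Bd.const 1).add ((hX.comap g).add hV)).mono fun i => by
    rw [esize_pair]; omega))

/-- Positions in a loop over a list: the part of the list that was treated and the next element. -/
abbrev FoldIdx (L : ι → List β) := {q : ι × List β × β // q.2.1 ++ [q.2.2] <+: L q.1}

theorem truth_list (l : List β) : (enc l).truth = decide (0 < l.length) := by
  cases l <;> simp [enc, Val.ofList, Val.truth]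

/-- The loop state is the unread part of the list together with the accumulator, and the unread part
serves as its own loop condition. The bound `hB` on all intermediate accumulators has to be
supplied: a polynomial-time step does not by itself keep sizes polynomial under iteration. -/
theorem foldl {L : ι → List β} {A : ι → γ} {f : ι → γ → β → γ}
    (hL : PT K X L) (hA : PT K X A)
    (hB : (K.comap fun q : {q : ι × List β // q.2 <+: L q.1} => q.1.1).Bd
      fun q => esize (q.1.2.foldl (f q.1.1) (A q.1.1)))
    (hf : PT (K.comap fun q : FoldIdx L => q.1.1)
      (fun q => (X q.1.1, (q.1.2.1.foldl (f q.1.1) (A q.1.1), q.1.2.2)))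
      fun q => f q.1.1 (q.1.2.1.foldl (f q.1.1) (A q.1.1)) q.1.2.2) :
    PT K X fun i => (L i).foldl (f i) (A i) := by
  let S : ι → ℕ → List β × γ := fun i j => ((L i).drop j, ((L i).take j).foldl (f i) (A i))
  have hS : (K.comap fun q : {q : ι × ℕ // q.2 ≤ (L q.1).length} => q.1.1).Bd
      fun q => esize (S q.1.1 q.1.2) := by
    obtain ⟨p, hp⟩ := hB
    obtain ⟨p', hp'⟩ := hL.bd_right
    refine ⟨1 + p' + p, fun q => ?_⟩
    change esize (_, _) ≤ _
    rw [esize_pair]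
    simp only [Polynomial.eval_add, Polynomial.eval_one]
    have h1 := hp ⟨(q.1.1, (L q.1.1).take q.1.2), List.take_prefix _ _⟩
    have h2 := hp' q.1.1
    have h3 := esize_le_of_sublist (List.drop_sublist q.1.2 (L q.1.1))
    simp only [Ctx.comap] at *
    omega
  have hS' : (K.comap fun q : {q : ι × ℕ // q.2 < (L q.1).length} => q.1.1).Bd
      fun q => esize (S q.1.1 q.1.2) := by
    obtain ⟨p, hp⟩ := hS
    exact ⟨p, fun q => hp ⟨q.1, q.2.le⟩⟩
  have key : PT K X fun i => S i (L i).length := by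
    refine PT.loop (S := S) (k := fun i => (L i).length) (Z := fun i j => (L i).drop j)
      ?_ (hL.bd_right.mono fun i => (length_lt_esize _).le) hS ?_ ?_ ?_
    · exact (hL.pair hA).congr fun i => by simp [S]
    · exact (ofSnd hS hL.bd_left).fst
    · intro i j hj
      rw [truth_list, List.length_drop]
      congr 1
      simp
    · have h1 := ofSnd hS' hL.bd_left
      have hel : PT (K.comap fun q : {q : ι × ℕ // q.2 < (L q.1).length} => q.1.1)
          (fun q => (X q.1.1, S q.1.1 q.1.2)) fun q => (L q.1.1)[q.1.2]'q.2 := by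
        refine h1.fst.unop .head (fun q => ?_) (((hL.bd_right.comap _).mono fun q => ?_))
        · simp only [S, List.drop_eq_getElem_cons q.2, UnOp.apply]; rfl
        · exact (esize_mem (List.getElem_mem _)).le
      have htl : PT (K.comap fun q : {q : ι × ℕ // q.2 < (L q.1).length} => q.1.1)
          (fun q => (X q.1.1, S q.1.1 q.1.2)) fun q => (L q.1.1).drop (q.1.2 + 1) := by
        refine h1.fst.unop .tail (fun q => ?_) (((hL.bd_right.comap _).mono fun q => ?_))
        · simp only [S, List.drop_eq_getElem_cons q.2, UnOp.apply]; rfl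
        · exact esize_le_of_sublist (List.drop_sublist _ _)
      have hg := (PT.fst (PT.id h1.bd_left)).pair (h1.snd.pair hel)
      have hstep := hf.comap (fun q : {q : ι × ℕ // q.2 < (L q.1).length} =>
        (⟨(q.1.1, (L q.1.1).take q.1.2, (L q.1.1)[q.1.2]'q.2), by
          simp only [List.take_append_getElem q.2]
          exact List.take_prefix _ _⟩ : FoldIdx L))
      refine (htl.pair (hg.comp hstep)).congr fun q => ?_
      simp only [S]
      congr 2
      rw [← List.take_append_getElem q.2, List.foldl_append]
      rfl
  exact key.snd.congr fun i => by simp [S]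

section FoldIdx

variable {L : ι → List β} {A : ι → γ} {f : ι → γ → β → γ}

theorem foldBd (hL : PT K X L)
    (hB : (K.comap fun q : {q : ι × List β // q.2 <+: L q.1} => q.1.1).Bd
      fun q => esize (q.1.2.foldl (f q.1.1) (A q.1.1))) :
    (K.comap fun q : FoldIdx L => q.1.1).Bd
      fun q => esize (q.1.2.1.foldl (f q.1.1) (A q.1.1), q.1.2.2) := by
  obtain ⟨p, hp⟩ := hB
  obtain ⟨p', hp'⟩ := hL.bd_right
  refine ⟨1 + p + p', fun q => ?_⟩
  change esize (_, _) ≤ _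
  rw [esize_pair]
  simp only [Polynomial.eval_add, Polynomial.eval_one]
  have h1 := hp ⟨(q.1.1, q.1.2.1), (List.prefix_append _ _).trans q.2⟩
  have h2 := hp' q.1.1
  have h3 := esize_mem (q.2.subset (List.mem_append_right _ (List.mem_singleton.2 rfl)))
  simp only [Ctx.comap] at *
  omega

end FoldIdx

/-- The usual form of the loop over a list: the body may use the current state, the next element
and everything that was computed before. -/
theorem foldl' {L : ι → List β} {A : ι → γ} {f : ι → γ → β → γ}
    (hL : PT K X L) (hA : PT K X A)
    (hB : (K.comap fun q : {q : ι × List β // q.2 <+: L q.1} => q.1.1).Bd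
      fun q => esize (q.1.2.foldl (f q.1.1) (A q.1.1)))
    (hf : ∀ (V : FoldIdx L → α × γ × β),
      (∀ {ε : Type} [Enc ε] {W : ι → ε}, PT K X W →
        PT (K.comap fun q : FoldIdx L => q.1.1) V fun q => W q.1.1) →
      PT (K.comap fun q : FoldIdx L => q.1.1) V
        (fun q => q.1.2.1.foldl (f q.1.1) (A q.1.1)) →
      PT (K.comap fun q : FoldIdx L => q.1.1) V (fun q => q.1.2.2) →
      PT (K.comap fun q : FoldIdx L => q.1.1) V
        fun q => f q.1.1 (q.1.2.1.foldl (f q.1.1) (A q.1.1)) q.1.2.2) :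
    PT K X fun i => (L i).foldl (f i) (A i) :=
  hL.foldl hA hB (hf _ (fun h => ofFst (hL.foldBd hB) h) (ofSnd (hL.foldBd hB) hL.bd_left).fst
    (ofSnd (hL.foldBd hB) hL.bd_left).snd)

theorem foldl_cons_eq {β : Type} (l m : List β) : l.foldl (fun acc a => a :: acc) m = l.reverse ++ m := by
  induction l generalizing m with
  | nil => rfl
  | cons a l ih => simp [ih]

theorem reverseAppend {L M : ι → List β} (hL : PT K X L) (hM : PT K X M) :
    PT K X fun i => (L i).reverse ++ M i := by
  refine (hL.foldl' hM (f := fun _ acc a => a :: acc) ?_ fun V _ ha he => he.cons ha).congr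
    fun i => by rw [foldl_cons_eq]
  refine ((hL.bd_right.add hM.bd_right).comap _).mono fun q => ?_
  have h1 := esize_append q.1.2.reverse (M q.1.1)
  have h2 := esize_le_of_sublist q.2.sublist
  rw [foldl_cons_eq, esize_reverse] at *
  omega

theorem nil (hX : K.Bd fun i => esize (X i)) : PT K X fun _ => ([] : List β) := .const hX _

theorem reverse {L : ι → List β} (hL : PT K X L) : PT K X fun i => (L i).reverse :=
  (hL.reverseAppend (.nil hL.bd_left)).congr fun i => by simp

theorem append {L M : ι → List β} (hL : PT K X L) (hM : PT K X M) :
    PT K X fun i => L i ++ M i :=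
  (hL.reverse.reverseAppend hM).congr fun i => by simp

/-- Elements of the list of an index. -/
abbrev MemIdx (L : ι → List β) := {q : ι × β // q.2 ∈ L q.1}

theorem memBd {L : ι → List β} (hL : PT K X L) :
    (K.comap fun q : MemIdx L => q.1.1).Bd fun q => esize q.1.2 :=
  (hL.bd_right.comap _).mono fun q => (esize_mem q.2).le

theorem foldl_append_eq {β γ : Type} (f : β → List γ) (l : List β) (m : List γ) :
    l.foldl (fun acc a => f a ++ acc) m = l.reverse.flatMap f ++ m := by
  induction l generalizing m with
  | nil => rfl
  | cons a l ih => simp [ih, List.flatMap_append]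

/-- The fold runs over the reversed list and prepends blocks. Its accumulators are then `flatMap`
values on suffixes of the list, hence sublists of the final value, and inherit the size bound of the
latter. -/
theorem flatMap {L : ι → List β} {f : ι → β → List γ} (hL : PT K X L)
    (hf : ∀ (V : MemIdx L → α × β),
      (∀ {ε : Type} [Enc ε] {W : ι → ε}, PT K X W →
        PT (K.comap fun q : MemIdx L => q.1.1) V fun q => W q.1.1) →
      PT (K.comap fun q : MemIdx L => q.1.1) V (fun q => q.1.2) →
      PT (K.comap fun q : MemIdx L => q.1.1) V fun q => f q.1.1 q.1.2) :
    PT K X fun i => (L i).flatMap (f i) := by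
  have hf' := hf _ (fun h => ofFst hL.memBd h) (ofSnd hL.memBd hL.bd_left)
  have hbd : K.Bd fun i => esize ((L i).flatMap (f i)) := by
    obtain ⟨p, hp⟩ := hf'.bd_right
    obtain ⟨p', hp'⟩ := hL.bd_right
    refine ⟨1 + p' * p, fun i => ?_⟩
    simp only [Polynomial.eval_add, Polynomial.eval_one, Polynomial.eval_mul]
    have : ∀ l : List β, (∀ a ∈ l, a ∈ L i) →
        esize (l.flatMap (f i)) ≤ 1 + l.length * p.eval (K.size i) := by
      intro l hl
      induction l with
      | nil => simp [esize_nil]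
      | cons a l ih =>
        have h1 := ih fun b hb => hl b (by simp [hb])
        have h2 := hp ⟨(i, a), hl a (by simp)⟩
        have h3 := esize_append (f i a) (l.flatMap (f i))
        rw [List.flatMap_cons, List.length_cons, Nat.succ_mul]
        simp only [Ctx.comap] at *
        omega
    refine (this (L i) fun a ha => ha).trans ?_
    have := Nat.mul_le_mul_right (p.eval (K.size i)) ((length_lt_esize (L i)).le.trans (hp' i))
    omega
  refine (hL.reverse.foldl' (.nil hL.bd_left) (f := fun i acc a => f i a ++ acc) ?_
    fun V hV ha he => ?_).congr fun i => by rw [foldl_append_eq]; simp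
  · refine (hbd.comap _).mono fun q => ?_
    rw [foldl_append_eq, List.append_nil]
    have h1 : q.1.2.reverse <:+ L q.1.1 := by
      rw [← List.reverse_prefix, List.reverse_reverse]; exact q.2
    obtain ⟨t, ht⟩ := h1
    rw [← ht, List.flatMap_append]
    exact esize_le_of_sublist (List.sublist_append_right _ _)
  · refine PT.append ?_ ha
    refine ((hV (.id hL.bd_left)).pair he).comp (hf'.comap fun q : FoldIdx (fun i => (L i).reverse) =>
      (⟨(q.1.1, q.1.2.2), ?_⟩ : MemIdx L))
    have := q.2.subset (List.mem_append_right _ (List.mem_singleton.2 rfl))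
    simpa using this

theorem map {L : ι → List β} {f : ι → β → γ} (hL : PT K X L)
    (hf : ∀ (V : MemIdx L → α × β),
      (∀ {ε : Type} [Enc ε] {W : ι → ε}, PT K X W →
        PT (K.comap fun q : MemIdx L => q.1.1) V fun q => W q.1.1) →
      PT (K.comap fun q : MemIdx L => q.1.1) V (fun q => q.1.2) →
      PT (K.comap fun q : MemIdx L => q.1.1) V fun q => f q.1.1 q.1.2) :
    PT K X fun i => (L i).map (f i) :=
  (hL.flatMap (f := fun i a => [f i a]) fun V hV he =>
    (hf V hV he).cons (.nil he.bd_left)).congr fun i => by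
      rw [List.map_eq_flatMap]

theorem filter {L : ι → List β} {f : ι → β → Bool} (hL : PT K X L)
    (hf : ∀ (V : MemIdx L → α × β),
      (∀ {ε : Type} [Enc ε] {W : ι → ε}, PT K X W →
        PT (K.comap fun q : MemIdx L => q.1.1) V fun q => W q.1.1) →
      PT (K.comap fun q : MemIdx L => q.1.1) V (fun q => q.1.2) →
      PT (K.comap fun q : MemIdx L => q.1.1) V fun q => f q.1.1 q.1.2) :
    PT K X fun i => (L i).filter (f i) :=
  (hL.flatMap (f := fun i a => if f i a = true then [a] else []) fun V hV he =>
    (hf V hV he).decideBool.ite (he.cons (.nil he.bd_left)) (.nil he.bd_left)).congr fun i => by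
      congr 1
      induction L i with
      | nil => rfl
      | cons a l ih => by_cases h : f i a <;> simp [h, ih]

theorem length {L : ι → List β} (hL : PT K X L) : PT K X fun i => (L i).length := by
  have key : ∀ (l : List β) (n : ℕ), l.foldl (fun n _ => n + 1) n = n + l.length := by
    intro l
    induction l with
    | nil => simp
    | cons a l ih => intro n; simp [ih]; omega
  refine (hL.foldl' (.const hL.bd_left (0 : ℕ)) (f := fun _ n _ => n + 1) ?_
    fun V hV ha he => ha.natAdd (.const ha.bd_left 1)).congr fun i => by simp [key]
  refine ((Ctx.Bd.const 2).add (hL.bd_right.comap _)).mono fun q => ?_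
  rw [key, esize_nat]
  have h1 := Nat.size_le_self_add_one (0 + q.1.2.length)
  have h2 := (length_lt_esize q.1.2).le
  have h3 := esize_le_of_sublist q.2.sublist
  omega

/-- A list whose length is the bit length of a number. -/
theorem bits {a : ι → ℕ} (ha : PT K X a) :
    PT K X fun i => List.replicate (Nat.size (a i)) () := by
  -- Halve the number repeatedly while collecting units; the quotient stays positive for exactly
  -- `Nat.size` rounds.
  let S : ι → ℕ → ℕ × List Unit := fun i j => (a i / 2 ^ j, List.replicate j ())
  have hsz : K.Bd fun i => Nat.size (a i) := ha.bd_right.mono fun i => by rw [esize_nat]; omega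
  have hrep : ∀ n, esize (List.replicate n ()) = 1 + n * 2 := by
    intro n
    rw [esize_list]
    simp [esize, enc, Val.size]
  have hS : (K.comap fun q : {q : ι × ℕ // q.2 ≤ Nat.size (a q.1)} => q.1.1).Bd
      fun q => esize (S q.1.1 q.1.2) := by
    refine ((((Ctx.Bd.const 4).add ha.bd_right).add ((Ctx.Bd.const 2).mul hsz)).comap _).mono
      fun q => ?_
    rw [esize_pair, hrep, esize_nat, esize_nat]
    have := Nat.size_le_size (Nat.div_le_self (a q.1.1) (2 ^ q.1.2))
    have := q.2
    omega
  have key : PT K X fun i => S i (Nat.size (a i)) := by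
    have hpos : ∀ i j, 1 ≤ (S i j).1 ↔ j < Nat.size (a i) := by
      intro i j
      rw [Nat.lt_size, Nat.one_le_div_iff (by positivity)]
    refine PT.loop (S := S) (k := fun i => Nat.size (a i)) (Z := fun i j => decide (1 ≤ (S i j).1))
      ?_ hsz hS ?_ ?_ ?_
    · exact (ha.pair (.nil (β := Unit) ha.bd_left)).congr fun i => by simp [S]
    · have h1 := ofSnd hS ha.bd_left
      exact PT.natLe (.const h1.bd_left 1) h1.fst
    · intro i j hj
      have h2 : ∀ b : Bool, (enc b).truth = b := by intro b; cases b <;> rfl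
      rw [h2]
      congr 1
      exact propext (hpos i j)
    · have h1 := ofSnd (V := fun q : {q : ι × ℕ // q.2 < Nat.size (a q.1)} => S q.1.1 q.1.2)
        (g := fun q => q.1.1) (X := X) (K := K) (by
          obtain ⟨p, hp⟩ := hS
          exact ⟨p, fun q => hp ⟨q.1, q.2.le⟩⟩) ha.bd_left
      have h2 : PT (K.comap fun q : {q : ι × ℕ // q.2 < Nat.size (a q.1)} => q.1.1) _ _ :=
        ((PT.div h1.fst.ratCast (.const h1.bd_left (2 : ℚ))).floorNat
          (fun q => by positivity)).pair (PT.cons (.const h1.bd_left ()) h1.snd)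
      refine h2.congr fun q => ?_
      simp only [S]
      congr 2
      rw [pow_succ, ← Nat.div_div_eq_div_mul]
      have := Nat.floor_div_eq_div (K := ℚ) (a q.1.1 / 2 ^ q.1.2) 2
      simpa using this.symm
  exact key.snd

/-- The elements of an inner context are treated one by one, in a list that does not depend on the
input. -/
theorem any_const {β : Type} {L : List β} {f : ι → β → Bool} (hX : K.Bd fun i => esize (X i))
    (hf : ∀ a ∈ L, PT K X fun i => f i a) : PT K X fun i => L.any (f i) := by
  induction L with
  | nil => exact .const hX false
  | cons a L ih =>
    have h1 := hf a (by simp)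
    have h2 := ih fun b hb => hf b (by simp [hb])
    refine (h1.decideBool.ite (.const hX true) h2).congr fun i => ?_
    cases h : f i a <;> simp [h]

end PT

/-! ### The algorithm -/

abbrev Vec (d : ℕ) := Fin d → ℚ

/-- A token is a free region of the knapsack: a label for its shape and a position. -/
abbrev Token (d : ℕ) := ℕ × Vec d

/-- A partial solution: free tokens, the profit, and the placed objects with their positions. -/
abbrev Partial (d : ℕ) := List (Token d) × ℚ × List (ℕ × Vec d)

/-- A way to replace a cell by tokens: labels and integral offsets. -/
abbrev Config (d : ℕ) := List (ℕ × (Fin d → ℤ))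

/-- The explicit part of an object: profit, radius and center of the inner ball. -/
abbrev Obj (d : ℕ) := ℚ × ℚ × Vec d

/-- An object with its index. -/
abbrev Item (d : ℕ) := ℕ × Obj d

/-- The constants of the algorithm: the grid of test points, those test points that are far from
the center, the precision of the tests, the number of labels, the resolution of the first level,
the ratio of consecutive levels, the number of extra levels and the configurations. -/
structure Params (d : ℕ) where
  tests : List (Vec d)
  far : List (Vec d)
  prec : ℚ
  labels : ℕ
  first : ℕ
  ratio : ℕ
  extra : ℕ
  cfgFirst : List (Config d)
  cfg : List (Config d)

section Algorithm

variable {d : ℕ}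

/-- The oracle's answer for the test point `t` of an item at resolution `h`. -/
def answer (O : Val → Bool) (prec h : ℚ) (it : Item d) (t : Vec d) : Bool :=
  O (enc ((it.1, h * prec, fun k => it.2.2.2 k + h * t k) : ℕ × ℚ × Vec d))

/-- The number that encodes the answers to all tests. -/
def answersCode (tests : List (Vec d)) (ans : Vec d → Bool) : ℕ :=
  tests.foldl (fun n t => 2 * n + if ans t = true then 1 else 0) 0

/-- The label of an item at resolution `h`. -/
def itemLabel (P : Params d) (O : Val → Bool) (h : ℚ) (it : Item d) : ℕ :=
  answersCode P.tests (answer O P.prec h it) + 2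

/-- An item is large at resolution `h` if some far test point is accepted. -/
def isLarge (P : Params d) (O : Val → Bool) (h : ℚ) (it : Item d) : Bool :=
  P.far.any (answer O P.prec h it)

/-- Removes the first token with label `j`. -/
def extract (j : ℕ) (ts : List (Token d)) : List (Vec d) × List (Token d) :=
  ts.foldl (fun a t => if t.1 = j ∧ a.1.length = 0 then ([t.2], a.2) else (a.1, t :: a.2)) ([], [])

def shiftBy (h : ℚ) (x : Vec d) (o : Fin d → ℤ) : Vec d := fun k => x k + h * (o k : ℚ)

/-- Replaces a cell by the tokens of a configuration. -/
def openCell (h : ℚ) (κ : Config d) (s : Partial d) : List (Partial d) :=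
  (extract 0 s.1).1.map fun x =>
    (κ.map (fun p => (p.1, shiftBy h x p.2)) ++ (extract 0 s.1).2, s.2)

/-- Places an item at a token with label `j`. -/
def placeItem (j : ℕ) (it : Item d) (s : Partial d) : List (Partial d) :=
  (extract j s.1).1.map fun x =>
    ((extract j s.1).2, (s.2.1 + it.2.1, (it.1, fun k => x k - it.2.2.2 k) :: s.2.2))

def countLabel (j : ℕ) (ts : List (Token d)) : ℕ := (ts.filter fun t => decide (t.1 = j)).length

/-- Two partial solutions have the same number of tokens of each label. -/
def sameKey (J : ℕ) (s s' : Partial d) : Bool :=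
  (List.range J).all fun j => decide (countLabel j s.1 = countLabel j s'.1)

/-- Adds a partial solution to a table that keeps the best one for each key. -/
def insertState (J : ℕ) (tbl : List (Partial d)) (s : Partial d) : List (Partial d) :=
  let r := tbl.foldl (fun (a : List (Partial d) × Partial d) e =>
    if sameKey J e a.2 = true then (a.1, if a.2.2.1 ≤ e.2.1 then e else a.2)
    else (e :: a.1, a.2)) ([], s)
  r.2 :: r.1

/-- Solutions with more than `cap` tokens are dropped, which leaves at most `(cap + 1) ^ J`
different keys. -/
def prune (cap J : ℕ) (l : List (Partial d)) : List (Partial d) :=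
  l.foldl (fun tbl s => if s.1.length ≤ cap then insertState J tbl s else tbl) []

/-- A pass opens at most one cell per partial solution. The old table is retained, so superfluous
passes do no harm. -/
def openStep (cap J : ℕ) (lev : ℚ × List (Config d)) (tbl : List (Partial d)) :
    List (Partial d) :=
  prune cap J (tbl ++ tbl.flatMap fun s => lev.2.flatMap fun κ => openCell lev.1 κ s)

/-- Retaining the old table means that the item may also be left out. -/
def placeStep (cap J : ℕ) (j : ℕ) (it : Item d) (tbl : List (Partial d)) : List (Partial d) :=
  prune cap J (tbl ++ tbl.flatMap (placeItem j it))

/-- Passage to the next level: only the new cells remain. -/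
def advance (s : Partial d) : Partial d :=
  ((s.1.filter fun t => decide (t.1 = 1)).map fun t => (0, t.2), s.2)

def openAll (cap J : ℕ) (lev : ℚ × List (Config d)) (spine : List Unit)
    (tbl : List (Partial d)) : List (Partial d) :=
  spine.foldl (fun t _ => openStep cap J lev t) tbl

def placeAll (P : Params d) (O : Val → Bool) (cap : ℕ) (h : ℚ) (its : List (Item d))
    (tbl : List (Partial d)) : List (Partial d) :=
  its.foldl (fun t it => placeStep cap P.labels (itemLabel P O h it) it t) tbl

/-- One level of the algorithm. -/
def levelStep (P : Params d) (O : Val → Bool) (cap : ℕ) (spine : List Unit)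
    (a : List (Item d) × List (Partial d)) (lev : ℚ × List (Config d)) :
    List (Item d) × List (Partial d) :=
  (a.1.filter fun it => !isLarge P O lev.1 it,
    prune cap P.labels ((placeAll P O cap lev.1 (a.1.filter fun it => isLarge P O lev.1 it)
      (openAll cap P.labels lev spine a.2)).map advance))

/-- The input objects with their indices, in reverse order. -/
def indexed (inp : List (Obj d)) : List (Item d) :=
  (inp.foldl (fun (a : ℕ × List (Item d)) o => (a.1 + 1, (a.1, o) :: a.2)) (0, [])).2

/-- A unary list that is longer than the logarithm of every inverse inner radius by at least
`P.extra`, so that every object is large at the last level. The absolute value makes the floor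
meaningful for arbitrary inputs. -/
def levelSpine (P : Params d) (inp : List (Obj d)) : List Unit :=
  List.replicate P.extra () ++ inp.flatMap fun o => List.replicate (Nat.size ⌊|1 / o.2.1|⌋₊) ()

/-- The levels of the algorithm, with resolutions and configurations. -/
def levels (P : Params d) (inp : List (Obj d)) : List (ℚ × List (Config d)) :=
  ((1 / (P.first : ℚ)), P.cfgFirst) ::
    ((levelSpine P inp).foldl (fun (a : ℚ × List (ℚ × List (Config d))) _ =>
      (a.1 / P.ratio, (a.1, P.cfg) :: a.2)) (1 / (P.first : ℚ) / P.ratio, [])).2.reverse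

/-- A useful partial solution needs at most one unopened cell, one new cell and one shape per
object. -/
def capOf (inp : List (Obj d)) : ℕ := 3 * (inp.length + 1)

/-- At most `n` cells have to be opened at a level, so `n + 1` passes suffice. -/
def openSpine (inp : List (Obj d)) : List Unit := () :: inp.map fun _ => ()

def finalTable (P : Params d) (O : Val → Bool) (inp : List (Obj d)) : List (Partial d) :=
  ((levels P inp).foldl (levelStep P O (capOf inp) (openSpine inp))
    (indexed inp, [([(0, fun _ => 0)], (0, []))])).2

def bestOf (tbl : List (Partial d)) : ℚ × List (ℕ × Vec d) :=
  tbl.foldl (fun b s => if b.1 ≤ s.2.1 then s.2 else b) (0, [])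

/-- The best solution for one choice of the constants: its profit and the placed items. -/
def solve (P : Params d) (O : Val → Bool) (inp : List (Obj d)) : ℚ × List (ℕ × Vec d) :=
  bestOf (finalTable P O inp)

/-- The best solution for several choices of the constants. -/
def solveAll (O : Val → Bool) (inp : List (Obj d)) : List (Params d) → ℚ × List (ℕ × Vec d)
  | [] => (0, [])
  | P :: Ps => if (solve P O inp).1 ≤ (solveAll O inp Ps).1 then solveAll O inp Ps
      else solve P O inp

def lookup (pl : List (ℕ × Vec d)) (i : ℕ) : Option (Vec d) :=
  pl.foldl (fun o p => if p.1 = i then some p.2 else o) none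

def output (inp : List (Obj d)) (pl : List (ℕ × Vec d)) : List (Option (Vec d)) :=
  (indexed inp).reverse.map fun it => lookup pl it.1

end Algorithm

/-! ### Specifications of the list operations of the algorithm -/

theorem esize_le_of_subperm {α : Type} [Enc α] {l m : List α} (h : l.Subperm m) :
    esize l ≤ esize m := by
  obtain ⟨l', hp, hs⟩ := h
  rw [← esize_perm hp]
  exact esize_le_of_sublist hs

section Specs

variable {d : ℕ}

theorem extract_foldl (j : ℕ) (ts : List (Token d)) :
    ∀ a : List (Vec d) × List (Token d), a.1.length ≤ 1 →
    ((ts.foldl (fun a t => if t.1 = j ∧ a.1.length = 0 then ([t.2], a.2) else (a.1, t :: a.2))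
        a).1.map (fun x => (j, x)) ++
      (ts.foldl (fun a t => if t.1 = j ∧ a.1.length = 0 then ([t.2], a.2) else (a.1, t :: a.2))
        a).2).Perm (a.1.map (fun x => (j, x)) ++ a.2 ++ ts) ∧
    ((ts.foldl (fun a t => if t.1 = j ∧ a.1.length = 0 then ([t.2], a.2) else (a.1, t :: a.2))
        a).1.length ≤ 1) ∧
    ((ts.foldl (fun a t => if t.1 = j ∧ a.1.length = 0 then ([t.2], a.2) else (a.1, t :: a.2))
        a).1 = [] → a.1 = [] ∧ ∀ t ∈ ts, t.1 ≠ j) := by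
  induction ts with
  | nil => intro a ha; simp [ha]
  | cons t ts ih =>
    intro a ha
    rw [List.foldl_cons]
    by_cases h : t.1 = j ∧ a.1.length = 0
    · rw [if_pos h]
      obtain ⟨h1, h2, h3⟩ := ih ([t.2], a.2) (by simp)
      refine ⟨h1.trans ?_, h2, fun h0 => by simpa using (h3 h0).1⟩
      have ha0 : a.1 = [] := List.length_eq_zero_iff.1 h.2
      have ht : (j, t.2) = t := by rw [← h.1]
      simp only [ha0, List.map_cons, List.map_nil, ht, List.nil_append, List.cons_append]
      exact List.perm_middle.symm
    · rw [if_neg h]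
      obtain ⟨h1, h2, h3⟩ := ih (a.1, t :: a.2) ha
      refine ⟨h1.trans ?_, h2, fun h0 => ?_⟩
      · simp only [List.append_assoc, List.cons_append]
        exact List.Perm.append_left _ List.perm_middle.symm
      · obtain ⟨h4, h5⟩ := h3 h0
        have h4' : a.1 = [] := h4
        refine ⟨h4', fun u hu => ?_⟩
        rcases List.mem_cons.1 hu with rfl | hu
        · intro hj; exact h ⟨hj, by simp [h4']⟩
        · exact h5 u hu

theorem extract_perm (j : ℕ) (ts : List (Token d)) :
    ((extract j ts).1.map (fun x => (j, x)) ++ (extract j ts).2).Perm ts := by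
  simpa [extract] using (extract_foldl j ts ([], []) (by simp)).1

theorem extract_length (j : ℕ) (ts : List (Token d)) : (extract j ts).1.length ≤ 1 :=
  (extract_foldl j ts ([], []) (by simp)).2.1

theorem extract_eq_nil {j : ℕ} {ts : List (Token d)} (h : (extract j ts).1 = []) :
    ∀ t ∈ ts, t.1 ≠ j :=
  ((extract_foldl j ts ([], []) (by simp)).2.2 h).2

theorem extract_mem {j : ℕ} {ts : List (Token d)} {x : Vec d} (h : x ∈ (extract j ts).1) :
    ((j, x) :: (extract j ts).2).Perm ts := by
  have h1 := extract_length j ts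
  have h2 := extract_perm j ts
  match he : (extract j ts).1 with
  | [] => rw [he] at h; simp at h
  | [y] =>
    rw [he] at h h2
    rw [List.mem_singleton.1 h]
    simpa using h2
  | _ :: _ :: _ => rw [he] at h1; simp at h1

theorem esize_extract_le (j : ℕ) (ts : List (Token d)) :
    esize (extract j ts) ≤ 2 + 2 * esize ts := by
  have h1 := esize_perm (extract_perm j ts)
  have h2 := esize_append ((extract j ts).1.map (fun x => (j, x))) (extract j ts).2
  have h3 : ∀ l : List (Vec d), esize l ≤ esize (l.map fun x => ((j, x) : Token d)) := by
    intro l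
    induction l with
    | nil => rfl
    | cons a l ih => rw [List.map_cons, esize_cons, esize_cons, esize_pair]; omega
  have h4 := h3 (extract j ts).1
  change esize ((extract j ts).1, (extract j ts).2) ≤ _
  rw [esize_pair]
  omega

theorem insertState_foldl (J : ℕ) (tbl : List (Partial d)) :
    ∀ a : List (Partial d) × Partial d,
    ((tbl.foldl (fun (a : List (Partial d) × Partial d) e =>
      if sameKey J e a.2 = true then (a.1, if a.2.2.1 ≤ e.2.1 then e else a.2)
      else (e :: a.1, a.2)) a).2 :: (tbl.foldl (fun (a : List (Partial d) × Partial d) e =>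
      if sameKey J e a.2 = true then (a.1, if a.2.2.1 ≤ e.2.1 then e else a.2)
      else (e :: a.1, a.2)) a).1).Subperm (a.2 :: (a.1 ++ tbl)) := by
  induction tbl with
  | nil => intro a; simpa using List.Subperm.refl _
  | cons e tbl ih =>
    intro a
    rw [List.foldl_cons]
    refine (ih _).trans ?_
    have hp : (e :: a.2 :: (a.1 ++ tbl)).Perm (a.2 :: (a.1 ++ e :: tbl)) :=
      (List.Perm.swap _ _ _).trans (List.perm_middle.symm.cons _)
    split_ifs
    · exact ((List.Sublist.refl _).cons _ |>.cons_cons e).subperm.trans hp.subperm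
    · exact ((List.Sublist.refl _).cons _).subperm.trans hp.subperm
    · exact (List.perm_middle.symm.cons _).subperm

theorem insertState_subperm (J : ℕ) (tbl : List (Partial d)) (s : Partial d) :
    (insertState J tbl s).Subperm (s :: tbl) := by
  simpa [insertState] using insertState_foldl J tbl ([], s)

theorem prune_foldl_subperm (cap J : ℕ) (l : List (Partial d)) : ∀ tbl : List (Partial d),
    (l.foldl (fun tbl s => if s.1.length ≤ cap then insertState J tbl s else tbl) tbl).Subperm
      (tbl ++ l) := by
  induction l with
  | nil => intro tbl; simpa using List.Subperm.refl _
  | cons s l ih =>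
    intro tbl
    rw [List.foldl_cons]
    refine (ih _).trans ?_
    split_ifs
    · exact ((List.subperm_append_right l).2 (insertState_subperm J tbl s)).trans
        List.perm_middle.symm.subperm
    · exact ((List.Sublist.refl _).append ((List.Sublist.refl _).cons _)).subperm

/-- Pruning only discards entries. This gives the size bound for pruned tables, and it lets every
invariant of the candidates pass to the entries that survive. -/
theorem prune_subperm (cap J : ℕ) (l : List (Partial d)) : (prune cap J l).Subperm l :=
  prune_foldl_subperm cap J l []

theorem indexed_foldl (inp : List (Obj d)) : ∀ a : ℕ × List (Item d),
    inp.foldl (fun (a : ℕ × List (Item d)) o => (a.1 + 1, (a.1, o) :: a.2)) a =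
      (a.1 + inp.length, ((inp.zipIdx a.1).map Prod.swap).reverse ++ a.2) := by
  induction inp with
  | nil => intro a; simp
  | cons o l ih =>
    intro a
    rw [List.foldl_cons, ih]
    simp; omega

theorem indexed_reverse (inp : List (Obj d)) :
    (indexed inp).reverse = (inp.zipIdx).map Prod.swap := by
  rw [indexed, indexed_foldl]; simp

theorem levels_foldl {α : Type} (r : ℚ) (C : α) (l : List Unit) : ∀ a : ℚ × List (ℚ × α),
    l.foldl (fun (a : ℚ × List (ℚ × α)) _ => (a.1 / r, (a.1, C) :: a.2)) a =
      (a.1 / r ^ l.length,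
        ((List.range l.length).map fun j => (a.1 / r ^ j, C)).reverse ++ a.2) := by
  induction l with
  | nil => intro a; simp
  | cons o l ih =>
    intro a
    rw [List.foldl_cons, ih, List.length_cons, List.range_succ_eq_map]
    simp [pow_succ', div_div, Function.comp_def]

/-- The resolution of a level. -/
def Params.res (P : Params d) (l : ℕ) : ℚ := 1 / ((P.first * P.ratio ^ l : ℕ) : ℚ)

/-- The data of a level. -/
def Params.level (P : Params d) (l : ℕ) : ℚ × List (Config d) :=
  (P.res l, if l = 0 then P.cfgFirst else P.cfg)

theorem levels_eq (P : Params d) (inp : List (Obj d)) :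
    levels P inp = (List.range ((levelSpine P inp).length + 1)).map P.level := by
  rw [levels, levels_foldl, List.range_succ_eq_map]
  simp only [List.append_nil, List.reverse_reverse, List.map_cons, List.map_map]
  congr 1
  · simp [Params.level, Params.res]
  · apply List.map_congr_left
    intro j _
    simp only [Params.level, Params.res, pow_succ', Function.comp_apply, Nat.succ_ne_zero,
      if_false]
    push_cast
    rw [div_div, div_div]


/-- The remaining items and the table before a level. -/
def stateAt (P : Params d) (O : Val → Bool) (inp : List (Obj d)) :
    ℕ → List (Item d) × List (Partial d)
  | 0 => (indexed inp, [([(0, fun _ => 0)], (0, []))])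
  | l + 1 => levelStep P O (capOf inp) (openSpine inp) (stateAt P O inp l) (P.level l)

theorem foldl_levels (P : Params d) (O : Val → Bool) (inp : List (Obj d)) (n : ℕ) :
    ((List.range n).map P.level).foldl (levelStep P O (capOf inp) (openSpine inp))
      (indexed inp, [([(0, fun _ => 0)], (0, []))]) = stateAt P O inp n := by
  induction n with
  | zero => rfl
  | succ n ih => rw [List.range_succ, List.map_append, List.foldl_append, ih]; rfl

theorem finalTable_eq (P : Params d) (O : Val → Bool) (inp : List (Obj d)) :
    finalTable P O inp = (stateAt P O inp ((levelSpine P inp).length + 1)).2 := by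
  rw [finalTable, levels_eq, foldl_levels]

theorem bestOf_foldl (tbl : List (Partial d)) : ∀ b : ℚ × List (ℕ × Vec d),
    (tbl.foldl (fun b s => if b.1 ≤ s.2.1 then s.2 else b) b = b ∨
      ∃ s ∈ tbl, tbl.foldl (fun b s => if b.1 ≤ s.2.1 then s.2 else b) b = s.2) ∧
    b.1 ≤ (tbl.foldl (fun b s => if b.1 ≤ s.2.1 then s.2 else b) b).1 ∧
    ∀ s ∈ tbl, s.2.1 ≤ (tbl.foldl (fun b s => if b.1 ≤ s.2.1 then s.2 else b) b).1 := by
  induction tbl with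
  | nil => intro b; simp
  | cons s tbl ih =>
    intro b
    rw [List.foldl_cons]
    obtain ⟨h1, h2, h3⟩ := ih (if b.1 ≤ s.2.1 then s.2 else b)
    have h4 : b.1 ≤ (if b.1 ≤ s.2.1 then s.2 else b).1 ∧
        s.2.1 ≤ (if b.1 ≤ s.2.1 then s.2 else b).1 := by
      split_ifs with h
      · exact ⟨h, le_rfl⟩
      · exact ⟨le_rfl, (not_le.1 h).le⟩
    refine ⟨?_, h4.1.trans h2, ?_⟩
    · rcases h1 with h1 | ⟨u, hu, h1⟩
      · rw [h1]
        split_ifs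
        · exact Or.inr ⟨s, by simp, rfl⟩
        · exact Or.inl rfl
      · exact Or.inr ⟨u, by simp [hu], h1⟩
    · intro u hu
      rcases List.mem_cons.1 hu with rfl | hu
      · exact h4.2.trans h2
      · exact h3 u hu

theorem lookup_foldl (i : ℕ) (pl : List (ℕ × Vec d)) : ∀ o : Option (Vec d),
    pl.foldl (fun o p => if p.1 = i then some p.2 else o) o = o ∨
      ∃ p ∈ pl, p.1 = i ∧ pl.foldl (fun o p => if p.1 = i then some p.2 else o) o = some p.2 := by
  induction pl with
  | nil => intro o; simp
  | cons p pl ih =>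
    intro o
    rw [List.foldl_cons]
    rcases ih (if p.1 = i then some p.2 else o) with h | ⟨u, hu, h1, h2⟩
    · rw [h]
      split_ifs with hp
      · exact Or.inr ⟨p, by simp, hp, rfl⟩
      · exact Or.inl rfl
    · exact Or.inr ⟨u, by simp [hu], h1, h2⟩

end Specs

/-! ### The steps of the algorithm run in polynomial time -/

namespace PT

variable {ι α β γ : Type} [Enc α] [Enc β] [Enc γ] {K : Ctx ι} {X : ι → α} {d : ℕ}

theorem foldl_const {β : Type} {L : List β} {f : ι → γ → β → γ} {A : ι → γ} (hA : PT K X A)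
    (hf : ∀ a ∈ L, ∀ W : ι → γ, PT K X W → PT K X fun i => f i (W i) a) :
    PT K X fun i => L.foldl (f i) (A i) := by
  induction L generalizing A with
  | nil => exact hA
  | cons a L ih =>
    exact ih (hf a (by simp) A hA) fun b hb => hf b (by simp [hb])

theorem all_const {β : Type} {L : List β} {f : ι → β → Bool} (hX : K.Bd fun i => esize (X i))
    (hf : ∀ a ∈ L, PT K X fun i => f i a) : PT K X fun i => L.all (f i) := by
  induction L with
  | nil => exact .const hX true
  | cons a L ih =>
    have h1 := hf a (by simp)
    have h2 := ih fun b hb => hf b (by simp [hb])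
    refine (h1.decideBool.ite h2 (.const hX false)).congr fun i => ?_
    cases h : f i a <;> simp [h]

theorem not {f : ι → Bool} (h : PT K X f) : PT K X fun i => !f i :=
  (h.decideBool.ite (.const h.bd_left false) (.const h.bd_left true)).congr fun i => by
    cases f i <;> simp

theorem abs {a : ι → ℚ} (ha : PT K X a) : PT K X fun i => |a i| := by
  have h := ((PT.const ha.bd_left (0 : ℚ)).le ha).ite ha
    ((PT.const ha.bd_left (0 : ℚ)).sub ha)
  refine h.congr fun i => ?_
  split_ifs with h0
  · rw [abs_of_nonneg h0]
  · rw [abs_of_neg (not_le.1 h0)]; simp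

section Pieces

variable {H : ι → ℚ} {It : ι → Item d} {S S' : ι → Partial d} {T : ι → List (Partial d)}
  {cap : ι → ℕ} {j : ι → ℕ} {lev : ι → ℚ × List (Config d)}

theorem answer (prec : ℚ) (t : Vec d) (hH : PT K X H) (hIt : PT K X It) :
    PT K X fun i => answer (K.oracle i) prec (H i) (It i) t :=
  PT.query (Y := fun i => (((It i).1, H i * prec, fun k => (It i).2.2.2 k + H i * t k) :
    ℕ × ℚ × Vec d)) <| hIt.fst.pair <| (hH.mul (.const hH.bd_left _)).pair <|
    .vec hH.bd_left fun k => (hIt.snd.snd.snd.coord k).add (hH.mul (.const hH.bd_left _))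

theorem itemLabel (P : Params d) (hH : PT K X H) (hIt : PT K X It) :
    PT K X fun i => itemLabel P (K.oracle i) (H i) (It i) := by
  refine PT.natAdd ?_ (.const hH.bd_left 2)
  refine PT.foldl_const (.const hH.bd_left 0) fun t _ W hW => ?_
  exact ((PT.const hH.bd_left 2).natMul hW).natAdd
    ((hH.answer P.prec t hIt).decideBool.ite (.const hH.bd_left 1) (.const hH.bd_left 0))

theorem isLarge (P : Params d) (hH : PT K X H) (hIt : PT K X It) :
    PT K X fun i => isLarge P (K.oracle i) (H i) (It i) :=
  PT.any_const hH.bd_left fun t _ => hH.answer P.prec t hIt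

theorem extract {ts : ι → List (Token d)} (hj : PT K X j) (hts : PT K X ts) :
    PT K X fun i => extract (j i) (ts i) := by
  refine hts.foldl' ((PT.nil hj.bd_left).pair (.nil hj.bd_left)) ?_ fun V hV ha he => ?_
  · refine (((Ctx.Bd.const 2).add ((Ctx.Bd.const 2).mul hts.bd_right)).comap _).mono fun q => ?_
    have h1 := esize_le_of_sublist q.2.sublist
    have h2 := esize_extract_le (j q.1.1) q.1.2
    rw [GeoKnapsack.extract] at h2
    omega
  · exact ((he.fst.natEq (hV hj)).andD (ha.fst.length.natEq (.const ha.bd_left 0))).ite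
      ((he.snd.cons (.nil ha.bd_left)).pair ha.snd) (ha.fst.pair (he.cons ha.snd))

theorem openCell {κ : ι → Config d} (hH : PT K X H) (hκ : PT K X κ) (hS : PT K X S) :
    PT K X fun i => openCell (H i) (κ i) (S i) := by
  have hE := (PT.const hH.bd_left 0).extract hS.fst
  refine hE.fst.map fun V hV hx => ?_
  refine ((PT.map (hV hκ) fun V' hV' hp => ?_).append (hV hE.snd)).pair (hV hS.snd)
  exact hp.fst.pair (.vec hp.bd_left fun k =>
    ((hV' hx).coord k).add ((hV' (hV hH)).mul (hp.snd.coord k).intRatCast))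

theorem placeItem (hj : PT K X j) (hIt : PT K X It) (hS : PT K X S) :
    PT K X fun i => placeItem (j i) (It i) (S i) := by
  have hE := hj.extract hS.fst
  refine hE.fst.map fun V hV hx => ?_
  refine (hV hE.snd).pair (((hV hS.snd.fst).add (hV hIt.snd.fst)).pair (PT.cons ?_ (hV hS.snd.snd)))
  exact (hV hIt.fst).pair (.vec hx.bd_left fun k =>
    (hx.coord k).sub ((hV hIt.snd.snd.snd).coord k))

theorem countLabel {ts : ι → List (Token d)} (hj : PT K X j) (hts : PT K X ts) :
    PT K X fun i => countLabel (j i) (ts i) :=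
  (hts.filter fun V hV he => he.fst.natEq (hV hj)).length

theorem sameKey (J : ℕ) (hS : PT K X S) (hS' : PT K X S') :
    PT K X fun i => sameKey J (S i) (S' i) :=
  PT.all_const hS.bd_left fun j _ => ((PT.const hS.bd_left j).countLabel hS.fst).natEq
    ((PT.const hS.bd_left j).countLabel hS'.fst)

theorem insertState (J : ℕ) (hT : PT K X T) (hS : PT K X S) :
    PT K X fun i => insertState J (T i) (S i) := by
  have h : PT K X fun i => (T i).foldl (fun (a : List (Partial d) × Partial d) e =>
      if GeoKnapsack.sameKey J e a.2 = true then (a.1, if a.2.2.1 ≤ e.2.1 then e else a.2)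
      else (e :: a.1, a.2)) ([], S i) := by
    refine hT.foldl' ((PT.nil hT.bd_left).pair hS) ?_ fun V hV ha he => ?_
    · refine ((((Ctx.Bd.const 2).add hT.bd_right).add hS.bd_right).comap _).mono fun q => ?_
      have h1 := esize_le_of_sublist q.2.sublist
      have h2 := esize_le_of_subperm (insertState_subperm J q.1.2 (S q.1.1))
      rw [GeoKnapsack.insertState, esize_cons, esize_cons] at h2
      change esize (_, _) ≤ _
      rw [esize_pair]
      omega
    · exact (he.sameKey J ha.snd).decideBool.ite
        (ha.fst.pair ((ha.snd.snd.fst.le he.snd.fst).ite he ha.snd))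
        ((he.cons ha.fst).pair ha.snd)
  exact h.snd.cons h.fst

theorem prune (J : ℕ) (hc : PT K X cap) (hT : PT K X T) :
    PT K X fun i => prune (cap i) J (T i) := by
  refine hT.foldl' (.nil hT.bd_left) ?_ fun V hV ha he => ?_
  · refine (hT.bd_right.comap _).mono fun q => ?_
    exact (esize_le_of_subperm (prune_subperm (cap q.1.1) J q.1.2)).trans
      (esize_le_of_sublist q.2.sublist)
  · exact (he.fst.length.natLe (hV hc)).ite (ha.insertState J he) ha

theorem openStep (J : ℕ) (hc : PT K X cap) (hl : PT K X lev) (hT : PT K X T) :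
    PT K X fun i => openStep (cap i) J (lev i) (T i) :=
  hc.prune J <| hT.append <| hT.flatMap fun V hV hs => (hV hl.snd).flatMap fun V' hV' hκ =>
    (hV' (hV hl.fst)).openCell hκ (hV' hs)

theorem placeStep (J : ℕ) (hc : PT K X cap) (hj : PT K X j) (hIt : PT K X It) (hT : PT K X T) :
    PT K X fun i => placeStep (cap i) J (j i) (It i) (T i) :=
  hc.prune J <| hT.append <| hT.flatMap fun V hV hs => (hV hj).placeItem (hV hIt) hs

/-- The sizes of the intermediate tables are hypotheses here, because they are controlled by an
invariant of the actual run and not by composing the growth of single steps. -/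
theorem levelStep (P : Params d) {spine : ι → List Unit}
    {a : ι → List (Item d) × List (Partial d)}
    (hc : PT K X cap) (hsp : PT K X spine) (ha : PT K X a) (hl : PT K X lev)
    (h1 : (K.comap fun q : {q : ι × List Unit // q.2 <+: spine q.1} => q.1.1).Bd
      fun q => esize (openAll (cap q.1.1) P.labels (lev q.1.1) q.1.2 (a q.1.1).2))
    (h2 : (K.comap fun q : {q : ι × List (Item d) // q.2 <+: (a q.1).1.filter
        fun it => GeoKnapsack.isLarge P (K.oracle q.1) (lev q.1).1 it} => q.1.1).Bd
      fun q => esize (placeAll P (K.oracle q.1.1) (cap q.1.1) (lev q.1.1).1 q.1.2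
        (openAll (cap q.1.1) P.labels (lev q.1.1) (spine q.1.1) (a q.1.1).2))) :
    PT K X fun i => levelStep P (K.oracle i) (cap i) (spine i) (a i) (lev i) := by
  have hop : PT K X fun i => openAll (cap i) P.labels (lev i) (spine i) (a i).2 :=
    hsp.foldl' ha.snd h1 fun V hV ht _ => (hV hc).openStep P.labels (hV hl) ht
  have hbig : PT K X fun i => (a i).1.filter
      fun it => GeoKnapsack.isLarge P (K.oracle i) (lev i).1 it :=
    ha.fst.filter fun V hV hit => (hV hl.fst).isLarge P hit
  have hpl : PT K X fun i => placeAll P (K.oracle i) (cap i) (lev i).1 ((a i).1.filter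
      fun it => GeoKnapsack.isLarge P (K.oracle i) (lev i).1 it)
        (openAll (cap i) P.labels (lev i) (spine i) (a i).2) :=
    hbig.foldl' hop h2 fun V hV ht hit =>
      (hV hc).placeStep P.labels ((hV hl.fst).itemLabel P hit) hit ht
  refine PT.pair (ha.fst.filter fun V hV hit => ((hV hl.fst).isLarge P hit).not) ?_
  refine hc.prune P.labels (hpl.map fun V hV hs => ?_)
  exact PT.pair ((hs.fst.filter fun V' _ ht => ht.fst.natEq (.const ht.bd_left 1)).map
    fun V' _ ht => (PT.const ht.bd_left 0).pair ht.snd) hs.snd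

theorem bestOf (hT : PT K X T) : PT K X fun i => bestOf (T i) := by
  refine hT.foldl' (.const hT.bd_left _) ?_ fun V hV ha he =>
    (ha.fst.le he.snd.fst).ite he.snd ha
  refine (((Ctx.Bd.const (esize ((0 : ℚ), ([] : List (ℕ × Vec d))))).add
    hT.bd_right).comap _).mono fun q => ?_
  rcases (bestOf_foldl q.1.2 (0, [])).1 with h | ⟨s, hs, h⟩
  · rw [h]; omega
  · rw [h]
    have h1 := esize_mem (q.2.subset hs)
    have h2 : esize s = 1 + esize s.1 + esize s.2 := esize_pair _ _
    omega

theorem lookup {pl : ι → List (ℕ × Vec d)} (hj : PT K X j) (hpl : PT K X pl) :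
    PT K X fun i => lookup (pl i) (j i) := by
  refine hpl.foldl' (.const hj.bd_left none) ?_ fun V hV ha he =>
    (he.fst.natEq (hV hj)).ite ?_ ha
  · refine (((Ctx.Bd.const 2).add hpl.bd_right).comap _).mono fun q => ?_
    rcases lookup_foldl (j q.1.1) q.1.2 none with h | ⟨p, hp, _, h⟩
    · rw [h]; change 1 ≤ _; omega
    · rw [h]
      have h1 := esize_mem (q.2.subset hp)
      have h2 : esize p = 1 + esize p.1 + esize p.2 := esize_pair _ _
      change 1 + 1 + esize p.2 ≤ _
      omega
  · exact ((PT.const he.bd_left ()).pair he.snd).congr fun _ => rfl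

end Pieces

section Input

variable {inp : ι → List (Obj d)}

theorem indexed (h : PT K X inp) : PT K X fun i => indexed (inp i) := by
  refine (h.foldl' ((PT.const h.bd_left 0).pair (.nil h.bd_left)) ?_ fun V hV ha he =>
    (ha.fst.natAdd (.const he.bd_left 1)).pair ((ha.fst.pair he).cons ha.snd)).snd
  refine ((((Ctx.Bd.const 4).add h.bd_right).add (h.bd_right.mul
    (((Ctx.Bd.const 4).add h.bd_right).add h.bd_right))).comap _).mono fun q => ?_
  rw [indexed_foldl]
  dsimp only
  rw [List.append_nil, esize_pair, esize_reverse, zero_add, esize_nat]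
  have h1 := esize_le_of_sublist q.2.sublist
  have h2 := length_lt_esize q.1.2
  have h3 := Nat.size_le_self_add_one q.1.2.length
  have h4 : esize ((q.1.2.zipIdx 0).map Prod.swap) ≤
      1 + ((q.1.2.zipIdx 0).map Prod.swap).length *
        (1 + (3 + esize (inp q.1.1) + esize (inp q.1.1))) := by
    refine esize_list_le fun a ha => ?_
    obtain ⟨⟨b, n⟩, hb, rfl⟩ := List.mem_map.1 ha
    have h5 := List.mem_zipIdx hb
    have h6 : b ∈ q.1.2 := by rw [h5.2.2]; exact List.getElem_mem _
    have h7 := esize_mem h6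
    have h8 := Nat.size_le_self_add_one n
    rw [Prod.swap_prod_mk, esize_pair, esize_nat]
    omega
  rw [List.length_map, List.length_zipIdx] at h4
  have h5 := Nat.mul_le_mul_right (1 + (3 + esize (inp q.1.1) + esize (inp q.1.1)))
    (h2.le.trans h1)
  have h6 : 1 + (3 + esize (inp q.1.1) + esize (inp q.1.1)) =
    4 + esize (inp q.1.1) + esize (inp q.1.1) := by ring
  rw [h6] at h4 h5
  omega

theorem output {pl : ι → List (ℕ × Vec d)} (h : PT K X inp) (hpl : PT K X pl) :
    PT K X fun i => output (inp i) (pl i) :=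
  h.indexed.reverse.map fun V hV he => he.fst.lookup (hV hpl)

theorem levelSpine (P : Params d) (h : PT K X inp) : PT K X fun i => levelSpine P (inp i) :=
  (PT.const h.bd_left _).append (h.flatMap fun V hV he => PT.bits
    (PT.floorNat (((PT.const he.bd_left 1).div he.snd.fst).abs) fun _ => abs_nonneg _))

theorem esize_inv_nat_le (n : ℕ) : esize (1 / (n : ℚ)) ≤ 3 + Nat.size n := by
  rcases Nat.eq_zero_or_pos n with rfl | hn
  · simp [esize_rat]
  · have := esize_div_le 1 n hn
    simp at this
    simp
    omega

theorem size_pow_le (n k : ℕ) : Nat.size (n ^ k) ≤ 1 + k * Nat.size n := by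
  induction k with
  | zero => simp
  | succ k ih =>
    rw [pow_succ, Nat.succ_mul]
    have := Nat.size_mul_le (n ^ k) n
    omega

theorem size_res_le (P : Params d) (l : ℕ) :
    Nat.size (P.first * P.ratio ^ l) ≤ Nat.size P.first + (1 + l * Nat.size P.ratio) :=
  (Nat.size_mul_le _ _).trans (Nat.add_le_add_left (size_pow_le _ _) _)

theorem levels (P : Params d) (h : PT K X inp) : PT K X fun i => levels P (inp i) := by
  have hs := h.levelSpine P
  refine PT.cons (.const h.bd_left _) (PT.reverse (PT.snd (hs.foldl' (.const h.bd_left _) ?_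
    fun V hV ha he => ?_)))
  · refine Ctx.Bd.mono (g := fun q => 2 + (3 + (Nat.size P.first + (1 +
        (1 + esize (GeoKnapsack.levelSpine P (inp q.1.1))) * Nat.size P.ratio))) +
        esize (GeoKnapsack.levelSpine P (inp q.1.1)) * (2 + esize P.cfg + (3 + (Nat.size P.first +
        (1 + (1 + esize (GeoKnapsack.levelSpine P (inp q.1.1))) * Nat.size P.ratio))))) ?_
        fun q => ?_
    · have hb : K.Bd fun i => 3 + (Nat.size P.first + (1 +
          (1 + esize (GeoKnapsack.levelSpine P (inp i))) * Nat.size P.ratio)) :=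
        (Ctx.Bd.const 3).add ((Ctx.Bd.const _).add ((Ctx.Bd.const 1).add
          (((Ctx.Bd.const 1).add hs.bd_right).mul (.const _))))
      exact (((Ctx.Bd.const 2).add hb).add (hs.bd_right.mul ((Ctx.Bd.const _).add hb))).comap _
    · rw [levels_foldl]
      dsimp only
      set B := esize (GeoKnapsack.levelSpine P (inp q.1.1)) with hB
      have h1 := esize_le_of_sublist q.2.sublist
      have h2 := length_lt_esize q.1.2
      have hr : ∀ j, 1 / (P.first : ℚ) / P.ratio / (P.ratio : ℚ) ^ j = P.res (j + 1) := by
        intro j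
        rw [Params.res, div_div, div_div]
        push_cast
        ring
      have h3 : ∀ j ≤ B, esize (P.res (j + 1)) ≤ 3 + (Nat.size P.first +
          (1 + (1 + B) * Nat.size P.ratio)) := by
        intro j hj
        refine (esize_inv_nat_le _).trans ?_
        have := size_res_le P (j + 1)
        have : (j + 1) * Nat.size P.ratio ≤ (1 + B) * Nat.size P.ratio :=
          Nat.mul_le_mul_right _ (by omega)
        omega
      rw [List.append_nil, esize_pair, esize_reverse, hr]
      have h4 : esize ((List.range q.1.2.length).map fun j =>
          (1 / (P.first : ℚ) / P.ratio / (P.ratio : ℚ) ^ j, P.cfg)) ≤ 1 + q.1.2.length *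
            (1 + (1 + (3 + (Nat.size P.first + (1 + (1 + B) * Nat.size P.ratio))) +
              esize P.cfg)) := by
        refine (esize_list_le fun a ha => ?_).trans (by rw [List.length_map, List.length_range])
        obtain ⟨j, hj, rfl⟩ := List.mem_map.1 ha
        have := h3 j (by have := List.mem_range.1 hj; omega)
        rw [esize_pair, hr]
        omega
      have h5 := Nat.mul_le_mul_right (1 + (1 + (3 + (Nat.size P.first + (1 + (1 + B) *
        Nat.size P.ratio))) + esize P.cfg)) (h2.le.trans h1)
      have h6 := h3 q.1.2.length (by omega)
      have h7 : 1 + (1 + (3 + (Nat.size P.first + (1 + (1 + B) * Nat.size P.ratio))) +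
        esize P.cfg) = 2 + esize P.cfg + (3 + (Nat.size P.first + (1 + (1 + B) *
        Nat.size P.ratio))) := by ring
      rw [h7] at h4 h5
      rw [← hB] at h5
      omega
  · exact (ha.fst.div (.const ha.bd_left _)).pair ((ha.fst.pair (.const ha.bd_left _)).cons ha.snd)

end Input

end PT

/-! ### Tables with one best entry per key, and invariants of the run -/

section Table

variable {d : ℕ}

/-- The numbers of tokens of each label. -/
def stateKey (J : ℕ) (s : Partial d) : Fin J → ℕ := fun j => countLabel j s.1

theorem sameKey_iff {J : ℕ} {s s' : Partial d} :
    sameKey J s s' = true ↔ stateKey J s = stateKey J s' := by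
  simp only [sameKey, List.all_eq_true, List.mem_range, decide_eq_true_eq, stateKey, funext_iff]
  exact ⟨fun h j => h j j.2, fun h j hj => h ⟨j, hj⟩⟩

/-- A table contains a partial solution with the key of `s` that is at least as good. -/
def Dominated (J : ℕ) (tbl : List (Partial d)) (s : Partial d) : Prop :=
  ∃ u ∈ tbl, stateKey J u = stateKey J s ∧ s.2.1 ≤ u.2.1

/-- The scan carries a candidate `a.2` and the passed entries `a.1`. An entry with the candidate's
key is merged with it, the more profitable of the two surviving. The two `Nodup` conditions say that
a passed entry shares its key neither with the candidate nor with an unread entry. -/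
theorem insertState_foldl_spec (J : ℕ) (tbl : List (Partial d)) :
    ∀ a : List (Partial d) × Partial d,
    ((a.2 :: a.1).map (stateKey J)).Nodup → ((a.1 ++ tbl).map (stateKey J)).Nodup →
    let r := tbl.foldl (fun (a : List (Partial d) × Partial d) e =>
      if sameKey J e a.2 = true then (a.1, if a.2.2.1 ≤ e.2.1 then e else a.2)
      else (e :: a.1, a.2)) a
    ((r.2 :: r.1).map (stateKey J)).Nodup ∧
      ∀ u ∈ a.2 :: (a.1 ++ tbl), Dominated J (r.2 :: r.1) u := by
  induction tbl with
  | nil =>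
    intro a h1 _
    exact ⟨h1, fun u hu => ⟨u, by simpa using hu, rfl, le_rfl⟩⟩
  | cons e tbl ih =>
    intro a h1 h2
    simp only [List.foldl_cons]
    have hperm : ((a.1 ++ e :: tbl).map (stateKey J)).Perm ((e :: (a.1 ++ tbl)).map (stateKey J)) :=
      List.perm_middle.map _
    have h2' := hperm.nodup_iff.1 h2
    rw [List.map_cons, List.nodup_cons] at h2'
    by_cases hk : sameKey J e a.2 = true
    · rw [if_pos hk]
      have hk' := sameKey_iff.1 hk
      set b : Partial d := if a.2.2.1 ≤ e.2.1 then e else a.2 with hb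
      have hbk : stateKey J b = stateKey J a.2 := by
        rw [hb]; split_ifs
        · exact hk'
        · rfl
      obtain ⟨h3, h4⟩ := ih (a.1, b) (by simpa [hbk] using h1) h2'.2
      refine ⟨h3, fun u hu => ?_⟩
      have hbe : e.2.1 ≤ b.2.1 ∧ a.2.2.1 ≤ b.2.1 := by
        rw [hb]; split_ifs with h
        · exact ⟨le_rfl, h⟩
        · exact ⟨(not_le.1 h).le, le_rfl⟩
      obtain ⟨v, hv, hv1, hv2⟩ := h4 b (by simp)
      have hmem : u = a.2 ∨ u = e ∨ u ∈ a.1 ++ tbl := by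
        simp only [List.mem_cons, List.mem_append] at hu ⊢; tauto
      rcases hmem with rfl | rfl | hu
      · exact ⟨v, hv, hv1.trans hbk, hbe.2.trans hv2⟩
      · exact ⟨v, hv, hv1.trans (hbk.trans hk'.symm), hbe.1.trans hv2⟩
      · exact h4 u (List.mem_cons_of_mem _ hu)
    · rw [if_neg hk]
      have hk' : stateKey J e ≠ stateKey J a.2 := fun h => hk (sameKey_iff.2 h)
      obtain ⟨h3, h4⟩ := ih (e :: a.1, a.2) (by
        rw [List.map_cons, List.nodup_cons] at h1
        simp only [List.map_cons, List.nodup_cons, List.mem_cons, not_or]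
        refine ⟨⟨hk'.symm, h1.1⟩, fun h => h2'.1 ?_, h1.2⟩
        rw [List.map_append]; exact List.mem_append_left _ h) (by
        simpa [List.nodup_cons] using h2')
      refine ⟨h3, fun u hu => h4 u ?_⟩
      simp only [List.mem_cons, List.mem_append] at hu ⊢
      tauto

theorem insertState_spec {J : ℕ} {tbl : List (Partial d)} (h : (tbl.map (stateKey J)).Nodup)
    (s : Partial d) : ((insertState J tbl s).map (stateKey J)).Nodup ∧
      ∀ u ∈ s :: tbl, Dominated J (insertState J tbl s) u := by
  have := insertState_foldl_spec J tbl ([], s) (by simp) (by simpa using h)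
  exact this

theorem prune_foldl_spec (cap J : ℕ) (l : List (Partial d)) : ∀ tbl : List (Partial d),
    (tbl.map (stateKey J)).Nodup → (∀ s ∈ tbl, s.1.length ≤ cap) →
    let r := l.foldl (fun tbl s => if s.1.length ≤ cap then insertState J tbl s else tbl) tbl
    (r.map (stateKey J)).Nodup ∧ (∀ s ∈ r, s.1.length ≤ cap) ∧
      (∀ u ∈ tbl, Dominated J r u) ∧ ∀ u ∈ l, u.1.length ≤ cap → Dominated J r u := by
  induction l with
  | nil =>
    intro tbl h1 h2
    exact ⟨h1, h2, fun u hu => ⟨u, hu, rfl, le_rfl⟩, by simp⟩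
  | cons s l ih =>
    intro tbl h1 h2
    simp only [List.foldl_cons]
    by_cases hs : s.1.length ≤ cap
    · rw [if_pos hs]
      obtain ⟨h3, h4⟩ := insertState_spec h1 s
      obtain ⟨h5, h6, h7, h8⟩ := ih (insertState J tbl s) h3 fun u hu => by
        rcases List.mem_cons.1 ((insertState_subperm J tbl s).subset hu) with rfl | hu
        · exact hs
        · exact h2 u hu
      have h9 : ∀ u ∈ s :: tbl, Dominated J (l.foldl (fun tbl s =>
          if s.1.length ≤ cap then insertState J tbl s else tbl) (insertState J tbl s)) u := by
        intro u hu
        obtain ⟨v, hv, hv1, hv2⟩ := h4 u hu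
        obtain ⟨w, hw, hw1, hw2⟩ := h7 v hv
        exact ⟨w, hw, hw1.trans hv1, hv2.trans hw2⟩
      refine ⟨h5, h6, fun u hu => h9 u (List.mem_cons_of_mem _ hu), fun u hu hc => ?_⟩
      rcases List.mem_cons.1 hu with rfl | hu
      · exact h9 u (by simp)
      · exact h8 u hu hc
    · rw [if_neg hs]
      obtain ⟨h5, h6, h7, h8⟩ := ih tbl h1 h2
      refine ⟨h5, h6, h7, fun u hu hc => ?_⟩
      rcases List.mem_cons.1 hu with rfl | hu
      · exact absurd hc hs
      · exact h8 u hu hc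

theorem prune_spec (cap J : ℕ) (l : List (Partial d)) :
    ((prune cap J l).map (stateKey J)).Nodup ∧ (∀ s ∈ prune cap J l, s.1.length ≤ cap) ∧
      ∀ u ∈ l, u.1.length ≤ cap → Dominated J (prune cap J l) u :=
  have h := prune_foldl_spec cap J l [] (by simp) (by simp)
  ⟨h.1, h.2.1, h.2.2.2⟩

/-- The tables that occur in the algorithm. -/
def TableOK (cap J : ℕ) (tbl : List (Partial d)) : Prop :=
  (tbl.map (stateKey J)).Nodup ∧ ∀ s ∈ tbl, s.1.length ≤ cap

theorem TableOK.prune (cap J : ℕ) (l : List (Partial d)) : TableOK cap J (prune cap J l) :=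
  ⟨(prune_spec cap J l).1, (prune_spec cap J l).2.1⟩

/-- Keys are distinct vectors of `J` numbers that are at most `cap`. As `J` is a constant of the
program and `cap` is linear in the number of objects, tables have polynomial length. -/
theorem TableOK.length_le {cap J : ℕ} {tbl : List (Partial d)} (h : TableOK cap J tbl) :
    tbl.length ≤ (cap + 1) ^ J := by
  -- `Fin.ofNat` reduces modulo `cap + 1`, which is injective on the keys in the table.
  let F : (Fin J → ℕ) → Fin J → Fin (cap + 1) := fun k j => Fin.ofNat (cap + 1) (k j)
  have h1 : ((tbl.map (stateKey J)).map F).Nodup := by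
    refine List.Nodup.map_on ?_ h.1
    intro x hx y hy hxy
    obtain ⟨s, hs, rfl⟩ := List.mem_map.1 hx
    obtain ⟨u, hu, rfl⟩ := List.mem_map.1 hy
    have hle : ∀ v ∈ tbl, ∀ j, stateKey J v j < cap + 1 := fun v hv j =>
      Nat.lt_succ_of_le ((List.length_filter_le _ _).trans (h.2 v hv))
    funext j
    have := congrArg Fin.val (congrFun hxy j)
    simpa [F, Fin.ofNat, Nat.mod_eq_of_lt (hle s hs j), Nat.mod_eq_of_lt (hle u hu j)] using this
  have h2 := h1.length_le_card
  simpa using h2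

variable {P : Params d} {O : Val → Bool} {inp : List (Obj d)}

theorem openAll_ok {cap J : ℕ} {lev : ℚ × List (Config d)} (sp : List Unit) :
    ∀ {tbl : List (Partial d)}, TableOK cap J tbl → TableOK cap J (openAll cap J lev sp tbl) := by
  induction sp with
  | nil => exact fun h => h
  | cons _ sp ih => exact fun _ => ih (TableOK.prune _ _ _)

theorem placeAll_ok {cap : ℕ} {h : ℚ} (its : List (Item d)) :
    ∀ {tbl : List (Partial d)}, TableOK cap P.labels tbl →
      TableOK cap P.labels (placeAll P O cap h its tbl) := by
  induction its with
  | nil => exact fun h => h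
  | cons _ its ih => exact fun _ => ih (TableOK.prune _ _ _)

theorem stateAt_ok (l : ℕ) : TableOK (capOf inp) P.labels (stateAt P O inp l).2 := by
  cases l with
  | zero => exact ⟨by simp [stateAt], by simp [stateAt, capOf]; omega⟩
  | succ l => exact TableOK.prune _ _ _

/-- A property of partial solutions that is preserved by all steps of the algorithm. The set `A`
contains the indices of the items that were treated. -/
structure StateInv (P : Params d) (O : Val → Bool) (inp : List (Obj d))
    (Inv : ℕ → Set ℕ → Partial d → Prop) : Prop where
  init : Inv 0 ∅ ([(0, fun _ => 0)], (0, []))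
  openCell : ∀ l A s κ s', Inv l A s → κ ∈ (P.level l).2 → s' ∈ openCell (P.res l) κ s →
    s'.1.length ≤ capOf inp → Inv l A s'
  placeItem : ∀ l A s it s', Inv l A s → it ∈ indexed inp → it.1 ∉ A →
    isLarge P O (P.res l) it = true →
    s' ∈ placeItem (itemLabel P O (P.res l) it) it s → Inv l (insert it.1 A) s'
  mono : ∀ l A A' s, A ⊆ A' → Inv l A s → Inv l A' s
  advance : ∀ l A s, Inv l A s → Inv (l + 1) A (advance s)

variable {Inv : ℕ → Set ℕ → Partial d → Prop}

theorem StateInv.openAll (H : StateInv P O inp Inv) {l : ℕ} {A : Set ℕ} (sp : List Unit) :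
    ∀ {tbl : List (Partial d)}, (∀ s ∈ tbl, Inv l A s) →
      ∀ s ∈ openAll (capOf inp) P.labels (P.level l) sp tbl, Inv l A s := by
  induction sp with
  | nil => exact fun h => h
  | cons _ sp ih =>
    intro tbl h
    refine ih (tbl := openStep (capOf inp) P.labels (P.level l) tbl) fun s hs => ?_
    have hc := (TableOK.prune _ _ _).2 s hs
    rcases List.mem_append.1 ((prune_subperm _ _ _).subset hs) with hs | hs
    · exact h s hs
    · obtain ⟨u, hu, hs⟩ := List.mem_flatMap.1 hs
      obtain ⟨κ, hκ, hs⟩ := List.mem_flatMap.1 hs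
      exact H.openCell l A u κ s (h u hu) hκ hs hc

theorem StateInv.placeAll (H : StateInv P O inp Inv) {l : ℕ} (its : List (Item d)) :
    ∀ {A : Set ℕ} {tbl : List (Partial d)}, (its.map Prod.fst).Nodup →
      (∀ it ∈ its, it ∈ indexed inp ∧ it.1 ∉ A ∧ isLarge P O (P.res l) it = true) →
      (∀ s ∈ tbl, Inv l A s) →
      ∀ s ∈ placeAll P O (capOf inp) (P.res l) its tbl,
        Inv l (A ∪ {i | i ∈ its.map Prod.fst}) s := by
  induction its with
  | nil => intro A tbl _ _ h; simpa [GeoKnapsack.placeAll] using h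
  | cons it its ih =>
    intro A tbl hnd hits h s hs
    rw [List.map_cons, List.nodup_cons] at hnd
    have hit := hits it (by simp)
    have h1 := ih (A := insert it.1 A) (tbl := placeStep (capOf inp) P.labels
      (itemLabel P O (P.res l) it) it tbl) hnd.2 (fun jt hjt => ⟨(hits jt (by simp [hjt])).1, ?_,
        (hits jt (by simp [hjt])).2.2⟩) (fun u hu => ?_) s hs
    · refine H.mono _ _ _ _ ?_ h1
      intro i hi
      simp only [Set.mem_union, Set.mem_insert_iff, Set.mem_ofPred_eq, List.map_cons,
        List.mem_cons] at hi ⊢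
      tauto
    · rintro (h2 | h2)
      · exact hnd.1 (h2 ▸ List.mem_map_of_mem hjt)
      · exact (hits jt (by simp [hjt])).2.1 h2
    · rcases List.mem_append.1 ((prune_subperm _ _ _).subset hu) with hu | hu
      · exact H.mono _ _ _ _ (Set.subset_insert _ _) (h u hu)
      · obtain ⟨v, hv, hu⟩ := List.mem_flatMap.1 hu
        exact H.placeItem l A v it u (h v hv) hit.1 hit.2.1 hit.2.2 hu

theorem indexed_nodup (inp : List (Obj d)) : ((indexed inp).map Prod.fst).Nodup := by
  have h := indexed_reverse inp
  rw [← List.nodup_reverse, ← List.map_reverse, h, List.map_map]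
  have : (Prod.fst ∘ Prod.swap : Obj d × ℕ → ℕ) = Prod.snd := rfl
  rw [this, List.zipIdx_map_snd]
  exact List.nodup_range'

theorem stateAt_sublist (l : ℕ) : (stateAt P O inp l).1.Sublist (indexed inp) := by
  induction l with
  | zero => exact List.Sublist.refl _
  | succ l ih => exact List.filter_sublist.trans ih

/-- Items that were large at an earlier level have left the list, so the remaining ones have indices
outside the set `A` of treated items. This is what allows a placement step to assume that its item
has not been placed before. -/
theorem StateInv.stateAt (H : StateInv P O inp Inv) (l : ℕ) :
    ∃ A : Set ℕ, (∀ it ∈ (stateAt P O inp l).1, it.1 ∉ A) ∧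
      ∀ s ∈ (stateAt P O inp l).2, Inv l A s := by
  induction l with
  | zero => exact ⟨∅, by simp, fun s hs => List.mem_singleton.1 hs ▸ H.init⟩
  | succ l ih =>
    obtain ⟨A, hA, hs⟩ := ih
    have hsub := stateAt_sublist (P := P) (O := O) (inp := inp) l
    have hnd : ((GeoKnapsack.stateAt P O inp l).1.map Prod.fst).Nodup :=
      (indexed_nodup inp).sublist (hsub.map _)
    set big := (GeoKnapsack.stateAt P O inp l).1.filter fun it => isLarge P O (P.res l) it with hbig
    have h1 := H.placeAll big (hnd.sublist (List.filter_sublist.map _)) (fun it hit =>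
      ⟨hsub.subset (List.mem_of_mem_filter hit), hA it (List.mem_of_mem_filter hit),
        (List.mem_filter.1 hit).2⟩) (H.openAll (openSpine inp) hs)
    refine ⟨A ∪ {i | i ∈ big.map Prod.fst}, ?_, ?_⟩
    · intro it hit
      obtain ⟨h2, h3⟩ := List.mem_filter.1 hit
      rintro (h4 | h4)
      · exact hA it h2 h4
      · obtain ⟨jt, hjt, h5⟩ := List.mem_map.1 h4
        have h6 := List.inj_on_of_nodup_map hnd (List.mem_of_mem_filter hjt) h2 h5
        subst h6
        have h7 := (List.mem_filter.1 hjt).2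
        have h3' : (!isLarge P O (P.res l) jt) = true := h3
        rw [h7] at h3'
        exact absurd h3' (by simp)
    · intro s hs'
      obtain ⟨u, hu, rfl⟩ := List.mem_map.1 ((prune_subperm _ _ _).subset hs')
      exact H.advance _ _ _ (h1 u hu)

end Table

/-! ### Polynomial bounds for all data of the dynamic program -/

section SizeBounds

variable {d : ℕ}

/-- Bounds for the configurations of the algorithm. -/
structure Params.Bounded (P : Params d) (C : ℕ) : Prop where
  first_pos : 0 < P.first
  ratio_pos : 0 < P.ratio
  one_lt_labels : 1 < P.labels
  labels : ∀ l, ∀ κ ∈ (P.level l).2, ∀ p ∈ κ, 0 < p.1 ∧ p.1 < P.labels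
  offsets : ∀ l, ∀ κ ∈ (P.level l).2, ∀ p ∈ κ, ∀ k, |p.2 k| ≤ (C : ℤ)

/-- A bound for the size of the coordinates of tokens. -/
def coordBound (P : Params d) (C l : ℕ) : ℕ :=
  3 + 2 * (Nat.size P.first + l * Nat.size P.ratio) + (l + 1) * C

/-- Size conditions for partial solutions. -/
structure SizeInv (P : Params d) (inp : List (Obj d)) (C l : ℕ) (A : Set ℕ) (s : Partial d) :
    Prop where
  label : ∀ t ∈ s.1, t.1 < P.labels
  lattice : ∀ t ∈ s.1, ∀ k, ∃ z : ℤ, t.2 k = z / ((P.first * P.ratio ^ l : ℕ) : ℚ)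
  abs_le : ∀ t ∈ s.1, ∀ k, |t.2 k| ≤ ((l + 1) * C : ℕ)
  abs_le_zero : ∀ t ∈ s.1, t.1 = 0 → ∀ k, |t.2 k| ≤ (l * C : ℕ)
  length_le : s.1.length ≤ capOf inp
  nodup : (s.2.2.map Prod.fst).Nodup
  index : ∀ p ∈ s.2.2, p.1 ∈ A ∧ p.1 < inp.length
  size_placed : ∀ p ∈ s.2.2, ∀ k, esize (p.2 k) ≤ 2 * (coordBound P C l + esize inp)
  profit : ∃ (z : ℤ) (D : ℕ), 0 < D ∧ s.2.1 = z / D ∧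
    Nat.size z.natAbs ≤ 1 + s.2.2.length * (esize inp + 1) ∧
    Nat.size D ≤ 1 + s.2.2.length * (esize inp + 1)

variable {P : Params d} {C : ℕ} {inp : List (Obj d)} {O : Val → Bool}

theorem mem_indexed {it : Item d} (h : it ∈ indexed inp) :
    it.2 ∈ inp ∧ it.1 < inp.length := by
  have h1 : it ∈ (indexed inp).reverse := by simpa using h
  rw [indexed_reverse] at h1
  obtain ⟨⟨o, n⟩, h2, rfl⟩ := List.mem_map.1 h1
  have h3 := List.mem_zipIdx h2
  refine ⟨?_, by simpa using h3.2.1⟩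
  have h4 : o = inp[n - 0]'(by omega) := h3.2.2
  simp only [Prod.swap_prod_mk]
  rw [h4]
  exact List.getElem_mem _

/-- The denominator divides `P.first * P.ratio ^ l`, and the absolute value is linear in `l`; both
contribute a number of bits that is polynomial in the level. -/
theorem coord_size {P : Params d} (hP : P.Bounded C) {l : ℕ} {x : ℚ}
    (h : ∃ z : ℤ, x = z / ((P.first * P.ratio ^ l : ℕ) : ℚ)) (ha : |x| ≤ ((l + 1) * C : ℕ)) :
    esize x ≤ coordBound P C l := by
  obtain ⟨z, rfl⟩ := h
  have hD : 0 < P.first * P.ratio ^ l := Nat.mul_pos hP.first_pos (pow_pos hP.ratio_pos _)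
  refine (esize_div_le z _ hD).trans ?_
  have h1 := size_res_le P l
  have h2 : z.natAbs ≤ ((l + 1) * C) * (P.first * P.ratio ^ l) := by
    have hD' : (0 : ℚ) < ((P.first * P.ratio ^ l : ℕ) : ℚ) := by exact_mod_cast hD
    rw [abs_div, abs_of_pos hD', div_le_iff₀ hD', ← Int.cast_abs, Int.abs_eq_natAbs] at ha
    exact_mod_cast ha
  have h3 := (Nat.size_le_size h2).trans (Nat.size_mul_le _ _)
  have h4 := Nat.size_le_self_add_one ((l + 1) * C)
  rw [coordBound]
  omega
where
  size_res_le (P : Params d) (l : ℕ) :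
      Nat.size (P.first * P.ratio ^ l) ≤ Nat.size P.first + (1 + l * Nat.size P.ratio) :=
    PT.size_res_le P l

theorem coordBound_mono (P : Params d) (C : ℕ) {l m : ℕ} (h : l ≤ m) :
    coordBound P C l ≤ coordBound P C m := by
  have h1 := Nat.mul_le_mul_right (Nat.size P.ratio) h
  have h2 := Nat.mul_le_mul_right C (Nat.succ_le_succ h)
  simp only [coordBound, Nat.succ_eq_add_one] at *
  omega

theorem res_pos (hP : P.Bounded C) (l : ℕ) : 0 < P.res l := by
  have hD : 0 < P.first * P.ratio ^ l := Nat.mul_pos hP.first_pos (pow_pos hP.ratio_pos _)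
  rw [Params.res]
  exact div_pos one_pos (by exact_mod_cast hD)

theorem res_le_one (hP : P.Bounded C) (l : ℕ) : P.res l ≤ 1 := by
  have hD : 0 < P.first * P.ratio ^ l := Nat.mul_pos hP.first_pos (pow_pos hP.ratio_pos _)
  rw [Params.res, div_le_one (by exact_mod_cast hD)]
  exact_mod_cast hD

/-- Configurations contain no token with label `0`, so a new token is never opened again at its own
level. Positions therefore move by at most `C` per level, and they stay on the lattice of the
current resolution. -/
theorem sizeInv (hP : P.Bounded C) : StateInv P O inp (SizeInv P inp C) where
  init := by
    refine ⟨?_, ?_, ?_, ?_, ?_, ?_, ?_, ?_, ⟨0, 1, by norm_num, by simp, by simp, by simp⟩⟩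
    · simp only [List.mem_singleton, forall_eq]; have := hP.one_lt_labels; omega
    · simp only [List.mem_singleton, forall_eq]; exact fun _ => ⟨0, by simp⟩
    · simp only [List.mem_singleton, forall_eq]; exact fun _ => by simp
    · simp only [List.mem_singleton, forall_eq]; exact fun _ _ => by simp
    · simp [capOf]; omega
    · simp
    · simp
    · simp
  openCell := by
    intro l A s κ s' h hκ hs' hcap
    obtain ⟨x, hx, rfl⟩ := List.mem_map.1 hs'
    have hp := extract_mem hx
    have h0 : ((0, x) : Token d) ∈ s.1 := hp.subset (by simp)
    have hrest : ∀ t ∈ (extract 0 s.1).2, t ∈ s.1 := fun t ht => hp.subset (by simp [ht])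
    have hD : ((P.first * P.ratio ^ l : ℕ) : ℚ) ≠ 0 := by
      exact_mod_cast (Nat.mul_pos hP.first_pos (pow_pos hP.ratio_pos _)).ne'
    refine ⟨?_, ?_, ?_, ?_, hcap, h.nodup, h.index, h.size_placed, h.profit⟩
    · intro t ht
      rcases List.mem_append.1 ht with ht | ht
      · obtain ⟨p, hp', rfl⟩ := List.mem_map.1 ht
        exact (hP.labels l κ hκ p hp').2
      · exact h.label t (hrest t ht)
    · intro t ht k
      rcases List.mem_append.1 ht with ht | ht
      · obtain ⟨p, hp', rfl⟩ := List.mem_map.1 ht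
        obtain ⟨z, hz⟩ := h.lattice _ h0 k
        refine ⟨z + p.2 k, ?_⟩
        simp only at hz
        simp only [shiftBy, hz, Params.res]
        push_cast
        field_simp
      · exact h.lattice t (hrest t ht) k
    · intro t ht k
      rcases List.mem_append.1 ht with ht | ht
      · obtain ⟨p, hp', rfl⟩ := List.mem_map.1 ht
        have h1 := h.abs_le_zero _ h0 rfl k
        have h2 : |((p.2 k : ℤ) : ℚ)| ≤ (C : ℚ) := by
          rw [← Int.cast_abs]; exact_mod_cast hP.offsets l κ hκ p hp' k
        have h3 : |P.res l * (p.2 k : ℚ)| ≤ C := by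
          rw [abs_mul, abs_of_pos (res_pos hP l)]
          exact (mul_le_of_le_one_left (abs_nonneg _) (res_le_one hP l)).trans h2
        refine (abs_add_le _ _).trans ((add_le_add h1 h3).trans (le_of_eq ?_))
        push_cast; ring
      · exact h.abs_le t (hrest t ht) k
    · intro t ht ht0 k
      rcases List.mem_append.1 ht with ht | ht
      · obtain ⟨p, hp', rfl⟩ := List.mem_map.1 ht
        exact absurd ht0 (hP.labels l κ hκ p hp').1.ne'
      · exact h.abs_le_zero t (hrest t ht) ht0 k
  placeItem := by
    intro l A s it s' h hit hitA _ hs'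
    obtain ⟨x, hx, rfl⟩ := List.mem_map.1 hs'
    have hp := extract_mem hx
    set j := itemLabel P O (P.res l) it
    have h0 : ((j, x) : Token d) ∈ s.1 := hp.subset (by simp)
    have hrest : ∀ t ∈ (extract j s.1).2, t ∈ s.1 := fun t ht => hp.subset (by simp [ht])
    obtain ⟨hin, hlt⟩ := mem_indexed hit
    have hsz := esize_mem hin
    have hit2 : esize it.2 = 1 + esize it.2.1 + (1 + esize it.2.2.1 + esize it.2.2.2) := by
      rw [← esize_pair, ← esize_pair]
    refine ⟨fun t ht => h.label t (hrest t ht), fun t ht => h.lattice t (hrest t ht),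
      fun t ht => h.abs_le t (hrest t ht), fun t ht => h.abs_le_zero t (hrest t ht), ?_, ?_, ?_,
      ?_, ?_⟩
    · have := hp.length_eq
      rw [List.length_cons] at this
      have := h.length_le
      simp only; omega
    · rw [List.map_cons, List.nodup_cons]
      refine ⟨fun hm => ?_, h.nodup⟩
      obtain ⟨p, hp1, hp2⟩ := List.mem_map.1 hm
      exact hitA (hp2 ▸ (h.index p hp1).1)
    · intro p hp'
      rcases List.mem_cons.1 hp' with rfl | hp'
      · exact ⟨Set.mem_insert _ _, hlt⟩
      · exact ⟨Set.mem_insert_of_mem _ (h.index p hp').1, (h.index p hp').2⟩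
    · intro p hp' k
      rcases List.mem_cons.1 hp' with rfl | hp'
      · have h1 := coord_size hP (h.lattice _ h0 k) (h.abs_le _ h0 k)
        have h2 := esize_vec_apply_le it.2.2.2 k
        have h3 := esize_sub_le (x k) (it.2.2.2 k)
        simp only at *
        omega
      · exact h.size_placed p hp' k
    · obtain ⟨z, D, hD, hz, h1, h2⟩ := h.profit
      -- The fraction is deliberately not reduced: each placed item then adds at most `esize inp +
      -- 1` to the bit lengths, whereas iterating `esize_add_le` would double the bound with every
      -- item.
      refine ⟨z * it.2.1.den + it.2.1.num * D, D * it.2.1.den, Nat.mul_pos hD it.2.1.den_pos,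
        ?_, ?_, ?_⟩
      · have e1 : (D : ℚ) ≠ 0 := by exact_mod_cast hD.ne'
        have e2 : (it.2.1.den : ℚ) ≠ 0 := by exact_mod_cast it.2.1.den_ne_zero
        simp only [hz]
        conv_lhs => rw [← Rat.num_div_den it.2.1]
        push_cast
        field_simp
      · refine (Nat.size_le_size (Int.natAbs_add_le _ _)).trans ((Nat.size_add_le _ _).trans ?_)
        rw [Int.natAbs_mul, Int.natAbs_mul, Int.natAbs_natCast, Int.natAbs_natCast]
        have e1 := Nat.size_mul_le z.natAbs it.2.1.den
        have e2 := Nat.size_mul_le it.2.1.num.natAbs D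
        have e3 := esize_rat it.2.1
        rw [List.length_cons, Nat.succ_mul]
        omega
      · have e1 := Nat.size_mul_le D it.2.1.den
        have e3 := esize_rat it.2.1
        rw [List.length_cons, Nat.succ_mul]
        omega
  mono := fun l A A' s hA h => ⟨h.label, h.lattice, h.abs_le, h.abs_le_zero, h.length_le, h.nodup,
    fun p hp => ⟨hA (h.index p hp).1, (h.index p hp).2⟩, h.size_placed, h.profit⟩
  advance := by
    intro l A s h
    have hm : ∀ t ∈ (advance s).1, t.1 = 0 ∧ ∃ u ∈ s.1, t.2 = u.2 := by
      intro t ht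
      obtain ⟨u, hu, rfl⟩ := List.mem_map.1 ht
      exact ⟨rfl, u, List.mem_of_mem_filter hu, rfl⟩
    refine ⟨?_, ?_, ?_, ?_, ?_, h.nodup, h.index, ?_, h.profit⟩
    · intro t ht
      have := (hm t ht).1
      have := hP.one_lt_labels
      omega
    · intro t ht k
      obtain ⟨-, u, hu, e⟩ := hm t ht
      obtain ⟨z, hz⟩ := h.lattice u hu k
      refine ⟨z * P.ratio, ?_⟩
      have e1 : (P.first : ℚ) ≠ 0 := by exact_mod_cast hP.first_pos.ne'
      have e2 : (P.ratio : ℚ) ≠ 0 := by exact_mod_cast hP.ratio_pos.ne'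
      rw [e, hz]
      push_cast
      field_simp
      ring
    · intro t ht k
      obtain ⟨-, u, hu, e⟩ := hm t ht
      rw [e]
      exact (h.abs_le u hu k).trans (by exact_mod_cast Nat.mul_le_mul_right C (by omega))
    · intro t ht _ k
      obtain ⟨-, u, hu, e⟩ := hm t ht
      rw [e]
      exact h.abs_le u hu k
    · refine le_trans ?_ h.length_le
      rw [advance, List.length_map]
      exact List.length_filter_le _ _
    · intro p hp k
      have := coordBound_mono P C (Nat.le_succ l)
      have := h.size_placed p hp k
      rw [Nat.succ_eq_add_one] at *
      omega

/-- A bound for the sizes of all tables up to level `l`, for inputs of size `N`. -/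
def tableBound (P : Params d) (C N l : ℕ) : ℕ :=
  1 + (3 * N + 4) ^ P.labels * (1 + (3 + (1 + (3 * N + 3) * (4 + P.labels + (1 + d * (1 +
    coordBound P C l)))) + (1 + 2 * (1 + N * (N + 1))) + (1 + N * (4 + N + (1 + d * (1 +
      2 * (coordBound P C l + N)))))))

theorem placed_length_le {A : Set ℕ} {l : ℕ} {s : Partial d} (h : SizeInv P inp C l A s) :
    s.2.2.length ≤ inp.length := by
  have h1 : s.2.2.map Prod.fst ⊆ List.range inp.length := by
    intro i hi
    obtain ⟨p, hp, rfl⟩ := List.mem_map.1 hi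
    exact List.mem_range.2 (h.index p hp).2
  simpa using (h.nodup.subperm h1).length_le

theorem table_size (hP : P.Bounded C) {l : ℕ} {tbl : List (Partial d)}
    (hT : TableOK (capOf inp) P.labels tbl) (h : ∀ s ∈ tbl, ∃ A, SizeInv P inp C l A s) :
    esize tbl ≤ tableBound P C (esize inp) l := by
  have hn := length_lt_esize inp
  set N := esize inp with hN
  have hcap : capOf inp ≤ 3 * N + 3 := by rw [capOf]; omega
  have h1 : ∀ s ∈ tbl, esize s ≤ 3 + (1 + (3 * N + 3) * (4 + P.labels + (1 + d * (1 +
      coordBound P C l)))) + (1 + 2 * (1 + N * (N + 1))) + (1 + N * (4 + N + (1 + d * (1 +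
      2 * (coordBound P C l + N))))) := by
    intro s hs
    obtain ⟨A, hA⟩ := h s hs
    have e1 : esize s = 1 + esize s.1 + (1 + esize s.2.1 + esize s.2.2) := by
      rw [← esize_pair, ← esize_pair]
    have e2 : esize s.1 ≤ 1 + s.1.length * (4 + P.labels + (1 + d * (1 + coordBound P C l))) := by
      refine (esize_list_le (B := 3 + P.labels + (1 + d * (1 + coordBound P C l)))
        fun t ht => ?_).trans (le_of_eq (by ring))
      have e3 : esize t = 1 + esize t.1 + esize t.2 := esize_pair _ _
      have e4 : esize t.2 ≤ _ :=
        esize_vec_le fun k => coord_size hP (hA.lattice t ht k) (hA.abs_le t ht k)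
      have e5 := hA.label t ht
      have e6 := Nat.size_le_self_add_one t.1
      rw [esize_nat] at e3
      omega
    have e3 := Nat.mul_le_mul_right (4 + P.labels + (1 + d * (1 + coordBound P C l)))
      (hA.length_le.trans hcap)
    have e4 := placed_length_le hA
    have e5 : esize s.2.2 ≤ 1 + s.2.2.length * (4 + N + (1 + d * (1 +
        2 * (coordBound P C l + N)))) := by
      refine (esize_list_le (B := 3 + N + (1 + d * (1 + 2 * (coordBound P C l + N))))
        fun t ht => ?_).trans (le_of_eq (by ring))
      have e3 : esize t = 1 + esize t.1 + esize t.2 := esize_pair _ _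
      have e4 : esize t.2 ≤ 1 + d * (1 + 2 * (coordBound P C l + N)) :=
        esize_vec_le fun k => hA.size_placed t ht k
      have e5 := (hA.index t ht).2
      have e6 := Nat.size_le_self_add_one t.1
      rw [esize_nat] at e3
      omega
    have e6 := Nat.mul_le_mul_right (4 + N + (1 + d * (1 + 2 * (coordBound P C l + N))))
      (e4.trans hn.le)
    obtain ⟨z, D, hD, hz, h1, h2⟩ := hA.profit
    have e7 := esize_div_le z D hD
    rw [← hz] at e7
    rw [← hN] at h1 h2
    have e8 := Nat.mul_le_mul_right (N + 1) (e4.trans hn.le)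
    omega
  refine (esize_list_le h1).trans (Nat.add_le_add_left (Nat.mul_le_mul_right _ ?_) _)
  exact hT.length_le.trans (Nat.pow_le_pow_left (by omega) _)

theorem tableBound_mono (P : Params d) (C N : ℕ) {l m : ℕ} (h : l ≤ m) :
    tableBound P C N l ≤ tableBound P C N m := by
  have := coordBound_mono P C h
  unfold tableBound
  gcongr

namespace PT

variable {ι α : Type} [Enc α] {K : Ctx ι} {X : ι → α} {inp : ι → List (Obj d)}

theorem coordBound_bd {n : ι → ℕ} (hn : K.Bd n) : K.Bd fun i => coordBound P C (n i) :=
  ((Ctx.Bd.const 3).add ((Ctx.Bd.const 2).mul ((Ctx.Bd.const _).add (hn.mul (.const _))))).add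
    ((hn.add (.const 1)).mul (.const C))

theorem tableBound_bd {N n : ι → ℕ} (hN : K.Bd N) (hn : K.Bd n) :
    K.Bd fun i => tableBound P C (N i) (n i) := by
  have h1 : K.Bd fun i => coordBound P C (n i) := coordBound_bd hn
  have h3N := (Ctx.Bd.const (K := K) 3).mul hN
  exact (Ctx.Bd.const 1).add (((h3N.add (.const 4)).pow _).mul ((Ctx.Bd.const 1).add
    ((((Ctx.Bd.const 3).add ((Ctx.Bd.const 1).add ((h3N.add (.const 3)).mul ((Ctx.Bd.const _).add
      ((Ctx.Bd.const 1).add ((Ctx.Bd.const d).mul ((Ctx.Bd.const 1).add h1))))))).add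
      ((Ctx.Bd.const 1).add ((Ctx.Bd.const 2).mul ((Ctx.Bd.const 1).add
        (hN.mul (hN.add (.const 1))))))).add ((Ctx.Bd.const 1).add (hN.mul
          (((Ctx.Bd.const 4).add hN).add ((Ctx.Bd.const 1).add ((Ctx.Bd.const d).mul
            ((Ctx.Bd.const 1).add ((Ctx.Bd.const 2).mul (h1.add hN)))))))))))

/-- Every list of levels met by the outer fold has the form `P.level 0, P.level 1, …`, so the states
reached are values of `stateAt`, for which `sizeInv` and the bound on the number of keys control the
table. The same argument after some opening and placing passes provides the bounds required by
`levelStep`. -/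
theorem solve (hP : P.Bounded C) (h : PT K X inp) :
    PT K X fun i => solve P (K.oracle i) (inp i) := by
  have hlev := h.levels P
  have hcap : PT K X fun i => capOf (inp i) :=
    (PT.const h.bd_left 3).natMul (h.length.natAdd (.const h.bd_left 1))
  have hspine : PT K X fun i => openSpine (inp i) :=
    (PT.const h.bd_left ()).cons (h.map fun V _ he => .const he.bd_left ())
  have hN := h.bd_right
  have hlen : K.Bd fun i => (GeoKnapsack.levels P (inp i)).length :=
    hlev.bd_right.mono fun i => (length_lt_esize _).le
  have hTB : K.Bd fun i => tableBound P C (esize (inp i)) (GeoKnapsack.levels P (inp i)).length :=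
    tableBound_bd hN hlen
  have hpre : ∀ (i : ι) (l : List (ℚ × List (Config d))), l <+: GeoKnapsack.levels P (inp i) →
      l = (List.range l.length).map P.level ∧ l.length ≤ (GeoKnapsack.levels P (inp i)).length := by
    intro i l hl
    refine ⟨?_, hl.length_le⟩
    have h1 := List.prefix_iff_eq_take.1 hl
    have h2 := hl.length_le
    rw [levels_eq] at h1 h2
    rw [List.length_map, List.length_range] at h2
    rw [← List.map_take, List.take_range, min_eq_left h2] at h1
    exact h1
  have hst : ∀ (i : ι) (l : List (ℚ × List (Config d))), l <+: GeoKnapsack.levels P (inp i) →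
      l.foldl (GeoKnapsack.levelStep P (K.oracle i) (capOf (inp i)) (openSpine (inp i)))
        (GeoKnapsack.indexed (inp i), [([(0, fun _ => 0)], (0, []))]) =
      stateAt P (K.oracle i) (inp i) l.length := by
    intro i l hl
    rw [(hpre i l hl).1, foldl_levels]; simp
  refine PT.bestOf (PT.snd (hlev.foldl' (h.indexed.pair (.const h.bd_left _)) ?_
    fun V hV ha he => ?_))
  · refine ((((Ctx.Bd.const 1).add h.indexed.bd_right).add hTB).comap _).mono fun q => ?_
    rw [hst _ _ q.2]
    have h1 := esize_le_of_sublist (stateAt_sublist (P := P) (O := K.oracle q.1.1)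
      (inp := inp q.1.1) q.1.2.length)
    obtain ⟨A, -, h2⟩ := (sizeInv (O := K.oracle q.1.1) (inp := inp q.1.1) hP).stateAt q.1.2.length
    have h3 := table_size hP (stateAt_ok (P := P) (O := K.oracle q.1.1) (inp := inp q.1.1)
      q.1.2.length) fun s hs => ⟨A, h2 s hs⟩
    have h4 := tableBound_mono P C (esize (inp q.1.1)) (hpre _ _ q.2).2
    change esize ((stateAt P (K.oracle q.1.1) (inp q.1.1) q.1.2.length).1,
      (stateAt P (K.oracle q.1.1) (inp q.1.1) q.1.2.length).2) ≤ _
    rw [esize_pair]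
    omega
  · have hlast : ∀ q : FoldIdx fun i => GeoKnapsack.levels P (inp i),
        q.1.2.1 <+: GeoKnapsack.levels P (inp q.1.1) ∧ q.1.2.2 = P.level q.1.2.1.length ∧
        q.1.2.1.length ≤ (GeoKnapsack.levels P (inp q.1.1)).length := by
      intro q
      have h1 := (List.prefix_append _ _).trans q.2
      refine ⟨h1, ?_, h1.length_le⟩
      have h2 := (hpre _ _ q.2).1
      rw [List.length_append, List.length_singleton, List.range_succ, List.map_append] at h2
      have h3 := List.append_inj_right' h2 (by simp)
      simpa using h3
    refine (hV hcap).levelStep P (hV hspine) ha he ?_ ?_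
    · refine (((hTB.comap fun q : FoldIdx _ => q.1.1)).comap _).mono fun q => ?_
      obtain ⟨h1, h2, h3⟩ := hlast q.1.1
      obtain ⟨A, -, h4⟩ := (sizeInv (O := K.oracle q.1.1.1.1) (inp := inp q.1.1.1.1) hP).stateAt
        q.1.1.1.2.1.length
      rw [hst _ _ h1, h2]
      refine (table_size hP (openAll_ok _ (stateAt_ok _)) fun s hs => ⟨A, ?_⟩).trans
        (tableBound_mono P C _ h3)
      exact (sizeInv (O := K.oracle q.1.1.1.1) hP).openAll _ h4 s hs
    · refine (((hTB.comap fun q : FoldIdx _ => q.1.1)).comap _).mono fun q => ?_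
      obtain ⟨h1, h2, h3⟩ := hlast q.1.1
      obtain ⟨A, hA, h4⟩ := (sizeInv (O := K.oracle q.1.1.1.1) (inp := inp q.1.1.1.1) hP).stateAt
        q.1.1.1.2.1.length
      have h5 := q.2
      rw [hst _ _ h1, h2] at h5
      have hsub := stateAt_sublist (P := P) (O := K.oracle q.1.1.1.1) (inp := inp q.1.1.1.1)
        q.1.1.1.2.1.length
      rw [hst _ _ h1, h2]
      refine (table_size hP (placeAll_ok _ (openAll_ok _ (stateAt_ok _))) fun s hs =>
        ?_).trans (tableBound_mono P C _ h3)
      · have h7 := (sizeInv (O := K.oracle q.1.1.1.1) (inp := inp q.1.1.1.1) hP).placeAll q.1.2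
          ?_ (fun it hit => ?_) ((sizeInv (O := K.oracle q.1.1.1.1) hP).openAll _ h4) s hs
        · exact ⟨_, h7⟩
        · exact (indexed_nodup _).sublist ((h5.sublist.trans
            (List.filter_sublist.trans hsub)).map _)
        · have h6 := List.mem_filter.1 (h5.subset hit)
          exact ⟨hsub.subset h6.1, hA it h6.1, h6.2⟩

theorem solveAll (Ps : List (Params d)) (hP : ∀ P ∈ Ps, ∃ C, P.Bounded C) (h : PT K X inp) :
    PT K X fun i => solveAll (K.oracle i) (inp i) Ps := by
  induction Ps with
  | nil => exact .const h.bd_left _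
  | cons P Ps ih =>
    obtain ⟨C, hC⟩ := hP P (by simp)
    have h1 := h.solve hC
    have h2 := ih fun Q hQ => hP Q (by simp [hQ])
    exact (h1.fst.le h2.fst).ite h2 h1

end PT

end SizeBounds

/-! ### Weak membership tests on fat convex bodies -/

section Bodies

variable {d : ℕ}

theorem norm_le_of_coord_le {v : E d} {a : ℝ} (h : ∀ k, |v k| ≤ a) : ‖v‖ ≤ d * a := by
  rcases Nat.eq_zero_or_pos d with rfl | hd
  · have : v = 0 := by ext k; exact k.elim0
    simp [this]
  · have ha : 0 ≤ a := (abs_nonneg _).trans (h ⟨0, hd⟩)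
    rw [EuclideanSpace.norm_eq, Real.sqrt_le_left (by positivity)]
    have h1 : ∑ k, ‖v k‖ ^ 2 ≤ ∑ _k : Fin d, a ^ 2 := Finset.sum_le_sum fun k _ => by
      rw [Real.norm_eq_abs]; exact pow_le_pow_left₀ (abs_nonneg _) (h k) 2
    refine h1.trans ?_
    rw [Finset.sum_const, Finset.card_univ, Fintype.card_fin, nsmul_eq_mul, mul_pow]
    have h2 : (d : ℝ) ≤ (d : ℝ) ^ 2 := by
      have : (1 : ℝ) ≤ d := by exact_mod_cast hd
      nlinarith
    exact mul_le_mul_of_nonneg_right h2 (sq_nonneg a)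

theorem abs_coord_le_norm (v : E d) (k : Fin d) : |v k| ≤ ‖v‖ := by
  simpa using PiLp.norm_apply_le v k

theorem abs_coord_sub_le_dist (x y : E d) (k : Fin d) : |x k - y k| ≤ dist x y := by
  rw [dist_eq_norm]; exact abs_coord_le_norm (x - y) k

theorem dist_le_of_coord_le {x y : E d} {a : ℝ} (h : ∀ k, |x k - y k| ≤ a) :
    dist x y ≤ d * a := by
  rw [dist_eq_norm]; exact norm_le_of_coord_le h

/-- A convex set that contains a ball of radius `r` and has diameter at most `F * r`. -/
structure FatWith (F r : ℝ) (K : Set (E d)) : Prop where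
  convex : Convex ℝ K
  pos : 0 < r
  one_le : 1 ≤ F
  ball : ∃ z, Metric.closedBall z r ⊆ K
  diam : ∀ x ∈ K, ∀ y ∈ K, dist x y ≤ F * r

/-- The homothety with center `x` and ratio `s` maps the given ball into `K`, by convexity. -/
theorem Convex.closedBall_subset_of_mem {K : Set (E d)} (hK : Convex ℝ K) {x z : E d} {r : ℝ}
    (hx : x ∈ K) (hz : Metric.closedBall z r ⊆ K) {s : ℝ} (hs : 0 < s) (hs1 : s ≤ 1) :
    Metric.closedBall (x + s • (z - x)) (s * r) ⊆ K := by
  intro w hw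
  rw [mem_closedBall_iff_norm] at hw
  set u := s⁻¹ • (w - (x + s • (z - x))) with hu
  have hur : ‖u‖ ≤ r := by
    rw [hu, norm_smul, norm_inv, Real.norm_of_nonneg hs.le, inv_mul_le_iff₀ hs]
    exact hw
  have h1 : z + u ∈ K := hz (by rw [mem_closedBall_iff_norm]; simpa using hur)
  have h2 : w = (1 - s) • x + s • (z + u) := by
    rw [hu, smul_add, smul_smul, mul_inv_cancel₀ hs.ne', one_smul, smul_sub, sub_smul, one_smul]
    abel
  rw [h2]
  exact hK hx h1 (by linarith) hs.le (by ring)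

/-- The point that is tested for the test vector `t`. -/
noncomputable def testPoint (c : Vec d) (h : ℚ) (t : Vec d) : E d :=
  toPoint fun k => c k + h * t k

theorem testPoint_apply (c : Vec d) (h : ℚ) (t : Vec d) (k : Fin d) :
    testPoint c h t k = c k + h * t k := by
  simp [testPoint, toPoint]

/-- The test points form a grid of width `1 / q` in a cube of radius `W`; the far ones are those
outside of the cube of radius `Kf`. -/
structure IsGrid (P : Params d) (q W Kf : ℕ) : Prop where
  mem_tests : ∀ t, t ∈ P.tests ↔ ∃ z : Fin d → ℤ, (∀ k, |z k| ≤ (W * q : ℕ)) ∧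
    t = fun k => (z k : ℚ) / q
  mem_far : ∀ t, t ∈ P.far ↔ t ∈ P.tests ∧ ∃ k, (Kf : ℚ) ≤ |t k|
  prec : P.prec = 1 / (q : ℚ)
  two_le : 2 ≤ q
  two_le_far : 2 ≤ Kf
  far_lt : Kf + 2 ≤ W

/-- Answers of a weak membership oracle for the tests at resolution `h`. -/
structure IsTest (K : Set (E d)) (c : Vec d) (h : ℚ) (q : ℕ) (ans : Vec d → Bool) : Prop where
  yes : ∀ t, ans t = true → ∃ y ∈ K, dist (testPoint c h t) y ≤ h / q
  no : ∀ t, ans t = false → ¬ Metric.closedBall (testPoint c h t) (h / q) ⊆ K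

variable {K : Set (E d)} {c : Vec d} {h : ℚ} {q W Kf : ℕ} {ans : Vec d → Bool} {P : Params d}
  {F r : ℝ}

/-- Contracting the inner ball towards `x` gives a ball of radius `h / (2F)` inside `K` whose center
differs from `x` by at most `h / 2` in each coordinate. Rounding this center to the test grid moves
it by at most `d * (h / q)`, and since `q` is large the precision ball of the rounded point still
fits. The oracle cannot reject such a test. -/
theorem FatWith.exists_test (hK : FatWith F r K) (hP : IsGrid P q W Kf)
    (hq : 2 * F * (d + 1) ≤ q) (hh : 0 < h) (hr : h ≤ 2 * F * r) {x : E d} (hx : x ∈ K)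
    (hxc : ∀ k, |x k - c k| ≤ (W - 1) * h) :
    ∃ t ∈ P.tests, Metric.closedBall (testPoint c h t) (h / q) ⊆ K ∧
      ∀ k, |testPoint c h t k - x k| ≤ h := by
  obtain ⟨z, hz⟩ := hK.ball
  have hF : 0 < F := one_pos.trans_le hK.one_le
  have hr0 := hK.pos
  have hh' : (0 : ℝ) < h := by exact_mod_cast hh
  have hq2 : (2 : ℝ) ≤ q := by exact_mod_cast hP.two_le
  have hq0 : (0 : ℝ) < q := by linarith
  set s : ℝ := h / (2 * F * r) with hs
  have hs0 : 0 < s := by positivity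
  have hs1 : s ≤ 1 := by rw [hs, div_le_one (by positivity)]; exact hr
  have hball := Convex.closedBall_subset_of_mem hK.convex hx hz hs0 hs1
  have hsr : s * r = h / (2 * F) := by rw [hs]; field_simp
  set y := x + s • (z - x) with hy
  have hyx : ∀ k, |y k - x k| ≤ h / 2 := by
    intro k
    have h1 : y k - x k = s * (z k - x k) := by simp [hy]
    rw [h1, abs_mul, abs_of_pos hs0]
    have h2 : |z k - x k| ≤ F * r := (abs_coord_sub_le_dist z x k).trans
      (hK.diam z (hz (Metric.mem_closedBall_self hr0.le)) x hx)
    calc s * |z k - x k| ≤ s * (F * r) := mul_le_mul_of_nonneg_left h2 hs0.le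
      _ = h / 2 := by rw [hs]; field_simp
  set n : Fin d → ℤ := fun k => ⌊(y k - c k) / h * q⌋ with hn
  have hnk : ∀ k, (n k : ℝ) ≤ (y k - c k) / h * q ∧ (y k - c k) / h * q < n k + 1 := fun k =>
    ⟨Int.floor_le _, Int.lt_floor_add_one _⟩
  have hty : ∀ k, |testPoint c h (fun k => (n k : ℚ) / q) k - y k| ≤ h / q := by
    intro k
    rw [testPoint_apply]
    obtain ⟨h1, h2⟩ := hnk k
    push_cast
    have h3 : (c k + h * (n k / q) - y k : ℝ) = (n k - (y k - c k) / h * q) * (h / q) := by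
      field_simp; ring
    rw [h3, abs_mul, abs_of_pos (div_pos hh' hq0)]
    refine mul_le_of_le_one_left (div_pos hh' hq0).le ?_
    rw [abs_le]; constructor <;> linarith
  refine ⟨fun k => (n k : ℚ) / q, (hP.mem_tests _).2 ⟨n, fun k => ?_, rfl⟩, ?_, fun k => ?_⟩
  · have h1 := hxc k
    have h2 := hyx k
    have h3 : |(y k - c k) / h| ≤ W - 1 / 2 := by
      rw [abs_div, abs_of_pos hh', div_le_iff₀ hh']
      calc |y k - c k| ≤ |y k - x k| + |x k - c k| := by
            have := abs_add_le (y k - x k) (x k - c k); simpa using this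
        _ ≤ (W - 1 / 2) * h := by linarith
    obtain ⟨h4, h5⟩ := hnk k
    rw [abs_le] at h3
    have h6 : (y k - c k) / h * q ≤ (W - 1 / 2) * q := mul_le_mul_of_nonneg_right h3.2 hq0.le
    have h7 : -(W - 1 / 2) * q ≤ (y k - c k) / h * q := mul_le_mul_of_nonneg_right h3.1 hq0.le
    have h8 : |(n k : ℝ)| ≤ W * q := by
      rw [abs_le]; constructor <;> nlinarith
    have h9 : ((|n k| : ℤ) : ℝ) ≤ ((W * q : ℕ) : ℝ) := by push_cast; exact h8
    exact_mod_cast h9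
  · refine subset_trans (fun w hw => ?_) hball
    rw [Metric.mem_closedBall] at hw ⊢
    have h1 := dist_le_of_coord_le hty
    rw [hsr]
    calc dist w y ≤ h / q + d * (h / q) := (dist_triangle _ _ _).trans (add_le_add hw h1)
      _ = (d + 1) * h / q := by ring
      _ ≤ h / (2 * F) := by
        rw [div_le_div_iff₀ hq0 (by positivity)]
        nlinarith
  · have h1 := hty k
    have h2 := hyx k
    have h3 : (h : ℝ) / q ≤ h / 2 := by gcongr
    calc |testPoint c h (fun k => (n k : ℚ) / q) k - x k|
        ≤ |testPoint c h (fun k => (n k : ℚ) / q) k - y k| + |y k - x k| := abs_sub_le _ _ _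
      _ ≤ h := by linarith

/-- On the segment from the center to `x`, some point has sup-distance exactly `R` from the center.
This turns a body that reaches far out into a body point at a prescribed distance, where tests are
available. -/
theorem exists_mem_segment (hK : Convex ℝ K) (hc : toPoint c ∈ K) {x : E d} (hx : x ∈ K) {R : ℝ}
    (hR : 0 ≤ R) {k : Fin d} (hk : R < |x k - c k|) :
    ∃ y ∈ K, (∀ j, |y j - c j| ≤ R) ∧ ∃ j, |y j - c j| = R := by
  obtain ⟨m, -, hm⟩ := Finset.exists_max_image Finset.univ (fun j => |x j - c j|) ⟨k, by simp⟩
  set M := |x m - c m| with hM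
  have hMpos : R < M := hk.trans_le (hm k (by simp))
  have hM0 : 0 < M := hR.trans_lt hMpos
  have hcoord : ∀ j, (toPoint c + (R / M) • (x - toPoint c)) j - c j = R / M * (x j - c j) := by
    intro j; simp [toPoint]
  refine ⟨toPoint c + (R / M) • (x - toPoint c), ?_, fun j => ?_, m, ?_⟩
  · exact hK.add_smul_sub_mem hc hx ⟨by positivity, (div_le_one hM0).2 hMpos.le⟩
  · rw [hcoord, abs_mul, abs_of_nonneg (by positivity), div_mul_eq_mul_div, div_le_iff₀ hM0]
    exact mul_le_mul_of_nonneg_left (hm j (by simp)) hR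
  · rw [hcoord, abs_mul, abs_of_nonneg (by positivity), div_mul_cancel₀ _ hM0.ne']

/-- Some far test point is accepted. -/
def Large (P : Params d) (ans : Vec d → Bool) : Prop := ∃ t ∈ P.far, ans t = true

theorem IsTest.near (hT : IsTest K c h q ans) (hP : IsGrid P q W Kf) (hh : 0 < h) {t : Vec d}
    (ht : ans t = true) : ∃ y ∈ K, ∀ k, |testPoint c h t k - y k| ≤ h := by
  obtain ⟨y, hy, hd⟩ := hT.yes t ht
  have hh' : (0 : ℝ) < h := by exact_mod_cast hh
  have hq2 : (2 : ℝ) ≤ q := by exact_mod_cast hP.two_le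
  refine ⟨y, hy, fun k => (abs_coord_sub_le_dist _ _ k).trans (hd.trans ?_)⟩
  exact div_le_self hh'.le (by linarith)

/-- An accepted far test point is at least `Kf * h` away from the center and within `h` of the body;
the diameter bound then bounds the inner radius from below. -/
theorem IsTest.radius_of_large (hT : IsTest K c h q ans) (hK : FatWith F r K)
    (hc : toPoint c ∈ K) (hP : IsGrid P q W Kf) (hh : 0 < h) (hl : Large P ans) :
    (Kf - 1) * h ≤ F * r := by
  obtain ⟨t, ht, ha⟩ := hl
  obtain ⟨y, hy, hyt⟩ := hT.near hP hh ha
  obtain ⟨-, k, hk⟩ := (hP.mem_far t).1 ht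
  have hh' : (0 : ℝ) < h := by exact_mod_cast hh
  have hk' : (Kf : ℝ) ≤ |(t k : ℝ)| := by exact_mod_cast hk
  have h1 := hyt k
  rw [testPoint_apply] at h1
  have h2 := hK.diam y hy _ hc
  have h3 := abs_coord_sub_le_dist y (toPoint c) k
  have h4 : |(h : ℝ) * t k| ≤ |c k + h * t k - y k| + |y k - c k| := by
    have := abs_add_le (c k + h * t k - y k) (y k - c k)
    rwa [show c k + h * t k - y k + (y k - c k) = (h : ℝ) * t k by ring] at this
  rw [abs_mul, abs_of_pos hh'] at h4
  have h5 : h * (Kf : ℝ) ≤ h * |(t k : ℝ)| := mul_le_mul_of_nonneg_left hk' hh'.le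
  have h6 : |y k - c k| ≤ dist y (toPoint c) := by simpa [toPoint] using h3
  linarith

theorem IsTest.le_of_large (hT : IsTest K c h q ans) (hK : FatWith F r K)
    (hc : toPoint c ∈ K) (hP : IsGrid P q W Kf) (hh : 0 < h) (hl : Large P ans) :
    h ≤ 2 * F * r := by
  have h1 := hT.radius_of_large hK hc hP hh hl
  have h2 : (2 : ℝ) ≤ Kf := by exact_mod_cast hP.two_le_far
  have hh' : (0 : ℝ) < h := by exact_mod_cast hh
  nlinarith

theorem IsTest.accepted (hT : IsTest K c h q ans) (hK : FatWith F r K)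
    (hP : IsGrid P q W Kf) (hq : 2 * F * (d + 1) ≤ q) (hh : 0 < h) (hr : h ≤ 2 * F * r) {x : E d}
    (hx : x ∈ K) (hxc : ∀ k, |x k - c k| ≤ (W - 1) * h) :
    ∃ t ∈ P.tests, ans t = true ∧ ∀ k, |testPoint c h t k - x k| ≤ h := by
  obtain ⟨t, ht, hb, hn⟩ := hK.exists_test hP hq hh hr hx hxc
  refine ⟨t, ht, ?_, hn⟩
  by_contra ha
  exact hT.no t (by simpa using ha) hb

/-- If the body left the cube of radius `(W - 1) * h`, it would contain a point at exactly that
sup-distance, and an accepted test near this point would violate `hin`. So the whole body lies where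
`accepted` applies. -/
theorem IsTest.covered (hT : IsTest K c h q ans) (hK : FatWith F r K)
    (hc : toPoint c ∈ K) (hP : IsGrid P q W Kf) (hq : 2 * F * (d + 1) ≤ q) (hh : 0 < h)
    (hl : Large P ans) (hin : ∀ t ∈ P.tests, ans t = true → ∀ k, |t k| < W - 2) {x : E d}
    (hx : x ∈ K) : ∃ t ∈ P.tests, ans t = true ∧ ∀ k, |testPoint c h t k - x k| ≤ h := by
  have hr := hT.le_of_large hK hc hP hh hl
  have hh' : (0 : ℝ) < h := by exact_mod_cast hh
  have hW : (2 : ℝ) ≤ W := by exact_mod_cast (by have := hP.far_lt; omega : 2 ≤ W)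
  by_cases hxc : ∀ k, |x k - c k| ≤ (W - 1) * h
  · exact hT.accepted hK hP hq hh hr hx hxc
  · push Not at hxc
    obtain ⟨k, hk⟩ := hxc
    obtain ⟨y, hy, hy1, j, hj⟩ := exists_mem_segment hK.convex hc hx
      (mul_nonneg (by linarith) hh'.le) hk
    obtain ⟨t, ht, ha, hn⟩ := hT.accepted hK hP hq hh hr hy hy1
    have h1 := hn j
    rw [testPoint_apply] at h1
    have h2 : |y j - c j| ≤ |c j + h * t j - y j| + |(h : ℝ) * t j| := by
      have := abs_sub (h * t j : ℝ) (c j + h * t j - y j)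
      rwa [show (h : ℝ) * t j - (c j + h * t j - y j) = y j - c j by ring, add_comm] at this
    rw [abs_mul, abs_of_pos hh', hj] at h2
    have h3 : |(t j : ℝ)| < W - 2 := by exact_mod_cast hin t ht ha j
    exfalso
    nlinarith

/-- A body reaching beyond `(Kf + 1) * h` would contain a point at exactly this sup-distance, with
an accepted test within `h` of it, and this test would be far. If `h` exceeds `2 * F * r`, no test
is guaranteed, but the diameter is already below `h`. -/
theorem IsTest.coord_le_of_not_large (hT : IsTest K c h q ans) (hK : FatWith F r K)
    (hc : toPoint c ∈ K) (hP : IsGrid P q W Kf) (hq : 2 * F * (d + 1) ≤ q) (hh : 0 < h)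
    (hl : ¬ Large P ans) {x : E d} (hx : x ∈ K) (k : Fin d) : |x k - c k| ≤ (Kf + 1) * h := by
  have hh' : (0 : ℝ) < h := by exact_mod_cast hh
  by_cases hr : h ≤ 2 * F * r
  · by_contra hk
    push Not at hk
    obtain ⟨y, hy, hy1, j, hj⟩ := exists_mem_segment hK.convex hc hx (by positivity) hk
    have hW : (Kf + 2 : ℝ) ≤ W := by exact_mod_cast hP.far_lt
    obtain ⟨t, ht, ha, hn⟩ := hT.accepted hK hP hq hh hr hy fun k => (hy1 k).trans
      (mul_le_mul_of_nonneg_right (by linarith) hh'.le)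
    refine hl ⟨t, (hP.mem_far t).2 ⟨ht, j, ?_⟩, ha⟩
    have h1 := hn j
    rw [testPoint_apply] at h1
    have h2 : |y j - c j| ≤ |c j + h * t j - y j| + |(h : ℝ) * t j| := by
      have := abs_sub (h * t j : ℝ) (c j + h * t j - y j)
      rwa [show (h : ℝ) * t j - (c j + h * t j - y j) = y j - c j by ring, add_comm] at this
    rw [abs_mul, abs_of_pos hh', hj] at h2
    have h3 : (Kf : ℝ) ≤ |(t j : ℝ)| := by
      by_contra hlt
      push Not at hlt
      nlinarith
    exact_mod_cast h3
  · push Not at hr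
    have h1 := hK.diam x hx _ hc
    have h2 : |x k - c k| ≤ dist x (toPoint c) := by
      simpa [toPoint] using abs_coord_sub_le_dist x (toPoint c) k
    have h3 : (0 : ℝ) ≤ Kf := by positivity
    nlinarith [hK.pos, hK.one_le, mul_pos (one_pos.trans_le hK.one_le) hK.pos]

/-- The test at distance `Kf * h` along the first axis has its precision ball inside the given ball,
so the oracle has to accept it. -/
theorem IsTest.large_of_ball (hT : IsTest K c h q ans) (hd : 1 ≤ d) (hP : IsGrid P q W Kf)
    (hh : 0 < h) {ρ : ℝ} (hρ : Metric.closedBall (toPoint c) ρ ⊆ K) (hle : (Kf + 1) * h ≤ ρ) :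
    Large P ans := by
  have hh' : (0 : ℝ) < h := by exact_mod_cast hh
  have hq2 : (2 : ℝ) ≤ q := by exact_mod_cast hP.two_le
  have hq0 : (q : ℚ) ≠ 0 := by have := hP.two_le; positivity
  set k0 : Fin d := ⟨0, hd⟩
  set t : Vec d := fun k => if k = k0 then (Kf : ℚ) else 0 with ht
  have htests : t ∈ P.tests := by
    refine (hP.mem_tests t).2 ⟨fun k => if k = k0 then (Kf * q : ℤ) else 0, fun k => ?_, ?_⟩
    · have h1 : Kf * q ≤ W * q := Nat.mul_le_mul_right q (by have := hP.far_lt; omega)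
      by_cases hk : k = k0
      · simp only [hk, if_true]
        rw [abs_of_nonneg (by positivity)]
        exact_mod_cast h1
      · simp only [hk, if_false, abs_zero]; positivity
    · funext k
      by_cases hk : k = k0
      · simp [ht, hk, hq0]
      · simp [ht, hk]
  refine ⟨t, (hP.mem_far t).2 ⟨htests, k0, by simp [ht]⟩, ?_⟩
  by_contra ha
  refine hT.no t (by simpa using ha) (subset_trans (fun w hw => ?_) hρ)
  rw [Metric.mem_closedBall] at hw ⊢
  have h1 : dist (testPoint c h t) (toPoint c) = Kf * h := by
    have : testPoint c h t - toPoint c = EuclideanSpace.single k0 ((Kf : ℝ) * h) := by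
      ext k
      have e : (testPoint c h t - toPoint c) k = testPoint c h t k - c k := by simp [toPoint]
      rw [e, testPoint_apply]
      by_cases hk : k = k0
      · simp [ht, hk]; ring
      · simp [ht, hk]
    rw [dist_eq_norm, this, PiLp.norm_single, Real.norm_of_nonneg (by positivity)]
  have h2 : (h : ℝ) / q ≤ h := div_le_self hh'.le (by linarith)
  calc dist w (toPoint c) ≤ h / q + Kf * h := (dist_triangle _ _ _).trans (add_le_add hw h1.le)
    _ ≤ ρ := by linarith

end Bodies

/-! ### Regions of tokens and the geometric invariant -/

section Regions

variable {d : ℕ}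

/-- The number of cells of the next level in a cell of level `l`, in each direction. -/
def Params.ratioAt (P : Params d) (l : ℕ) : ℕ := if l = 0 then P.first else P.ratio

/-- The sets of grid cells that belong to the labels: `0` is a full cell of the current level, `1`
is a cell of the next level, and `j + 2` is the shape of an object for which `j` encodes the
answers to the tests. -/
def shape (P : Params d) (M : ℕ) : ℕ → Set (Fin d → ℤ)
  | 0 => {q | ∀ k, 0 ≤ q k ∧ q k < M}
  | 1 => {0}
  | j + 2 => {q | ∃ ans, answersCode P.tests ans = j ∧
      ∃ t ∈ P.tests, ans t = true ∧ ∀ k, |(q k : ℚ) - t k| ≤ 2}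

/-- Labels that occur in configurations. -/
def GoodLabel (P : Params d) (W : ℕ) : ℕ → Prop
  | 0 => False
  | 1 => True
  | j + 2 => (∃ ans, answersCode P.tests ans = j ∧ ∃ t ∈ P.tests, ans t = true) ∧
      ∀ ans, answersCode P.tests ans = j → ∀ t ∈ P.tests, ans t = true → ∀ k, |t k| < (W : ℚ) - 2

/-- Configurations whose shapes are disjoint and contained in a cell. -/
structure ValidConfig (P : Params d) (W M : ℕ) (κ : Config d) : Prop where
  good : ∀ p ∈ κ, GoodLabel P W p.1
  inside : ∀ p ∈ κ, ∀ q ∈ shape P M p.1, q + p.2 ∈ shape P M 0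
  disjoint : κ.Pairwise fun p p' => ∀ q ∈ shape P M p.1, ∀ q' ∈ shape P M p'.1, q + p.2 ≠ q' + p'.2

/-- The grid cell of a point, relative to a position. -/
noncomputable def gridCell (h : ℚ) (x : Vec d) (p : E d) : Fin d → ℤ :=
  fun k => ⌊(p k - x k) / h⌋

/-- The region of a token. -/
def region (P : Params d) (l : ℕ) (t : Token d) : Set (E d) :=
  {p | gridCell (P.res l) t.2 p ∈ shape P (P.ratioAt l) t.1}

/-- The input list of an instance. -/
def Instance.input (I : Instance d) : List (Obj d) :=
  List.ofFn fun i => (I.profit i, I.radius i, I.center i)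

/-- The set that is occupied by a placed object. -/
def Instance.occupied (I : Instance d) (p : ℕ × Vec d) : Set (E d) :=
  {x | ∃ hi : p.1 < I.n, x - toPoint p.2 ∈ (I.body ⟨p.1, hi⟩ : Set (E d))}

def Instance.profitOf (I : Instance d) (i : ℕ) : ℚ :=
  if hi : i < I.n then I.profit ⟨i, hi⟩ else 0

theorem gridCell_shiftBy {h : ℚ} (hh : 0 < h) (x : Vec d) (o : Fin d → ℤ) (p : E d) :
    gridCell h (shiftBy h x o) p + o = gridCell h x p := by
  funext k
  have hh' : (h : ℝ) ≠ 0 := by exact_mod_cast hh.ne'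
  simp only [gridCell, shiftBy, Pi.add_apply]
  rw [← Int.floor_add_intCast]
  congr 1
  push_cast
  field_simp
  ring

theorem Instance.mem_indexed {I : Instance d} {it : Item d} (h : it ∈ indexed I.input) :
    ∃ i : Fin I.n, it = ((i : ℕ), (I.profit i, I.radius i, I.center i)) := by
  have h1 : it ∈ (indexed I.input).reverse := by simpa using h
  rw [indexed_reverse] at h1
  obtain ⟨⟨o, n⟩, h2, rfl⟩ := List.mem_map.1 h1
  have h3 := List.mem_zipIdx h2
  have h4 : n < I.n := by simpa [Instance.input] using h3.2.1
  refine ⟨⟨n, h4⟩, ?_⟩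
  have h5 : o = I.input[n - 0]'(by have := h3.2.1; omega) := h3.2.2
  rw [Prod.swap_prod_mk, h5]
  simp [Instance.input]

theorem Instance.isTest {I : Instance d} {O : Val → Bool} (hO : I.IsOracle O) (i : Fin I.n)
    {P : Params d} {q W Kf : ℕ} (hP : IsGrid P q W Kf) {h : ℚ} (hh : 0 < h) :
    IsTest (I.body i : Set (E d)) (I.center i) h q
      (answer O P.prec h ((i : ℕ), (I.profit i, I.radius i, I.center i))) := by
  have hq : (0 : ℚ) < q := by have := hP.two_le; positivity
  have hδ : 0 < h * P.prec := by rw [hP.prec]; positivity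
  have hδ' : ((h * P.prec : ℚ) : ℝ) = h / q := by rw [hP.prec]; push_cast; ring
  have hnn : (0 : ℝ) ≤ h / q := by rw [← hδ']; exact_mod_cast hδ.le
  refine ⟨fun t ht => ?_, fun t ht => ?_⟩
  · have h1 := (hO i (fun k => I.center i k + h * t k) (h * P.prec) hδ).1 ht
    -- Compactness yields an actual body point within the precision, not only a bound on an infimum.
    rw [(I.body i).isCompact.cthickening_eq_biUnion_closedBall (by exact_mod_cast hδ.le),
      Set.mem_iUnion₂] at h1
    obtain ⟨y, hy, h2⟩ := h1
    rw [Metric.mem_closedBall, hδ'] at h2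
    exact ⟨y, hy, h2⟩
  · have h1 := (hO i (fun k => I.center i k + h * t k) (h * P.prec) hδ).2 ht
    rwa [hδ'] at h1

/-- The regions of the tokens and the placed objects are disjoint and contained in the knapsack. -/
structure RegionInv (I : Instance d) (P : Params d) (W l : ℕ) (_A : Set ℕ) (s : Partial d) :
    Prop where
  cube : ∀ t ∈ s.1, region P l t ⊆ knapsack d
  disj : s.1.Pairwise fun t t' => Disjoint (region P l t) (region P l t')
  good : ∀ t ∈ s.1, t.1 = 0 ∨ GoodLabel P W t.1
  placed_cube : ∀ p ∈ s.2.2, I.occupied p ⊆ knapsack d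
  placed_disj : s.2.2.Pairwise fun p p' => Disjoint (I.occupied p) (I.occupied p')
  cross : ∀ t ∈ s.1, ∀ p ∈ s.2.2, Disjoint (region P l t) (I.occupied p)
  profit : s.2.1 = (s.2.2.map fun p => I.profitOf p.1).sum

theorem GoodLabel.ne_zero {P : Params d} {W j : ℕ} (h : GoodLabel P W j) : j ≠ 0 := by
  rintro rfl; exact h

/-- As `ratio * res (l + 1) = res l`, one small cell of level `l` is a full cell of level `l + 1`;
relabelling in `advance` leaves the region unchanged. -/
theorem region_advance {P : Params d} {C : ℕ} (hP : P.Bounded C) (l : ℕ) (x : Vec d) :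
    region P (l + 1) (0, x) = region P l (1, x) := by
  ext p
  have h1 : (0 : ℝ) < P.res (l + 1) := by exact_mod_cast res_pos hP (l + 1)
  have h2 : (0 : ℝ) < P.res l := by exact_mod_cast res_pos hP l
  have h3 : (P.ratio : ℝ) * P.res (l + 1) = P.res l := by
    have : (P.ratio : ℚ) * P.res (l + 1) = P.res l := by
      have e1 : (P.first : ℚ) ≠ 0 := by exact_mod_cast hP.first_pos.ne'
      have e2 : (P.ratio : ℚ) ≠ 0 := by exact_mod_cast hP.ratio_pos.ne'
      simp only [Params.res]
      push_cast
      field_simp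
      ring
    exact_mod_cast this
  simp only [region, shape, Params.ratioAt, Nat.succ_ne_zero, if_false, gridCell,
    Set.mem_ofPred_eq, Set.mem_singleton_iff, funext_iff, Pi.zero_apply]
  refine forall_congr' fun k => ?_
  rw [Int.floor_nonneg, Int.floor_lt, Int.floor_eq_zero_iff, Set.mem_Ico, Int.cast_natCast,
    div_lt_iff₀ h1, div_lt_one h2, h3, le_div_iff₀ h1, le_div_iff₀ h2, zero_mul, zero_mul]

/-- A valid configuration divides the region of a cell into disjoint parts of it, and an object is
placed with its center on the position of a token whose region covers it. So occupied sets inherit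
disjointness and containment from regions. The covering hypothesis `hcov` is needed for good labels
only, since the others never occur on tokens that receive an object. -/
theorem regionInv {I : Instance d} {P : Params d} {W C : ℕ} {O : Val → Bool} (hP : P.Bounded C)
    (hcfg : ∀ l, ∀ κ ∈ (P.level l).2, ValidConfig P W (P.ratioAt l) κ)
    (hcov : ∀ l, ∀ i : Fin I.n,
      isLarge P O (P.res l) ((i : ℕ), (I.profit i, I.radius i, I.center i)) = true →
      GoodLabel P W (itemLabel P O (P.res l) ((i : ℕ), (I.profit i, I.radius i, I.center i))) →
      ∀ y ∈ (I.body i : Set (E d)), gridCell (P.res l) (I.center i) y ∈ shape P (P.ratioAt l)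
        (itemLabel P O (P.res l) ((i : ℕ), (I.profit i, I.radius i, I.center i)))) :
    StateInv P O I.input (RegionInv I P W) where
  init := by
    refine ⟨?_, by simp, by simp, by simp, by simp, by simp, by simp⟩
    simp only [List.mem_singleton, forall_eq]
    intro p hp k
    have h1 := hp k
    have hf : (0 : ℝ) < P.first := by exact_mod_cast hP.first_pos
    simp only [gridCell, Params.res, Params.ratioAt, if_true, pow_zero, mul_one, Rat.cast_zero,
      sub_zero, Int.floor_nonneg, Int.floor_lt, Int.cast_natCast, Rat.cast_div, Rat.cast_one,
      Rat.cast_natCast, div_div_eq_mul_div, div_one] at h1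
    refine ⟨nonneg_of_mul_nonneg_left h1.1 hf, ?_⟩
    have := h1.2
    nlinarith
  openCell := by
    intro l A s κ s' h hκ hs' _
    obtain ⟨x, hx, rfl⟩ := List.mem_map.1 hs'
    have hp := extract_mem hx
    have hpw := (hp.pairwise_iff (fun {a b} hab => hab.symm)).2 h.disj
    rw [List.pairwise_cons] at hpw
    have h0 : ((0, x) : Token d) ∈ s.1 := hp.subset (by simp)
    have hrest : ∀ t ∈ (extract 0 s.1).2, t ∈ s.1 := fun t ht => hp.subset (by simp [ht])
    have hv := hcfg l κ hκ
    have hsub : ∀ p ∈ κ, region P l (p.1, shiftBy (P.res l) x p.2) ⊆ region P l (0, x) := by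
      intro p hpκ y hy
      have h1 := hv.inside p hpκ _ hy
      simp only at h1
      rwa [gridCell_shiftBy (res_pos hP l)] at h1
    refine ⟨?_, ?_, ?_, h.placed_cube, h.placed_disj, ?_, h.profit⟩
    · intro t ht
      rcases List.mem_append.1 ht with ht | ht
      · obtain ⟨p, hpκ, rfl⟩ := List.mem_map.1 ht
        exact (hsub p hpκ).trans (h.cube _ h0)
      · exact h.cube t (hrest t ht)
    · rw [List.pairwise_append]
      refine ⟨?_, hpw.2, ?_⟩
      · rw [List.pairwise_map]
        refine hv.disjoint.imp fun {p p'} hpp' => Set.disjoint_left.2 fun y hy hy' => ?_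
        refine hpp' _ hy _ hy' ?_
        simp only
        rw [gridCell_shiftBy (res_pos hP l), gridCell_shiftBy (res_pos hP l)]
      · intro t ht t' ht'
        obtain ⟨p, hpκ, rfl⟩ := List.mem_map.1 ht
        exact (hpw.1 t' ht').mono_left (hsub p hpκ)
    · intro t ht
      rcases List.mem_append.1 ht with ht | ht
      · obtain ⟨p, hpκ, rfl⟩ := List.mem_map.1 ht
        exact Or.inr (hv.good p hpκ)
      · exact h.good t (hrest t ht)
    · intro t ht p' hp'
      rcases List.mem_append.1 ht with ht | ht
      · obtain ⟨p, hpκ, rfl⟩ := List.mem_map.1 ht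
        exact (h.cross _ h0 p' hp').mono_left (hsub p hpκ)
      · exact h.cross t (hrest t ht) p' hp'
  placeItem := by
    intro l A s it s' h hit _ hlarge hs'
    obtain ⟨x, hx, rfl⟩ := List.mem_map.1 hs'
    obtain ⟨i, rfl⟩ := Instance.mem_indexed hit
    have hp := extract_mem hx
    set j := itemLabel P O (P.res l) ((i : ℕ), (I.profit i, I.radius i, I.center i)) with hj
    have hpw := (hp.pairwise_iff (fun {a b} hab => hab.symm)).2 h.disj
    rw [List.pairwise_cons] at hpw
    have h0 : ((j, x) : Token d) ∈ s.1 := hp.subset (by simp)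
    have hrest : ∀ t ∈ (extract j s.1).2, t ∈ s.1 := fun t ht => hp.subset (by simp [ht])
    -- Labels of items are at least `2`, so the token is not an unopened cell.
    have hgood : GoodLabel P W j := (h.good _ h0).resolve_left (by simp [hj, itemLabel])
    have hsub : I.occupied ((i : ℕ), fun k => x k - I.center i k) ⊆ region P l (j, x) := by
      rintro y ⟨hi, hy⟩
      have h1 := hcov l i hlarge hgood _ hy
      have h2 : gridCell (P.res l) (I.center i) (y - toPoint fun k => x k - I.center i k) =
          gridCell (P.res l) x y := by
        funext k
        simp only [gridCell]
        congr 2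
        simp [toPoint]
        ring
      rw [h2] at h1
      exact h1
    refine ⟨fun t ht => h.cube t (hrest t ht), hpw.2, fun t ht => h.good t (hrest t ht), ?_, ?_, ?_,
      ?_⟩
    · intro p hp'
      rcases List.mem_cons.1 hp' with rfl | hp'
      · exact hsub.trans (h.cube _ h0)
      · exact h.placed_cube p hp'
    · rw [List.pairwise_cons]
      exact ⟨fun p hp' => (h.cross _ h0 p hp').mono_left hsub, h.placed_disj⟩
    · intro t ht p hp'
      rcases List.mem_cons.1 hp' with rfl | hp'
      · exact ((hpw.1 t ht).mono_left hsub).symm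
      · exact h.cross t (hrest t ht) p hp'
    · rw [List.map_cons, List.sum_cons, ← h.profit]
      simp [Instance.profitOf, add_comm]
  mono := fun l A A' s _ h => ⟨h.cube, h.disj, h.good, h.placed_cube, h.placed_disj, h.cross,
    h.profit⟩
  advance := by
    intro l A s h
    have hm : ∀ t ∈ (advance s).1, t.1 = 0 ∧ ∃ u ∈ s.1, region P (l + 1) t = region P l u := by
      intro t ht
      obtain ⟨u, hu, rfl⟩ := List.mem_map.1 ht
      obtain ⟨hu1, hu2⟩ := List.mem_filter.1 hu
      refine ⟨rfl, u, hu1, ?_⟩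
      rw [region_advance hP]
      have : (1, u.2) = u := by rw [← of_decide_eq_true hu2]
      rw [this]
    refine ⟨?_, ?_, fun t ht => Or.inl (hm t ht).1, h.placed_cube, h.placed_disj, ?_, h.profit⟩
    · intro t ht
      obtain ⟨-, u, hu, e⟩ := hm t ht
      rw [e]; exact h.cube u hu
    · simp only [advance]
      rw [List.pairwise_map]
      have h1 := h.disj.sublist (List.filter_sublist (p := fun t => decide (t.1 = 1)) (l := s.1))
      refine List.Pairwise.imp_of_mem (fun {a b} ha hb hab => ?_) h1
      have ha' : (1, a.2) = a := by rw [← of_decide_eq_true (List.mem_filter.1 ha).2]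
      have hb' : (1, b.2) = b := by rw [← of_decide_eq_true (List.mem_filter.1 hb).2]
      rw [region_advance hP, region_advance hP, ha', hb']
      exact hab
    · intro t ht p hp
      obtain ⟨-, u, hu, e⟩ := hm t ht
      rw [e]; exact h.cross u hu p hp

end Regions

/-! ### The output is a feasible solution with the computed profit -/

section Soundness

variable {d : ℕ}

/-- The answers are the binary digits of the code and are recovered from the last one by parity. -/
theorem answersCode_foldl_inj (tests : List (Vec d)) (a a' : Vec d → Bool) : ∀ n n' : ℕ,
    tests.foldl (fun n t => 2 * n + if a t = true then 1 else 0) n =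
      tests.foldl (fun n t => 2 * n + if a' t = true then 1 else 0) n' →
    n = n' ∧ ∀ t ∈ tests, a t = a' t := by
  induction tests with
  | nil => intro n n' h; exact ⟨h, by simp⟩
  | cons t tests ih =>
    intro n n' h
    obtain ⟨h1, h2⟩ := ih _ _ h
    have h3 : n = n' ∧ a t = a' t := by
      cases ha : a t <;> cases ha' : a' t <;> simp [ha, ha'] at h1 ⊢ <;> omega
    exact ⟨h3.1, fun u hu => (List.mem_cons.1 hu).elim (fun e => e ▸ h3.2) (h2 u)⟩

theorem answersCode_inj {tests : List (Vec d)} {a a' : Vec d → Bool}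
    (h : answersCode tests a = answersCode tests a') : ∀ t ∈ tests, a t = a' t :=
  (answersCode_foldl_inj tests a a' 0 0 h).2

theorem isLarge_iff {P : Params d} {O : Val → Bool} {h : ℚ} {it : Item d} :
    isLarge P O h it = true ↔ Large P (answer O P.prec h it) := by
  simp [isLarge, Large]

/-- The item of an object. -/
def Instance.item (I : Instance d) (i : Fin I.n) : Item d :=
  ((i : ℕ), (I.profit i, I.radius i, I.center i))

/-- One unit comes from the distance to the test point and one from rounding down; the radius `2` in
`shape` accounts for both. -/
theorem abs_gridCell_sub_le {h : ℚ} (hh : 0 < h) {c : Vec d} {t : Vec d} {y : E d} {k : Fin d}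
    (hk : |testPoint c h t k - y k| ≤ h) : |(gridCell h c y k : ℚ) - t k| ≤ 2 := by
  have hh' : (0 : ℝ) < h := by exact_mod_cast hh
  rw [testPoint_apply] at hk
  have h1 : |(y k - c k) / h - t k| ≤ 1 := by
    have e : (y k - c k) / h - t k = (y k - (c k + h * t k)) / h := by field_simp; ring
    rw [e, abs_div, abs_of_pos hh', div_le_one hh', abs_sub_comm]
    exact hk
  have h2 := Int.floor_le ((y k - c k) / (h : ℝ))
  have h3 := Int.lt_floor_add_one ((y k - c k) / (h : ℝ))
  have h4 : |((gridCell h c y k : ℤ) : ℝ) - t k| ≤ 2 := by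
    rw [abs_le] at h1 ⊢
    simp only [gridCell]
    constructor <;> linarith
  exact_mod_cast h4

theorem Instance.covered {I : Instance d} {P : Params d} {O : Val → Bool} {q W Kf : ℕ}
    (hO : I.IsOracle O) (hP : IsGrid P q W Kf) {F : ℝ} (hq : 2 * F * (d + 1) ≤ q) {i : Fin I.n}
    {r : ℝ} (hF : FatWith F r (I.body i : Set (E d)))
    (hc : toPoint (I.center i) ∈ (I.body i : Set (E d))) {h : ℚ} (hh : 0 < h) (M : ℕ)
    (hl : isLarge P O h (I.item i) = true) (hg : GoodLabel P W (itemLabel P O h (I.item i))) :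
    ∀ y ∈ (I.body i : Set (E d)),
      gridCell h (I.center i) y ∈ shape P M (itemLabel P O h (I.item i)) := by
  intro y hy
  have hT := Instance.isTest hO i hP hh
  obtain ⟨t, ht, ha, hn⟩ := hT.covered hF hc hP hq hh (isLarge_iff.1 hl)
    (fun t ht ha => hg.2 _ rfl t ht ha) hy
  exact ⟨_, rfl, t, ht, ha, fun k => abs_gridCell_sub_le hh (hn k)⟩

/-- Lists of placed objects that are feasible solutions, with their profit. -/
structure Instance.Solution (I : Instance d) (b : ℚ × List (ℕ × Vec d)) : Prop where
  nodup : (b.2.map Prod.fst).Nodup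
  index : ∀ p ∈ b.2, p.1 < I.n
  cube : ∀ p ∈ b.2, I.occupied p ⊆ knapsack d
  disj : b.2.Pairwise fun p p' => Disjoint (I.occupied p) (I.occupied p')
  profit : b.1 = (b.2.map fun p => I.profitOf p.1).sum

theorem Instance.Solution.empty (I : Instance d) : I.Solution (0, []) :=
  ⟨by simp, by simp, by simp, by simp, by simp⟩

theorem Instance.solution_solve {I : Instance d} {P : Params d} {O : Val → Bool} {W C : ℕ}
    (hP : P.Bounded C) (hR : StateInv P O I.input (RegionInv I P W)) :
    I.Solution (solve P O I.input) := by
  rw [solve, finalTable_eq]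
  set l := (levelSpine P I.input).length + 1
  obtain ⟨A, -, hA⟩ := (sizeInv (O := O) (inp := I.input) hP).stateAt l
  obtain ⟨A', -, hA'⟩ := hR.stateAt l
  rcases (bestOf_foldl (stateAt P O I.input l).2 (0, [])).1 with h | ⟨s, hs, h⟩
  · rw [bestOf, h]; exact .empty I
  · rw [bestOf, h]
    have h1 := hA s hs
    have h2 := hA' s hs
    refine ⟨h1.nodup, fun p hp => ?_, h2.placed_cube, h2.placed_disj, h2.profit⟩
    simpa [Instance.input] using (h1.index p hp).2

theorem Instance.solution_solveAll {I : Instance d} {O : Val → Bool} (Ps : List (Params d))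
    (h : ∀ P ∈ Ps, I.Solution (solve P O I.input)) : I.Solution (solveAll O I.input Ps) := by
  induction Ps with
  | nil => exact .empty I
  | cons P Ps ih =>
    rw [solveAll]
    split_ifs
    · exact ih fun Q hQ => h Q (by simp [hQ])
    · exact h P (by simp)

theorem le_solveAll {O : Val → Bool} {inp : List (Obj d)} {Ps : List (Params d)} {P : Params d}
    (h : P ∈ Ps) : (solve P O inp).1 ≤ (solveAll O inp Ps).1 := by
  induction Ps with
  | nil => simp at h
  | cons Q Ps ih =>
    rw [solveAll]
    rcases List.mem_cons.1 h with rfl | h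
    · split_ifs with h1
      · exact h1
      · exact le_rfl
    · split_ifs with h1
      · exact ih h
      · exact (ih h).trans (not_le.1 h1).le

theorem lookup_foldl_eq_none (i : ℕ) (pl : List (ℕ × Vec d)) : ∀ o : Option (Vec d),
    pl.foldl (fun o p => if p.1 = i then some p.2 else o) o = none ↔
      o = none ∧ ∀ p ∈ pl, p.1 ≠ i := by
  induction pl with
  | nil => simp
  | cons p pl ih =>
    intro o
    rw [List.foldl_cons, ih]
    by_cases h : p.1 = i <;> simp [h]

theorem lookup_eq_some {pl : List (ℕ × Vec d)} {i : ℕ} {t : Vec d} (h : lookup pl i = some t) :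
    (i, t) ∈ pl := by
  rcases lookup_foldl i pl none with h1 | ⟨p, hp, h1, h2⟩
  · rw [lookup, h1] at h; simp at h
  · rw [lookup, h2] at h
    obtain rfl := Option.some.inj h
    rw [← h1]
    exact hp

theorem lookup_isSome {pl : List (ℕ × Vec d)} {i : ℕ} :
    (lookup pl i).isSome ↔ i ∈ pl.map Prod.fst := by
  rw [← Option.ne_none_iff_isSome, ne_eq, lookup, lookup_foldl_eq_none]
  simp only [true_and, not_forall, not_not, List.mem_map]
  exact ⟨fun ⟨p, hp, h⟩ => ⟨p, hp, h⟩, fun ⟨p, hp, h⟩ => ⟨p, hp, h⟩⟩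

theorem Instance.occupied_eq (I : Instance d) (i : Fin I.n) (t : Vec d) :
    I.occupied ((i : ℕ), t) = toPoint t +ᵥ (I.body i : Set (E d)) := by
  ext x
  rw [Set.mem_vadd_set_iff_neg_vadd_mem, vadd_eq_add, neg_add_eq_sub]
  exact ⟨fun ⟨_, h⟩ => h, fun h => ⟨i.2, h⟩⟩

theorem Instance.Solution.feasible {I : Instance d} {b : ℚ × List (ℕ × Vec d)}
    (h : I.Solution b) :
    I.Feasible fun i => (lookup b.2 i).map toPoint := by
  refine ⟨fun i t hi => ?_, fun i j s t hij hi hj => ?_⟩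
  · obtain ⟨v, hv, rfl⟩ := Option.map_eq_some_iff.1 hi
    rw [← I.occupied_eq]
    exact h.cube _ (lookup_eq_some hv)
  · obtain ⟨v, hv, rfl⟩ := Option.map_eq_some_iff.1 hi
    obtain ⟨w, hw, rfl⟩ := Option.map_eq_some_iff.1 hj
    rw [← I.occupied_eq, ← I.occupied_eq]
    refine Disjoint.mono interior_subset interior_subset ?_
    have : Std.Symm fun p p' => Disjoint (I.occupied p) (I.occupied p') :=
      ⟨fun _ _ hab => Disjoint.symm hab⟩
    exact h.disj.forall (lookup_eq_some hv) (lookup_eq_some hw)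
      fun e => hij (Fin.ext (congrArg Prod.fst e))

theorem Instance.Solution.totalProfit {I : Instance d} {b : ℚ × List (ℕ × Vec d)}
    (h : I.Solution b) : I.totalProfit (fun i => lookup b.2 i) = b.1 := by
  have h1 : b.1 = ∑ j ∈ (b.2.map Prod.fst).toFinset, I.profitOf j := by
    rw [List.sum_toFinset _ h.nodup, List.map_map, h.profit]; rfl
  have h2 : (b.2.map Prod.fst).toFinset =
      (Finset.range I.n).filter fun j => (lookup b.2 j).isSome := by
    ext j
    rw [List.mem_toFinset, Finset.mem_filter, Finset.mem_range, lookup_isSome]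
    refine ⟨fun hj => ⟨?_, hj⟩, fun hj => hj.2⟩
    obtain ⟨p, hp, rfl⟩ := List.mem_map.1 hj
    exact h.index p hp
  rw [h1, h2, Finset.sum_filter, Finset.sum_range]
  refine Finset.sum_congr rfl fun i _ => ?_
  simp [Instance.profitOf]

theorem Instance.enc_output (I : Instance d) (pl : List (ℕ × Vec d)) :
    enc (output I.input pl) = placementCode fun i : Fin I.n => lookup pl i := by
  have h1 : output I.input pl = List.ofFn fun i : Fin I.n => lookup pl i := by
    rw [output, indexed_reverse, List.map_map]
    apply List.ext_getElem
    · simp [Instance.input]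
    · intro n h1 h2
      simp
  rw [h1]
  simp only [enc, placementCode, List.map_ofFn]
  congr 2
  funext i
  simp only [Function.comp_apply]
  cases lookup pl i <;> rfl

theorem Instance.enc_input (I : Instance d) : enc I.input = I.code := by
  simp only [enc, Instance.input, Instance.code, List.map_ofFn]
  rfl

end Soundness

/-! ### The tables dominate every admissible sequence of steps -/

section Completeness

variable {d : ℕ}

/-- The multiset of the labels of the tokens. -/
def labelsOf (s : Partial d) : Multiset ℕ := ↑(s.1.map Prod.fst)

def LabelsOK (J : ℕ) (tbl : List (Partial d)) : Prop := ∀ s ∈ tbl, ∀ t ∈ s.1, t.1 < J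

/-- The table contains a partial solution with given labels and at least the given profit. -/
def HasState (tbl : List (Partial d)) (m : Multiset ℕ) (p : ℚ) : Prop :=
  ∃ s ∈ tbl, labelsOf s = m ∧ p ≤ s.2.1

theorem count_labelsOf (j : ℕ) (s : Partial d) : (labelsOf s).count j = countLabel j s.1 := by
  rw [labelsOf, Multiset.coe_count, countLabel, List.count, List.countP_map,
    List.countP_eq_length_filter]
  congr 2

/-- A key counts only the labels below `J`, so it determines the multiset of labels once all labels
are below `J`. -/
theorem labelsOf_eq {J : ℕ} {s s' : Partial d} (h : stateKey J s = stateKey J s')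
    (hs : ∀ t ∈ s.1, t.1 < J) (hs' : ∀ t ∈ s'.1, t.1 < J) : labelsOf s = labelsOf s' := by
  ext j
  by_cases hj : j < J
  · rw [count_labelsOf, count_labelsOf]
    exact congrFun h ⟨j, hj⟩
  · rw [Multiset.count_eq_zero_of_notMem, Multiset.count_eq_zero_of_notMem]
    · intro hm
      obtain ⟨t, ht, rfl⟩ := List.mem_map.1 (Multiset.mem_coe.1 hm)
      exact hj (hs' t ht)
    · intro hm
      obtain ⟨t, ht, rfl⟩ := List.mem_map.1 (Multiset.mem_coe.1 hm)
      exact hj (hs t ht)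

theorem card_labelsOf (s : Partial d) : Multiset.card (labelsOf s) = s.1.length := by
  simp [labelsOf]

theorem LabelsOK.prune {J : ℕ} (cap : ℕ) {l : List (Partial d)} (h : LabelsOK J l) :
    LabelsOK J (prune cap J l) := fun s hs => h s ((prune_subperm _ _ _).subset hs)

theorem HasState.prune {cap J : ℕ} {l : List (Partial d)} (hl : LabelsOK J l) {m : Multiset ℕ}
    {p : ℚ} (h : HasState l m p) (hc : Multiset.card m ≤ cap) : HasState (prune cap J l) m p := by
  obtain ⟨s, hs, rfl, hp⟩ := h
  rw [card_labelsOf] at hc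
  obtain ⟨u, hu, hk, hpu⟩ := (prune_spec cap J l).2.2 s hs hc
  exact ⟨u, hu, labelsOf_eq hk (hl.prune cap u hu) (hl s hs), hp.trans hpu⟩

theorem extract_of_mem {j : ℕ} {s : Partial d} (h : j ∈ labelsOf s) :
    ∃ x ∈ (extract j s.1).1, ((j, x) :: (extract j s.1).2).Perm s.1 := by
  match he : (extract j s.1).1 with
  | [] =>
    obtain ⟨t, ht, htj⟩ := List.mem_map.1 (Multiset.mem_coe.1 h)
    exact absurd htj (extract_eq_nil he t ht)
  | x :: l => exact ⟨x, by simp, extract_mem (by rw [he]; simp)⟩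

theorem erase_labelsOf {j : ℕ} {x : Vec d} {s : Partial d} {r : List (Token d)}
    (h : ((j, x) :: r).Perm s.1) : (labelsOf s).erase j = ↑(r.map Prod.fst) := by
  have : labelsOf s = j ::ₘ ↑(r.map Prod.fst) := by
    rw [labelsOf, Multiset.cons_coe]
    exact Multiset.coe_eq_coe.2 (h.map Prod.fst).symm
  rw [this, Multiset.erase_cons_head]

section Steps

variable {cap J : ℕ} {lev : ℚ × List (Config d)} {tbl : List (Partial d)}

theorem LabelsOK.openCands (h : LabelsOK J tbl) (hcfg : ∀ κ ∈ lev.2, ∀ p ∈ κ, p.1 < J) :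
    LabelsOK J (tbl ++ tbl.flatMap fun s => lev.2.flatMap fun κ => openCell lev.1 κ s) := by
  intro s hs t ht
  rcases List.mem_append.1 hs with hs | hs
  · exact h s hs t ht
  · obtain ⟨u, hu, hs⟩ := List.mem_flatMap.1 hs
    obtain ⟨κ, hκ, hs⟩ := List.mem_flatMap.1 hs
    obtain ⟨x, hx, rfl⟩ := List.mem_map.1 hs
    rcases List.mem_append.1 ht with ht | ht
    · obtain ⟨p, hp, rfl⟩ := List.mem_map.1 ht
      exact hcfg κ hκ p hp
    · exact h u hu t ((extract_mem hx).subset (by simp [ht]))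

theorem LabelsOK.placeCands (h : LabelsOK J tbl) (j : ℕ) (it : Item d) :
    LabelsOK J (tbl ++ tbl.flatMap (placeItem j it)) := by
  intro s hs t ht
  rcases List.mem_append.1 hs with hs | hs
  · exact h s hs t ht
  · obtain ⟨u, hu, hs⟩ := List.mem_flatMap.1 hs
    obtain ⟨x, hx, rfl⟩ := List.mem_map.1 hs
    exact h u hu t ((extract_mem hx).subset (by simp [show t ∈ (extract j u.1).2 from ht]))

theorem HasState.append_left {l l' : List (Partial d)} {m : Multiset ℕ} {p : ℚ}
    (h : HasState l m p) : HasState (l ++ l') m p :=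
  let ⟨s, hs, h1⟩ := h
  ⟨s, List.mem_append_left _ hs, h1⟩

/-- Each pass opens one cell with the next configuration of `κs`, and the spare passes keep the
table. Which token is opened is irrelevant, because only the multiset of labels is tracked; the
bound by `cap` ensures that no intermediate state is pruned. -/
theorem HasState.openAll (hcfg : ∀ κ ∈ lev.2, ∀ p ∈ κ, p.1 < J) (sp : List Unit) :
    ∀ {tbl : List (Partial d)} {κs : List (Config d)} {m : Multiset ℕ} {p : ℚ},
    LabelsOK J tbl → HasState tbl (Multiset.replicate κs.length 0 + m) p → (∀ κ ∈ κs, κ ∈ lev.2) →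
    κs.length ≤ sp.length →
    κs.length + Multiset.card m + (κs.map List.length).sum ≤ cap →
    LabelsOK J (openAll cap J lev sp tbl) ∧ HasState (openAll cap J lev sp tbl)
      (m + (κs.map fun κ => (↑(κ.map Prod.fst) : Multiset ℕ)).sum) p := by
  induction sp with
  | nil =>
    intro tbl κs m p hl h _ hlen _
    obtain rfl := List.length_eq_zero_iff.1 (Nat.le_zero.1 hlen)
    exact ⟨hl, by simpa [GeoKnapsack.openAll] using h⟩
  | cons _ sp ih =>
    intro tbl κs m p hl h hκ hlen hcap
    have hl' := (hl.openCands hcfg).prune cap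
    cases κs with
    | nil =>
      refine ih (κs := []) hl' ?_ (by simp) (by simp) hcap
      refine (h.append_left).prune (hl.openCands hcfg) ?_
      simpa using hcap
    | cons κ κs =>
      simp only [List.length_cons, List.map_cons, List.sum_cons] at h hlen hcap ⊢
      obtain ⟨h1, h2⟩ := ih (κs := κs) (m := m + ↑(κ.map Prod.fst)) (p := p) hl' (by
        obtain ⟨s, hs, hm, hp⟩ := h
        obtain ⟨x, hx, hperm⟩ := extract_of_mem (j := 0) (s := s) (by rw [hm]; simp)
        have he := erase_labelsOf hperm
        refine HasState.prune (hl.openCands hcfg) ⟨(κ.map (fun p => (p.1, shiftBy lev.1 x p.2)) ++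
          (extract 0 s.1).2, s.2), ?_, ?_, hp⟩ ?_
        · exact List.mem_append_right _ (List.mem_flatMap.2 ⟨s, hs, List.mem_flatMap.2 ⟨κ,
            hκ κ (by simp), List.mem_map.2 ⟨x, hx, rfl⟩⟩⟩)
        · rw [labelsOf, List.map_append, List.map_map, ← Multiset.coe_add, ← he, hm,
            Multiset.replicate_succ, Multiset.cons_add, Multiset.erase_cons_head]
          have : (Prod.fst ∘ fun p : ℕ × (Fin d → ℤ) => ((p.1, shiftBy lev.1 x p.2) : Token d)) =
            Prod.fst := rfl
          rw [this]
          abel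
        · simp only [Multiset.card_add, Multiset.card_replicate, Multiset.coe_card,
            List.length_map]
          omega) (fun κ' h' => hκ κ' (by simp [h'])) (by omega) (by
            simp only [Multiset.card_add, Multiset.coe_card, List.length_map]; omega)
      refine ⟨h1, ?_⟩
      rw [← add_assoc]
      exact h2

variable {P : Params d} {O : Val → Bool} {h : ℚ}

/-- Every chosen item consumes one token of its own label, and the others are skipped. The tokens
`m` are left over and the profits add up; a dominating entry can replace the intended one because it
has the same labels. -/
theorem HasState.placeAll (chosen : Item d → Prop) [DecidablePred chosen] (its : List (Item d)) :
    ∀ {tbl : List (Partial d)} {m : Multiset ℕ} {p : ℚ}, LabelsOK P.labels tbl →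
    HasState tbl (m + ↑((its.filter fun it => decide (chosen it)).map (itemLabel P O h))) p →
    Multiset.card m + its.length ≤ cap →
    HasState (placeAll P O cap h its tbl) m
      (p + ((its.filter fun it => decide (chosen it)).map fun it => it.2.1).sum) := by
  induction its with
  | nil => intro tbl m p hl hs _; simpa [GeoKnapsack.placeAll] using hs
  | cons it its ih =>
    intro tbl m p hl hs hcap
    set j := itemLabel P O h it with hj
    have hl' := (hl.placeCands j it).prune cap
    rw [List.length_cons] at hcap
    by_cases hc : chosen it
    · simp only [List.filter_cons, hc, decide_true, if_true, List.map_cons, List.sum_cons,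
        ← add_assoc] at hs ⊢
      refine ih (tbl := placeStep cap P.labels j it tbl) hl' ?_ (by omega)
      obtain ⟨s, hs, hm, hp⟩ := hs
      obtain ⟨x, hx, hperm⟩ := extract_of_mem (j := j) (s := s) (by
        rw [hm, ← Multiset.cons_coe]; simp [hj])
      have he := erase_labelsOf hperm
      refine HasState.prune (hl.placeCands j it) ⟨((extract j s.1).2, (s.2.1 + it.2.1,
        (it.1, fun k => x k - it.2.2.2 k) :: s.2.2)), ?_, ?_, ?_⟩ ?_
      · exact List.mem_append_right _ (List.mem_flatMap.2 ⟨s, hs, List.mem_map.2 ⟨x, hx, rfl⟩⟩)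
      · rw [labelsOf, ← he, hm, ← Multiset.cons_coe, Multiset.add_cons, ← hj,
          Multiset.erase_cons_head]
      · simp only; linarith
      · have := List.length_filter_le (fun it => decide (chosen it)) its
        simp only [Multiset.card_add, Multiset.coe_card, List.length_map]
        omega
    · simp only [List.filter_cons, hc, decide_false, Bool.false_eq_true, if_false] at hs ⊢
      refine ih (tbl := placeStep cap P.labels j it tbl) hl' ?_ (by omega)
      refine hs.append_left.prune (hl.placeCands j it) ?_
      have := List.length_filter_le (fun it => decide (chosen it)) its
      simp only [Multiset.card_add, Multiset.coe_card, List.length_map]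
      omega

theorem HasState.advance {n : ℕ} {p : ℚ} (hJ : 0 < J)
    (hs : HasState tbl (Multiset.replicate n 1) p) (hn : n ≤ cap) :
    HasState (GeoKnapsack.prune cap J (tbl.map GeoKnapsack.advance))
      (Multiset.replicate n 0) p := by
  obtain ⟨s, hs, hm, hp⟩ := hs
  refine HasState.prune ?_ ⟨GeoKnapsack.advance s, List.mem_map_of_mem hs, ?_, hp⟩ (by simpa)
  · intro u hu t ht
    obtain ⟨v, hv, rfl⟩ := List.mem_map.1 hu
    obtain ⟨w, hw, rfl⟩ := List.mem_map.1 ht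
    exact hJ
  · have h1 : (s.1.filter fun t => decide (t.1 = 1)).length = n := by
      have := count_labelsOf 1 s
      rw [hm, Multiset.count_replicate_self, countLabel] at this
      exact this.symm
    rw [labelsOf, GeoKnapsack.advance, List.map_map]
    have h2 : (Prod.fst ∘ fun t : Token d => ((0, t.2) : Token d)) = fun _ => 0 := rfl
    rw [h2, List.map_const', h1]
    rfl

end Steps

end Completeness

/-! ### Grid packings are found by the dynamic program -/

section Packings

variable {d : ℕ}

/-- The label of an object at a level. -/
def Instance.labelAt (I : Instance d) (P : Params d) (O : Val → Bool) (l : ℕ) (i : Fin I.n) : ℕ :=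
  itemLabel P O (P.res l) (I.item i)

/-- A placement of objects on the hierarchical grid. An object `i` has a level `lev i`, and
`addr i a` is the grid cell of level `a` that contains its reference point. -/
structure GridPacking (I : Instance d) (P : Params d) (O : Val → Bool) (W : ℕ)
    (S : Finset (Fin I.n)) (lev : Fin I.n → ℕ) (addr : Fin I.n → ℕ → Fin d → ℤ) : Prop where
  addr_zero : ∀ i ∈ S, addr i 0 = 0
  addr_div : ∀ i ∈ S, ∀ a k, addr i (a + 1) k / (P.ratioAt a : ℤ) = addr i a k
  large : ∀ i ∈ S, isLarge P O (P.res (lev i)) (I.item i) = true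
  not_large : ∀ i ∈ S, ∀ l < lev i, isLarge P O (P.res l) (I.item i) = false
  good : ∀ i ∈ S, GoodLabel P W (I.labelAt P O (lev i) i)
  inside : ∀ i ∈ S, ∀ q ∈ shape P (P.ratioAt (lev i)) (I.labelAt P O (lev i) i), ∀ k,
    (addr i (lev i + 1) k + q k) / (P.ratioAt (lev i) : ℤ) = addr i (lev i) k
  disjoint : ∀ i ∈ S, ∀ j ∈ S, i ≠ j → lev i = lev j →
    ∀ q ∈ shape P (P.ratioAt (lev i)) (I.labelAt P O (lev i) i),
    ∀ q' ∈ shape P (P.ratioAt (lev i)) (I.labelAt P O (lev i) j),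
      addr i (lev i + 1) + q ≠ addr j (lev i + 1) + q'
  retained : ∀ i ∈ S, ∀ j ∈ S, lev i < lev j →
    ∀ q ∈ shape P (P.ratioAt (lev i)) (I.labelAt P O (lev i) i),
      addr i (lev i + 1) + q ≠ addr j (lev i + 1)

theorem labels_toList {α : Type*} (s : Finset α) (f : α → ℕ × (Fin d → ℤ)) :
    (↑((s.toList.map f).map Prod.fst) : Multiset ℕ) = ∑ x ∈ s, {(f x).1} := by
  rw [List.map_map, ← Multiset.map_coe, Finset.coe_toList, Finset.sum]
  induction s.val using Multiset.induction with
  | empty => simp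
  | cons a t ih => simp [Multiset.singleton_add, ← ih]

theorem card_sum_labels (κs : List (Config d)) :
    Multiset.card (κs.map fun κ => (↑(κ.map Prod.fst) : Multiset ℕ)).sum =
      (κs.map List.length).sum := by
  induction κs with
  | nil => simp
  | cons κ κs ih => simp [ih]

theorem sub_mem_box {M : ℕ} (hM : 0 < M) {P : Params d} {p u : Fin d → ℤ}
    (h : ∀ k, p k / (M : ℤ) = u k) : p - (M : ℤ) • u ∈ shape P M 0 := by
  intro k
  have hM' : (0 : ℤ) < M := by exact_mod_cast hM
  have h1 := Int.emod_nonneg (p k) hM'.ne'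
  have h2 := Int.emod_lt_of_pos (p k) hM'
  have h3 := Int.mul_ediv_add_emod (p k) M
  rw [h k] at h3
  simp only [Pi.sub_apply, Pi.smul_apply, smul_eq_mul]
  constructor <;> linarith

namespace GridPacking

variable {I : Instance d} {P : Params d} {O : Val → Bool} {W : ℕ}
  {S : Finset (Fin I.n)} {lev : Fin I.n → ℕ} {addr : Fin I.n → ℕ → Fin d → ℤ}

variable (S lev addr) in
/-- The cells of level `l` that contain objects of level at least `l`. -/
def cells (l : ℕ) : Finset (Fin d → ℤ) := (S.filter fun i => l ≤ lev i).image fun i => addr i l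

variable (P O S lev addr) in
/-- The configuration that opens the cell `u` of level `l`. -/
noncomputable def config (l : ℕ) (u : Fin d → ℤ) : Config d :=
  ((S.filter fun i => lev i = l).filter fun i => addr i l = u).toList.map (fun i =>
    (I.labelAt P O l i, addr i (l + 1) - (P.ratioAt l : ℤ) • u)) ++
  ((cells S lev addr (l + 1)).filter fun v => (fun k => v k / (P.ratioAt l : ℤ)) = u).toList.map
    fun v => (1, v - (P.ratioAt l : ℤ) • u)

theorem ratioAt_pos {C : ℕ} (hP : P.Bounded C) (l : ℕ) : 0 < P.ratioAt l := by
  rw [Params.ratioAt]; split_ifs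
  · exact hP.first_pos
  · exact hP.ratio_pos

theorem mem_cells {l : ℕ} {v : Fin d → ℤ} (h : v ∈ cells S lev addr l) :
    ∃ i ∈ S, l ≤ lev i ∧ addr i l = v := by
  obtain ⟨i, hi, rfl⟩ := Finset.mem_image.1 h
  exact ⟨i, (Finset.mem_filter.1 hi).1, (Finset.mem_filter.1 hi).2, rfl⟩

/-- Two shapes are disjoint by `disjoint`, two retained cells because they are different, and a
shape misses a retained cell by `retained`. Everything lies in the opened cell because of `inside`
and the definition of the parent cell. -/
theorem validConfig {C : ℕ} (hP : P.Bounded C) (h : GridPacking I P O W S lev addr) (l : ℕ)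
    (u : Fin d → ℤ) : ValidConfig P W (P.ratioAt l) (config P O S lev addr l u) where
  good := by
    intro p hp
    rcases List.mem_append.1 hp with hp | hp
    · obtain ⟨i, hi, rfl⟩ := List.mem_map.1 hp
      simp only [Finset.mem_toList, Finset.mem_filter] at hi
      obtain ⟨⟨hS, rfl⟩, -⟩ := hi
      exact h.good i hS
    · obtain ⟨v, hv, rfl⟩ := List.mem_map.1 hp
      trivial
  inside := by
    intro p hp q hq
    rcases List.mem_append.1 hp with hp | hp
    · obtain ⟨i, hi, rfl⟩ := List.mem_map.1 hp
      simp only [Finset.mem_toList, Finset.mem_filter] at hi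
      obtain ⟨⟨hS, rfl⟩, rfl⟩ := hi
      have h1 := sub_mem_box (P := P) (ratioAt_pos hP (lev i))
        (p := addr i (lev i + 1) + q) (h.inside i hS q hq)
      rwa [add_comm (addr i (lev i + 1)), add_sub_assoc] at h1
    · obtain ⟨v, hv, rfl⟩ := List.mem_map.1 hp
      simp only [Finset.mem_toList, Finset.mem_filter] at hv
      obtain rfl : q = 0 := hq
      rw [zero_add]
      exact sub_mem_box (ratioAt_pos hP l) fun k => congrFun hv.2 k
  disjoint := by
    rw [config, List.pairwise_append]
    refine ⟨?_, ?_, ?_⟩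
    · rw [List.pairwise_map]
      refine (Finset.nodup_toList _).imp_of_mem fun {i j} hi hj hij q hq q' hq' e => ?_
      simp only [Finset.mem_toList, Finset.mem_filter] at hi hj
      obtain ⟨⟨hS, rfl⟩, rfl⟩ := hi
      refine h.disjoint i hS j hj.1.1 hij hj.1.2.symm q hq q' hq' ?_
      rwa [← add_sub_assoc, ← add_sub_assoc, sub_left_inj, add_comm q, add_comm q'] at e
    · rw [List.pairwise_map]
      refine (Finset.nodup_toList _).imp fun {v w} hvw q hq q' hq' e => hvw ?_
      obtain rfl : q = 0 := hq
      obtain rfl : q' = 0 := hq'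
      simpa using e
    · intro p hp p' hp' q hq q' hq' e
      obtain ⟨i, hi, rfl⟩ := List.mem_map.1 hp
      obtain ⟨v, hv, rfl⟩ := List.mem_map.1 hp'
      simp only [Finset.mem_toList, Finset.mem_filter] at hi hv
      obtain ⟨⟨hS, rfl⟩, rfl⟩ := hi
      obtain ⟨j, hj, hjl, rfl⟩ := mem_cells hv.1
      obtain rfl : q' = 0 := hq'
      refine h.retained i hS j hj hjl q hq ?_
      rwa [zero_add, ← add_sub_assoc, sub_left_inj, add_comm q] at e

theorem parent_mem_cells (h : GridPacking I P O W S lev addr) {l : ℕ} {v : Fin d → ℤ}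
    (hv : v ∈ cells S lev addr (l + 1)) :
    (fun k => v k / (P.ratioAt l : ℤ)) ∈ cells S lev addr l := by
  obtain ⟨i, hi, hil, rfl⟩ := mem_cells hv
  refine Finset.mem_image.2 ⟨i, Finset.mem_filter.2 ⟨hi, by omega⟩, ?_⟩
  funext k
  exact (h.addr_div i hi l k).symm

/-- Each object of level `l` has its reference point in exactly one cell of level `l`, and each cell
of level `l + 1` has exactly one parent, so the sum over the opened cells can be taken fiberwise. -/
theorem labels_config (h : GridPacking I P O W S lev addr) (l : ℕ) :
    (((cells S lev addr l).toList.map (config P O S lev addr l)).map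
      fun κ => (↑(κ.map Prod.fst) : Multiset ℕ)).sum =
    (∑ i ∈ S with lev i = l, {I.labelAt P O l i}) +
      Multiset.replicate (cells S lev addr (l + 1)).card 1 := by
  rw [List.map_map, ← Multiset.sum_coe, ← Multiset.map_coe, Finset.coe_toList]
  have h1 : ∀ u, ((fun κ : Config d => (↑(κ.map Prod.fst) : Multiset ℕ)) ∘
      config P O S lev addr l) u =
      (∑ i ∈ (S.filter fun i => lev i = l) with addr i l = u,
        {I.labelAt P O l i}) +
      ∑ v ∈ cells S lev addr (l + 1) with (fun k => v k / (P.ratioAt l : ℤ)) = u, {1} := by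
    intro u
    rw [Function.comp_apply, config, List.map_append, ← Multiset.coe_add, labels_toList,
      labels_toList]
  have h2 : ((cells S lev addr l).val.map ((fun κ : Config d =>
      (↑(κ.map Prod.fst) : Multiset ℕ)) ∘ config P O S lev addr l)).sum =
      ∑ u ∈ cells S lev addr l, ((fun κ : Config d => (↑(κ.map Prod.fst) : Multiset ℕ)) ∘
        config P O S lev addr l) u := rfl
  rw [h2, Finset.sum_congr rfl fun u _ => h1 u, Finset.sum_add_distrib,
    Finset.sum_fiberwise_of_maps_to, Finset.sum_fiberwise_of_maps_to]
  · rw [Finset.sum_const, Multiset.nsmul_singleton]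
  · exact fun v hv => h.parent_mem_cells hv
  · intro i hi
    obtain ⟨hS, rfl⟩ := Finset.mem_filter.1 hi
    exact Finset.mem_image.2 ⟨i, Finset.mem_filter.2 ⟨hS, le_rfl⟩, rfl⟩

theorem card_cells_le (l : ℕ) : (cells S lev addr l).card ≤ I.n :=
  Finset.card_image_le.trans ((Finset.card_le_univ _).trans (by simp))

theorem item_injective (I : Instance d) : Function.Injective I.item := fun i j h =>
  Fin.ext (congrArg Prod.fst h)

theorem item_mem_indexed (I : Instance d) (i : Fin I.n) : I.item i ∈ indexed I.input := by
  rw [← List.mem_reverse, indexed_reverse]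
  refine List.mem_map.2 ⟨((I.profit i, I.radius i, I.center i), (i : ℕ)), ?_, rfl⟩
  rw [List.mem_zipIdx_iff_getElem?]
  simp [Instance.input]

theorem item_mem_stateAt (h : GridPacking I P O W S lev addr) {i : Fin I.n} (hi : i ∈ S) :
    ∀ {l : ℕ}, l ≤ lev i → I.item i ∈ (stateAt P O I.input l).1
  | 0, _ => item_mem_indexed I i
  | l + 1, hl => List.mem_filter.2 ⟨h.item_mem_stateAt hi (by omega), by
      have := h.not_large i hi l hl
      simpa [Params.level] using this⟩

/-- Only the number of occupied cells is remembered from level to level. Opening them according to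
the packing yields precisely the labels of the objects of level `l` and the occupied cells of the
next level; placing these objects uses up the former and adds their profit. -/
theorem hasState {C : ℕ} (hP : P.Bounded C)
    (hall : ∀ l κ, ValidConfig P W (P.ratioAt l) κ → κ ∈ (P.level l).2)
    (h : GridPacking I P O W S lev addr) (hS : S.Nonempty) (l : ℕ) :
    HasState (stateAt P O I.input l).2 (Multiset.replicate (cells S lev addr l).card 0)
      (∑ i ∈ S with lev i < l, I.profit i) := by
  classical
  induction l with
  | zero =>
    have h1 : cells S lev addr 0 = {0} := by
      ext v
      simp only [cells, Nat.zero_le, Finset.filter_true, Finset.mem_image, Finset.mem_singleton]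
      constructor
      · rintro ⟨i, hi, rfl⟩
        exact h.addr_zero i hi
      · rintro rfl
        obtain ⟨i, hi⟩ := hS
        exact ⟨i, hi, h.addr_zero i hi⟩
    exact ⟨_, List.mem_singleton.2 rfl, by simp [h1, labelsOf], by simp⟩
  | succ l ih =>
    -- Occupied cells of level `l`, occupied cells of level `l + 1` and objects of level `l` number
    -- at most `I.n` each, so no state of interest exceeds the cap.
    have hcap : capOf I.input = 3 * (I.n + 1) := by simp [capOf, Instance.input]
    have hsp : (openSpine I.input).length = I.n + 1 := by simp [openSpine, Instance.input]
    have hn := card_cells_le (S := S) (lev := lev) (addr := addr) l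
    have hn' := card_cells_le (S := S) (lev := lev) (addr := addr) (l + 1)
    have hnS : (S.filter fun i => lev i = l).card ≤ I.n :=
      (Finset.card_le_univ _).trans (by simp)
    have hl : LabelsOK P.labels (stateAt P O I.input l).2 := by
      obtain ⟨A, -, hA⟩ := (sizeInv (O := O) (inp := I.input) hP).stateAt l
      exact fun s hs => (hA s hs).label
    set κs := (cells S lev addr l).toList.map (config P O S lev addr l) with hκs
    have hκl : κs.length = (cells S lev addr l).card := by simp [hκs]
    have hlabels := h.labels_config l
    have hlen : (κs.map List.length).sum =
        (S.filter fun i => lev i = l).card + (cells S lev addr (l + 1)).card := by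
      have e := congrArg Multiset.card hlabels
      simp only [Multiset.card_add, Multiset.card_replicate, Multiset.card_sum,
        Multiset.card_singleton, Finset.sum_const, smul_eq_mul, mul_one] at e
      rw [← e, ← hκs, card_sum_labels]
    obtain ⟨hl1, hs1⟩ := HasState.openAll (cap := capOf I.input) (J := P.labels)
      (lev := P.level l) (fun κ hκ p hp => (hP.labels l κ hκ p hp).2) (openSpine I.input)
      (κs := κs) (m := 0) hl (by rw [hκl, add_zero]; exact ih) (by
        intro κ hκ
        obtain ⟨u, -, rfl⟩ := List.mem_map.1 hκ
        exact hall l _ (h.validConfig hP l u)) (by omega) (by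
        rw [Multiset.card_zero]; omega)
    rw [zero_add, hlabels, add_comm] at hs1
    set its := (stateAt P O I.input l).1.filter fun it => isLarge P O (P.res l) it with hits
    set chosen : Item d → Prop := fun it => ∃ i ∈ S, lev i = l ∧ I.item i = it
    have hnd : its.Nodup := ((indexed_nodup I.input).of_map _).sublist
      (List.filter_sublist.trans (stateAt_sublist l))
    have hch : (↑(its.filter fun it => decide (chosen it)) : Multiset (Item d)) =
        (S.filter fun i => lev i = l).val.map I.item := by
      refine (Multiset.Nodup.ext (Multiset.coe_nodup.2 (hnd.filter _))
        ((Finset.nodup _).map (item_injective I))).2 fun it => ?_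
      rw [Multiset.mem_coe, List.mem_filter, Multiset.mem_map]
      constructor
      · rintro ⟨-, hc⟩
        obtain ⟨i, hi, hil, rfl⟩ := of_decide_eq_true hc
        exact ⟨i, Finset.mem_filter.2 ⟨hi, hil⟩, rfl⟩
      · rintro ⟨i, hi, rfl⟩
        obtain ⟨hiS, rfl⟩ := Finset.mem_filter.1 (Finset.mem_def.2 hi)
        exact ⟨List.mem_filter.2 ⟨h.item_mem_stateAt hiS le_rfl, h.large i hiS⟩,
          decide_eq_true ⟨i, hiS, rfl, rfl⟩⟩
    have hlab' : (↑((its.filter fun it => decide (chosen it)).map (itemLabel P O (P.res l))) :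
        Multiset ℕ) = ∑ i ∈ S with lev i = l, {I.labelAt P O l i} := by
      rw [← Multiset.map_coe, hch, Multiset.map_map, Finset.sum]
      exact (Multiset.sum_map_singleton _).symm.trans (by rw [Multiset.map_map]; rfl)
    have hpro : ((its.filter fun it => decide (chosen it)).map fun it => it.2.1).sum =
        ∑ i ∈ S with lev i = l, I.profit i := by
      rw [← Multiset.sum_coe, ← Multiset.map_coe, hch, Multiset.map_map]
      rfl
    rw [← hlab'] at hs1
    have hitl : its.length ≤ I.n := by
      have h1 := (List.filter_sublist.trans (stateAt_sublist (P := P) (O := O)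
        (inp := I.input) l)).length_le (l₁ := its)
      have h2 : (indexed I.input).length = I.n := by
        rw [← List.length_reverse, indexed_reverse]; simp [Instance.input]
      omega
    have hs2 := HasState.placeAll (cap := capOf I.input) chosen its hl1 hs1 (by
      rw [Multiset.card_replicate]; omega)
    have hs3 := HasState.advance (cap := capOf I.input) (zero_lt_one.trans hP.one_lt_labels) hs2 (by omega)
    have hsum : (∑ i ∈ S with lev i < l + 1, I.profit i) =
        (∑ i ∈ S with lev i < l, I.profit i) + ∑ i ∈ S with lev i = l, I.profit i := by
      rw [← Finset.sum_union]
      · congr 1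
        ext i
        simp only [Finset.mem_filter, Finset.mem_union]
        constructor
        · rintro ⟨h1, h2⟩
          rcases Nat.lt_succ_iff_lt_or_eq.1 h2 with h2 | h2
          · exact Or.inl ⟨h1, h2⟩
          · exact Or.inr ⟨h1, h2⟩
        · rintro (⟨h1, h2⟩ | ⟨h1, h2⟩) <;> exact ⟨h1, by omega⟩
      · refine Finset.disjoint_left.2 fun i hi hi' => ?_
        have h1 := (Finset.mem_filter.1 hi).2
        have h2 := (Finset.mem_filter.1 hi').2
        omega
    rw [hsum, ← hpro]
    exact hs3

theorem sum_le_solve {C : ℕ} (hP : P.Bounded C)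
    (hall : ∀ l κ, ValidConfig P W (P.ratioAt l) κ → κ ∈ (P.level l).2)
    (h : GridPacking I P O W S lev addr)
    (hlev : ∀ i ∈ S, lev i ≤ (levelSpine P I.input).length) :
    ∑ i ∈ S, I.profit i ≤ (solve P O I.input).1 := by
  have hb := bestOf_foldl (finalTable P O I.input) (0, [])
  -- Without objects the root cell would not count as occupied, and the initial table would not
  -- match.
  rcases S.eq_empty_or_nonempty with rfl | hS
  · rw [Finset.sum_empty]; exact hb.2.1
  · obtain ⟨s, hs, -, hp⟩ := h.hasState hP hall hS ((levelSpine P I.input).length + 1)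
    rw [Finset.filter_true_of_mem fun i hi => Nat.lt_succ_of_le (hlev i hi)] at hp
    rw [← finalTable_eq] at hs
    exact hp.trans (hb.2.2 s hs)

end GridPacking

end Packings

/-! ### Finiteness of the configurations and choice of the program's constants -/

section Parameters

variable {d : ℕ}

theorem answersCode_lt (tests : List (Vec d)) (ans : Vec d → Bool) :
    answersCode tests ans < 2 ^ tests.length := by
  have h : ∀ n : ℕ, tests.foldl (fun n t => 2 * n + if ans t = true then 1 else 0) n <
      (n + 1) * 2 ^ tests.length := by
    induction tests with
    | nil => simp
    | cons t tests ih =>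
      intro n
      rw [List.foldl_cons, List.length_cons, pow_succ]
      refine (ih _).trans_le ?_
      have h1 : (2 * n + if ans t = true then 1 else 0) + 1 ≤ (n + 1) * 2 := by
        split_ifs <;> omega
      calc _ ≤ (n + 1) * 2 * 2 ^ tests.length := Nat.mul_le_mul_right _ h1
        _ = _ := by ring
  simpa [answersCode] using h 0

theorem GoodLabel.lt {P : Params d} {W j : ℕ} (h : GoodLabel P W j) :
    j < 2 + 2 ^ P.tests.length := by
  match j, h with
  | 1, _ => exact (by norm_num : 1 < 2).trans_le (Nat.le_add_right _ _)
  | j + 2, h =>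
    obtain ⟨⟨ans, rfl, -⟩, -⟩ := h
    have := answersCode_lt P.tests ans
    omega

theorem GoodLabel.nonempty {P : Params d} {W j : ℕ} (h : GoodLabel P W j) (M : ℕ) :
    (shape P M j).Nonempty := by
  match j, h with
  | 1, _ => exact ⟨0, rfl⟩
  | j + 2, h =>
    obtain ⟨⟨ans, hj, t, ht, ha⟩, -⟩ := h
    refine ⟨fun k => ⌊t k⌋, ans, hj, t, ht, ha, fun k => ?_⟩
    have h1 := Int.floor_le (t k)
    have h2 := Int.lt_floor_add_one (t k)
    rw [abs_le]
    constructor <;> linarith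

theorem shape_congr {P P' : Params d} (h : P.tests = P'.tests) (M : ℕ) :
    ∀ j, shape P M j = shape P' M j
  | 0 => rfl
  | 1 => rfl
  | j + 2 => by simp only [shape, h]

theorem goodLabel_congr {P P' : Params d} (h : P.tests = P'.tests) (W : ℕ) :
    ∀ j, GoodLabel P W j ↔ GoodLabel P' W j
  | 0 => Iff.rfl
  | 1 => Iff.rfl
  | j + 2 => by simp only [GoodLabel, h]

theorem ValidConfig.congr {P P' : Params d} (h : P.tests = P'.tests) {W M : ℕ} {κ : Config d}
    (hv : ValidConfig P W M κ) : ValidConfig P' W M κ := by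
  refine ⟨fun p hp => (goodLabel_congr h W _).1 (hv.good p hp), fun p hp => ?_, ?_⟩
  · rw [← shape_congr h, ← shape_congr h]
    exact hv.inside p hp
  · have := hv.disjoint
    simp only [shape_congr h] at this
    exact this

open Classical in
/-- Some element of the shape of a label. -/
noncomputable def shapePoint (P : Params d) (M j : ℕ) : Fin d → ℤ :=
  if h : (shape P M j).Nonempty then h.some else 0

/-- A finite set that contains the entries of the valid configurations. -/
def entries (P : Params d) (M : ℕ) : Set (ℕ × (Fin d → ℤ)) :=
  ⋃ j ∈ Set.Iio (2 + 2 ^ P.tests.length),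
    Prod.mk j '' Set.Icc (-shapePoint P M j) (fun k => M - shapePoint P M j k)

theorem entries_finite (P : Params d) (M : ℕ) : (entries P M).Finite :=
  (Set.finite_Iio _).biUnion fun _ _ => (Set.finite_Icc _ _).image _

/-- One fixed point of the shape has to land in the cell, which confines the offset to a box. -/
theorem ValidConfig.mem_entries {P : Params d} {W M : ℕ} {κ : Config d}
    (hv : ValidConfig P W M κ) {p : ℕ × (Fin d → ℤ)} (hp : p ∈ κ) : p ∈ entries P M := by
  have hg := hv.good p hp
  refine Set.mem_biUnion (Set.mem_Iio.2 hg.lt) ⟨p.2, ?_, rfl⟩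
  have h1 := hv.inside p hp (shapePoint P M p.1) (by
    rw [shapePoint, dif_pos (hg.nonempty M)]
    exact (hg.nonempty M).some_mem)
  refine ⟨fun k => ?_, fun k => ?_⟩
  · have := (h1 k).1
    simp only [Pi.add_apply, Pi.neg_apply] at this ⊢
    linarith
  · have := (h1 k).2
    simp only [Pi.add_apply] at this ⊢
    linarith

theorem ValidConfig.nodup {P : Params d} {W M : ℕ} {κ : Config d} (hv : ValidConfig P W M κ) :
    κ.Nodup := by
  refine hv.disjoint.imp_of_mem fun {p p'} hp _ h => ?_
  rintro rfl
  obtain ⟨q, hq⟩ := (hv.good p hp).nonempty M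
  exact h q hq q hq rfl

/-- Entries come from a finite set, and none is repeated because the shapes are nonempty and
disjoint. -/
theorem validConfig_finite (P : Params d) (W M : ℕ) : {κ | ValidConfig P W M κ}.Finite := by
  classical
  have := (entries_finite P M).fintype
  refine (Set.finite_range fun l : {l : List (entries P M) // l.Nodup} =>
    l.1.map Subtype.val).subset fun κ hκ => ?_
  refine ⟨⟨κ.attachWith (· ∈ entries P M) fun p hp => ValidConfig.mem_entries hκ hp, ?_⟩, ?_⟩
  · exact List.Nodup.of_map Subtype.val (by
      rw [List.attachWith_map_subtype_val]; exact ValidConfig.nodup hκ)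
  · exact List.attachWith_map_subtype_val _

/-- The test vectors. -/
noncomputable def gridTests (d q W : ℕ) : List (Vec d) :=
  (Finset.Icc (fun _ => -(W * q : ℕ)) (fun _ => ((W * q : ℕ) : ℤ)) :
    Finset (Fin d → ℤ)).toList.map fun z k => (z k : ℚ) / q

open Classical in
/-- Constants without configurations. -/
noncomputable def Params.bare (d q W Kf first ratio extra : ℕ) : Params d where
  tests := gridTests d q W
  far := (gridTests d q W).filter fun t => ∃ k, (Kf : ℚ) ≤ |t k|
  prec := 1 / q
  labels := 2 + 2 ^ (gridTests d q W).length
  first := first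
  ratio := ratio
  extra := extra
  cfgFirst := []
  cfg := []

/-- Constants with all valid configurations. -/
noncomputable def Params.make (d q W Kf first ratio extra : ℕ) : Params d :=
  { Params.bare d q W Kf first ratio extra with
    cfgFirst := (validConfig_finite (Params.bare d q W Kf first ratio extra)
      W first).toFinset.toList
    cfg := (validConfig_finite (Params.bare d q W Kf first ratio extra) W ratio).toFinset.toList }

variable {q W Kf first ratio extra : ℕ}

theorem isGrid_make (hq : 2 ≤ q) (hK : 2 ≤ Kf) (hW : Kf + 2 ≤ W) :
    IsGrid (Params.make d q W Kf first ratio extra) q W Kf where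
  mem_tests := by
    intro t
    simp only [Params.make, Params.bare, gridTests, List.mem_map, Finset.mem_toList,
      Finset.mem_Icc, Pi.le_def, ← forall_and, ← abs_le]
    exact exists_congr fun z => and_congr_right fun _ => eq_comm
  mem_far := by
    intro t
    simp only [Params.make, Params.bare, List.mem_filter, decide_eq_true_eq]
  prec := rfl
  two_le := hq
  two_le_far := hK
  far_lt := hW

/-- Validity depends on the constants only through the tests, which `bare` and `make` share; so
listing the configurations valid for `bare` involves no circularity. -/
theorem mem_level_make {l : ℕ} {κ : Config d} :
    κ ∈ ((Params.make d q W Kf first ratio extra).level l).2 ↔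
      ValidConfig (Params.make d q W Kf first ratio extra) W
        ((Params.make d q W Kf first ratio extra).ratioAt l) κ := by
  have h : ∀ M, κ ∈ (validConfig_finite (Params.bare d q W Kf first ratio extra)
      W M).toFinset.toList ↔ ValidConfig (Params.make d q W Kf first ratio extra) W M κ := by
    intro M
    rw [Finset.mem_toList, Set.Finite.mem_toFinset]
    exact ⟨fun h => ValidConfig.congr (by rfl) h, fun h => ValidConfig.congr (by rfl) h⟩
  rw [Params.level, Params.ratioAt]
  split_ifs
  · exact h _
  · exact h _

theorem bounded_make (hf : 0 < first) (hr : 0 < ratio) :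
    ∃ C, (Params.make d q W Kf first ratio extra).Bounded C := by
  set P := Params.make d q W Kf first ratio extra with hP
  have hb : ∀ M, ∃ C : ℕ, ∀ p ∈ entries P M, ∀ k, |p.2 k| ≤ (C : ℤ) := by
    intro M
    obtain ⟨C, hC⟩ := ((entries_finite P M).image
      fun p => Finset.univ.sup fun k => (p.2 k).natAbs).bddAbove
    refine ⟨C, fun p hp k => ?_⟩
    have h1 := hC ⟨p, hp, rfl⟩
    have h2 : (p.2 k).natAbs ≤ C :=
      (Finset.le_sup (f := fun k => (p.2 k).natAbs) (Finset.mem_univ k)).trans h1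
    rw [Int.abs_eq_natAbs]
    exact_mod_cast h2
  obtain ⟨C₁, h₁⟩ := hb first
  obtain ⟨C₂, h₂⟩ := hb ratio
  refine ⟨max C₁ C₂, hf, hr, ?_, ?_, ?_⟩
  · exact (by norm_num : 1 < 2).trans_le (Nat.le_add_right _ _)
  · intro l κ hκ p hp
    have hv := (mem_level_make.1 hκ).good p hp
    exact ⟨Nat.pos_of_ne_zero hv.ne_zero, hv.lt⟩
  · intro l κ hκ p hp k
    have hv := (mem_level_make.1 hκ).mem_entries hp
    rw [Params.ratioAt] at hv
    split_ifs at hv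
    · exact (h₁ p hv k).trans (by exact_mod_cast le_max_left _ _)
    · exact (h₂ p hv k).trans (by exact_mod_cast le_max_right _ _)

theorem size_floor_le {inp : List (Obj d)} {o : Obj d} (ho : o ∈ inp) (P : Params d) :
    P.extra + Nat.size ⌊|1 / o.2.1|⌋₊ ≤ (levelSpine P inp).length := by
  rw [levelSpine, List.length_append, List.length_replicate, List.length_flatMap]
  refine Nat.add_le_add_left ?_ _
  refine List.single_le_sum (fun _ _ => Nat.zero_le _) _ ?_
  exact List.mem_map.2 ⟨o, ho, by simp⟩

/-- At the last level all objects are large. -/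
theorem res_mul_le {inp : List (Obj d)} {o : Obj d} (ho : o ∈ inp) (hpos : 0 < o.2.1)
    {P : Params d} (hf : 0 < P.first) (hr : 2 ≤ P.ratio) {A : ℕ} (hA : A ≤ 2 ^ P.extra) :
    (A : ℚ) * P.res (levelSpine P inp).length ≤ o.2.1 := by
  have h1 := size_floor_le ho P
  set L := (levelSpine P inp).length
  have h2 : (1 / o.2.1 : ℚ) < 2 ^ (Nat.size ⌊|1 / o.2.1|⌋₊) := by
    have h3 : ⌊|1 / o.2.1|⌋₊ < 2 ^ (Nat.size ⌊|1 / o.2.1|⌋₊) := Nat.lt_size_self _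
    have h4 := Nat.lt_floor_add_one |1 / o.2.1|
    rw [abs_of_pos (by positivity)] at h3 h4 ⊢
    refine h4.trans_le ?_
    exact_mod_cast h3
  have h5 : (A : ℚ) * (1 / o.2.1) ≤ (P.first * P.ratio ^ L : ℕ) := by
    calc (A : ℚ) * (1 / o.2.1) ≤ 2 ^ P.extra * 2 ^ (Nat.size ⌊|1 / o.2.1|⌋₊) := by
          refine mul_le_mul (by exact_mod_cast hA) h2.le (by positivity) (by positivity)
      _ = 2 ^ (P.extra + Nat.size ⌊|1 / o.2.1|⌋₊) := (pow_add _ _ _).symm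
      _ ≤ 2 ^ L := pow_le_pow_right₀ (by norm_num) h1
      _ ≤ (P.first * P.ratio ^ L : ℕ) := by
        have h6 : 2 ^ L ≤ P.first * P.ratio ^ L :=
          (Nat.pow_le_pow_left hr L).trans (Nat.le_mul_of_pos_left _ hf)
        exact_mod_cast h6
  have h6 : (0 : ℚ) < (P.first * P.ratio ^ L : ℕ) := by
    exact_mod_cast Nat.mul_pos hf (pow_pos (by omega) _)
  rw [Params.res, mul_one_div, div_le_iff₀ h6]
  rw [mul_one_div, div_le_iff₀ hpos] at h5
  linarith

end Parameters

/-! ### Fatness in terms of balls and diameters; separating hyperplanes -/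

section FatBodies

variable {d : ℕ}

theorem dist_le_two_mul_circumradius (K : ConvexBody (E d)) {x y : E d} (hx : x ∈ K)
    (hy : y ∈ K) : dist x y ≤ 2 * circumradius K := by
  have h : dist x y / 2 ≤ circumradius K := by
    refine le_csInf ?_ ?_
    · obtain ⟨R, hR⟩ := K.isCompact.isBounded.subset_closedBall (0 : E d)
      exact ⟨max R 0, le_max_right _ _, 0,
        hR.trans (Metric.closedBall_subset_closedBall (le_max_left _ _))⟩
    · rintro R ⟨-, c, hc⟩
      have h1 := dist_triangle_right x y c
      have h2 := Metric.mem_closedBall.1 (hc hx)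
      have h3 := Metric.mem_closedBall.1 (hc hy)
      linarith
  linarith

/-- The inradius is a supremum, so a contained ball with more than half that radius is taken. The
diameter is at most twice the circumradius; the two factors 2 make `4 * f`. -/
theorem IsFat.fatWith {f : ℝ} (hf : 1 ≤ f) {K : ConvexBody (E d)} (h : IsFat f K) :
    ∃ r, FatWith (4 * f) r (K : Set (E d)) := by
  obtain ⟨hpos, hle⟩ := h
  have hne : {r : ℝ | 0 ≤ r ∧ ∃ c : E d, Metric.closedBall c r ⊆ (K : Set (E d))}.Nonempty := by
    by_contra hne
    rw [Set.not_nonempty_iff_eq_empty] at hne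
    rw [inradius, hne, Real.sSup_empty] at hpos
    exact lt_irrefl _ hpos
  obtain ⟨r, ⟨-, z, hz⟩, hr⟩ := exists_lt_of_lt_csSup hne (half_lt_self hpos)
  change inradius K / 2 < r at hr
  refine ⟨r, K.convex, by linarith, by linarith, ⟨z, hz⟩, fun x hx y hy => ?_⟩
  have h1 := dist_le_two_mul_circumradius K hx hy
  rw [div_le_iff₀ hpos] at hle
  nlinarith

open scoped RealInnerProductSpace

variable {ι : Type*}

/-- Two translated sets are on different sides of a hyperplane. -/
def SepAt (K : ι → Set (E d)) (t : ι → E d) (i j : ι) : Prop :=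
  ∃ u : E d, ‖u‖ = 1 ∧ ∃ c : ℝ, (∀ x ∈ K i, ⟪u, x + t i⟫ ≤ c) ∧ ∀ y ∈ K j, c ≤ ⟪u, y + t j⟫

theorem SepAt.symm {K : ι → Set (E d)} {t : ι → E d} {i j : ι} (h : SepAt K t i j) :
    SepAt K t j i := by
  obtain ⟨u, hu, c, h1, h2⟩ := h
  refine ⟨-u, by rwa [norm_neg], -c, fun x hx => ?_, fun y hy => ?_⟩
  · rw [inner_neg_left]; exact neg_le_neg (h2 x hx)
  · rw [inner_neg_left]; exact neg_le_neg (h1 y hy)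

theorem SepAt.add {K : ι → Set (E d)} {t t' : ι → E d} {i j : ι} (h : SepAt K t i j) (v : E d)
    (hi : t' i = t i + v) (hj : t' j = t j + v) : SepAt K t' i j := by
  obtain ⟨u, hu, c, h1, h2⟩ := h
  refine ⟨u, hu, c + ⟪u, v⟫, fun x hx => ?_, fun y hy => ?_⟩
  · rw [hi, ← add_assoc, inner_add_right]; linarith [h1 x hx]
  · rw [hj, ← add_assoc, inner_add_right]; linarith [h2 y hy]

/-- Hahn–Banach separates the open interiors. The inequalities extend to the whole sets, because a
convex set with interior points lies in the closure of its interior. Normalizing the functional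
turns gaps into distances. -/
theorem sepAt_of_disjoint_interior {K : ι → Set (E d)} {t : ι → E d} {i j : ι}
    (hi : Convex ℝ (K i)) (hj : Convex ℝ (K j)) (hi' : (interior (K i)).Nonempty)
    (hj' : (interior (K j)).Nonempty)
    (h : Disjoint (interior (t i +ᵥ K i)) (interior (t j +ᵥ K j))) : SepAt K t i j := by
  rw [interior_vadd, interior_vadd] at h
  obtain ⟨g, c, h1, h2⟩ := geometric_hahn_banach_open_open (hi.interior.vadd (t i))
    (isOpen_interior.vadd (t i)) (hj.interior.vadd (t j)) (isOpen_interior.vadd (t j)) h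
  set v := (InnerProductSpace.toDual ℝ (E d)).symm g with hv
  have hg : ∀ x, ⟪v, x⟫ = g x := fun x => InnerProductSpace.toDual_symm_apply
  have hle : ∀ x ∈ K i, ⟪v, x + t i⟫ ≤ c := by
    have hcl : closure (interior (K i)) ⊆ {x | ⟪v, x + t i⟫ ≤ c} := by
      refine closure_minimal (fun x hx => ?_) (isClosed_le (by fun_prop) continuous_const)
      have := h1 _ (Set.vadd_mem_vadd_set (a := t i) hx)
      rw [vadd_eq_add, add_comm] at this
      rw [Set.mem_ofPred_eq, hg]
      exact this.le
    rw [hi.closure_interior_eq_closure_of_nonempty_interior hi'] at hcl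
    exact fun x hx => hcl (subset_closure hx)
  have hge : ∀ y ∈ K j, c ≤ ⟪v, y + t j⟫ := by
    have hcl : closure (interior (K j)) ⊆ {x | c ≤ ⟪v, x + t j⟫} := by
      refine closure_minimal (fun x hx => ?_) (isClosed_le continuous_const (by fun_prop))
      have := h2 _ (Set.vadd_mem_vadd_set (a := t j) hx)
      rw [vadd_eq_add, add_comm] at this
      rw [Set.mem_ofPred_eq, hg]
      exact this.le
    rw [hj.closure_interior_eq_closure_of_nonempty_interior hj'] at hcl
    exact fun x hx => hcl (subset_closure hx)
  have hv0 : 0 < ‖v‖ := by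
    rw [norm_pos_iff]
    intro h0
    obtain ⟨x, hx⟩ := hi'
    obtain ⟨y, hy⟩ := hj'
    have e1 := h1 _ (Set.vadd_mem_vadd_set (a := t i) hx)
    have e2 := h2 _ (Set.vadd_mem_vadd_set (a := t j) hy)
    rw [← hg, h0, inner_zero_left] at e1 e2
    linarith
  refine ⟨‖v‖⁻¹ • v, ?_, ‖v‖⁻¹ * c, fun x hx => ?_, fun y hy => ?_⟩
  · rw [norm_smul, norm_inv, norm_norm, inv_mul_cancel₀ hv0.ne']
  · rw [real_inner_smul_left]
    exact mul_le_mul_of_nonneg_left (hle x hx) (by positivity)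
  · rw [real_inner_smul_left]
    exact mul_le_mul_of_nonneg_left (hge y hy) (by positivity)

end FatBodies

/-! ### Averaging over finitely many choices -/

section Averaging

variable {ι : Type*}

/-- If every element is bad for few choices, some choice loses little. -/
theorem exists_good_choice (S : Finset ι) {w : ι → ℝ} (hw : ∀ i, 0 ≤ w i) {bad : ι → ℕ → Prop}
    {N b : ℕ} (hN : 0 < N) {ε : ℝ} (hb : 2 * b ≤ N) (hε : b ≤ 2 * ε * N)
    (h : ∀ i ∈ S, ∀ T : Finset ℕ, (∀ j ∈ T, j < N ∧ bad i j) → T.card ≤ b) :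
    ∃ j < N, ∃ S' ⊆ S, (∀ i ∈ S', ¬ bad i j) ∧
      ∑ i ∈ S, w i ≤ (1 + 4 * ε) * ∑ i ∈ S', w i := by
  classical
  set A := ∑ i ∈ S, w i with hA
  have hA0 : 0 ≤ A := Finset.sum_nonneg fun i _ => hw i
  have hsum : ∑ j ∈ Finset.range N, ∑ i ∈ S with bad i j, w i ≤ b * A := by
    simp only [Finset.sum_filter]
    rw [Finset.sum_comm, hA, Finset.mul_sum]
    refine Finset.sum_le_sum fun i hi => ?_
    rw [← Finset.sum_filter, Finset.sum_const, nsmul_eq_mul]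
    refine mul_le_mul_of_nonneg_right ?_ (hw i)
    exact_mod_cast h i hi _ fun j hj =>
      ⟨Finset.mem_range.1 (Finset.mem_filter.1 hj).1, (Finset.mem_filter.1 hj).2⟩
  obtain ⟨j, hj, hjle⟩ : ∃ j ∈ Finset.range N, ∑ i ∈ S with bad i j, w i ≤ b * A / N := by
    refine Finset.exists_le_of_sum_le (Finset.nonempty_range_iff.2 hN.ne') ?_
    rw [Finset.sum_const, Finset.card_range, nsmul_eq_mul, mul_div_cancel₀ _ (by positivity)]
    exact hsum
  refine ⟨j, Finset.mem_range.1 hj, S.filter fun i => ¬ bad i j, Finset.filter_subset _ _,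
    fun i hi => (Finset.mem_filter.1 hi).2, ?_⟩
  have hsplit : ∑ i ∈ S with bad i j, w i + ∑ i ∈ S with ¬ bad i j, w i = A :=
    Finset.sum_filter_add_sum_filter_not S _ _
  have hN' : (0 : ℝ) < N := by exact_mod_cast hN
  set x : ℝ := b / N with hx
  have hx0 : 0 ≤ x := by positivity
  have hx1 : x ≤ 1 / 2 := by
    rw [hx, div_le_iff₀ hN']
    have : (2 : ℝ) * b ≤ N := by exact_mod_cast hb
    linarith
  have hx2 : x ≤ 2 * ε := by rw [hx, div_le_iff₀ hN']; exact hε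
  have hxA : b * A / N = x * A := by rw [hx]; ring
  rw [hxA] at hjle
  have h1 : (1 - x) * A ≤ ∑ i ∈ S with ¬ bad i j, w i := by linarith
  -- From `x ≤ 1/2` and `x ≤ 2 * ε` follows `4 * ε * (1 - x) ≥ 2 * x * (1/2) = x`.
  have h2 : 1 ≤ (1 + 4 * ε) * (1 - x) := by nlinarith
  calc A = 1 * A := (one_mul A).symm
    _ ≤ (1 + 4 * ε) * (1 - x) * A := mul_le_mul_of_nonneg_right h2 hA0
    _ = (1 + 4 * ε) * ((1 - x) * A) := by ring
    _ ≤ _ := mul_le_mul_of_nonneg_left h1 (by linarith)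

theorem one_add_pow_le (n : ℕ) {x : ℝ} (hx : 0 ≤ x) (hx2 : x ≤ 2) :
    (1 + x) ^ n ≤ 1 + 4 ^ n * x := by
  induction n with
  | zero => simp [hx]
  | succ n ih =>
    have h1 : (1 : ℝ) ≤ 4 ^ n := one_le_pow₀ (by norm_num)
    calc (1 + x) ^ (n + 1) = (1 + x) ^ n * (1 + x) := pow_succ _ _
      _ ≤ (1 + 4 ^ n * x) * (1 + x) := mul_le_mul_of_nonneg_right ih (by linarith)
      _ ≤ 1 + 4 ^ (n + 1) * x := by
        have h2 : (4 : ℝ) ^ n * x * x ≤ 4 ^ n * x * 2 :=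
          mul_le_mul_of_nonneg_left hx2 (by positivity)
        have h3 : x ≤ 4 ^ n * x := le_mul_of_one_le_left hx h1
        rw [pow_succ]
        linarith

end Averaging

/-! ### Creating slack and spreading the objects -/

section Slack

open scoped RealInnerProductSpace

variable {d : ℕ} {ι : Type*}

/-- A set of translated bodies in the knapsack, pairwise separated. -/
structure Separated (K : ι → Set (E d)) (t : ι → E d) (S : Finset ι) : Prop where
  cube : ∀ i ∈ S, ∀ x ∈ K i, ∀ k, 0 ≤ x k + t i k ∧ x k + t i k ≤ 1
  sep : ∀ i ∈ S, ∀ j ∈ S, i ≠ j → SepAt K t i j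

-- The candidate strips have width `η` and mutual gaps `2 * ε`. An object is in the way of a strip
-- if it reaches above the bottom of the strip and below its top. Deleting the obstructing objects
-- of one cheap strip lets everything above it slide down by `η`; pairs on different sides become
-- separated by the hyperplane `x k = a j`, and pairs on the same side move together.
open Classical in
theorem Separated.exists_slack_coord {K : ι → Set (E d)} {t : ι → E d} {S : Finset ι}
    (h : Separated K t S) {w : ι → ℝ} (hw : ∀ i, 0 ≤ w i) {ε η : ℝ} {m : ℕ} (hε : 0 < ε)
    (hη : 0 < η) (hm : 2 ≤ m) (hmε : 1 ≤ 2 * ε * m) (hmη : (m - 1) * (2 * ε + η) + η ≤ 1)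
    (hK : ∀ i, ∀ x ∈ K i, ∀ y ∈ K i, ∀ k, x k - y k ≤ 2 * ε) (k : Fin d) :
    ∃ t' : ι → E d, ∃ S' ⊆ S, Separated K t' S' ∧
      (∀ i ∈ S', ∀ x ∈ K i, x k + t' i k ≤ 1 - η) ∧ (∀ i, ∀ l ≠ k, t' i l = t i l) ∧
      ∑ i ∈ S, w i ≤ (1 + 4 * ε) * ∑ i ∈ S', w i := by
  set a : ℕ → ℝ := fun j => j * (2 * ε + η) with ha
  obtain ⟨j, hj, S', hS', hgood, hsum⟩ := exists_good_choice S hw (N := m) (b := 1) (ε := ε)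
    (bad := fun i j => (∃ x ∈ K i, a j < x k + t i k) ∧ ∃ y ∈ K i, y k + t i k < a j + η)
    (by omega) (by omega) (by simpa using hmε) (by
      intro i hi T hT
      rw [Finset.card_le_one]
      -- An object obstructing two strips would be wider than the gap `2 * ε` between them.
      have key : ∀ j ∈ T, ∀ j' ∈ T, ¬ j < j' := by
        intro j hj j' hj' hlt
        obtain ⟨-, -, y, hy, hy'⟩ := hT j hj
        obtain ⟨-, ⟨x, hx, hx'⟩, -⟩ := hT j' hj'
        have h1 := hK i x hx y hy k
        have h2 : (j : ℝ) + 1 ≤ j' := by exact_mod_cast hlt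
        have h3 : a j + (2 * ε + η) ≤ a j' := by
          simp only [ha]
          nlinarith
        linarith
      intro j hj j' hj'
      exact le_antisymm (not_lt.1 (key j' hj' j hj)) (not_lt.1 (key j hj j' hj')))
  have haj0 : 0 ≤ a j := by simp only [ha]; positivity
  have haj1 : a j ≤ 1 - η := by
    have : (j : ℝ) ≤ m - 1 := by
      have : (j : ℝ) + 1 ≤ m := by exact_mod_cast hj
      linarith
    simp only [ha]
    nlinarith
  set e : E d := EuclideanSpace.single k η with he
  set t' : ι → E d := fun i => if ∃ x ∈ K i, a j < x k + t i k then t i - e else t i with ht'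
  have hek : e k = η := by simp [he]
  have hel : ∀ l ≠ k, e l = 0 := fun l hl => by simp [he, hl]
  have hup : ∀ i ∈ S', (∃ x ∈ K i, a j < x k + t i k) → ∀ y ∈ K i, a j ≤ y k + t' i k := by
    intro i hi hx y hy
    have h1 : ¬ y k + t i k < a j + η := fun h1 => hgood i hi ⟨hx, y, hy, h1⟩
    simp only [ht', if_pos hx, PiLp.sub_apply, hek]
    linarith
  have hlow : ∀ i, (¬ ∃ x ∈ K i, a j < x k + t i k) → ∀ y ∈ K i, y k + t' i k ≤ a j := by
    intro i hx y hy
    simp only [ht', if_neg hx]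
    by_contra h1
    exact hx ⟨y, hy, not_le.1 h1⟩
  have htl : ∀ i, ∀ l ≠ k, t' i l = t i l := by
    intro i l hl
    simp only [ht']
    split_ifs
    · simp [hel l hl]
    · rfl
  have hsepk : ∀ i ∈ S', ∀ i' ∈ S', (¬ ∃ x ∈ K i, a j < x k + t i k) →
      (∃ x ∈ K i', a j < x k + t i' k) → SepAt K t' i i' := by
    intro i hi i' hi' hn hp
    refine ⟨EuclideanSpace.single k 1, by simp, a j, fun x hx => ?_, fun y hy => ?_⟩
    · have := hlow i hn x hx
      simpa [EuclideanSpace.inner_single_left] using this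
    · have := hup i' hi' hp y hy
      simpa [EuclideanSpace.inner_single_left] using this
  refine ⟨t', S', hS', ⟨fun i hi x hx l => ?_, fun i hi i' hi' hne => ?_⟩, fun i hi x hx => ?_, htl,
    hsum⟩
  · have h0 := h.cube i (hS' hi) x hx l
    by_cases hl : l = k
    · subst hl
      by_cases hp : ∃ x ∈ K i, a j < x l + t i l
      · refine ⟨haj0.trans (hup i hi hp x hx), ?_⟩
        simp only [ht', if_pos hp, PiLp.sub_apply, hek]
        linarith
      · simp only [ht', if_neg hp]
        exact h0
    · rw [htl i l hl]; exact h0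
  · by_cases hp : ∃ x ∈ K i, a j < x k + t i k
    · by_cases hp' : ∃ x ∈ K i', a j < x k + t i' k
      · exact (h.sep i (hS' hi) i' (hS' hi') hne).add (-e) (by simp [ht', if_pos hp, sub_eq_add_neg])
          (by simp [ht', if_pos hp', sub_eq_add_neg])
      · exact (hsepk i' hi' i hi hp' hp).symm
    · by_cases hp' : ∃ x ∈ K i', a j < x k + t i' k
      · exact hsepk i hi i' hi' hp hp'
      · exact (h.sep i (hS' hi) i' (hS' hi') hne).add 0 (by simp [ht', if_neg hp])
          (by simp [ht', if_neg hp'])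
  · by_cases hp : ∃ x ∈ K i, a j < x k + t i k
    · simp only [ht', if_pos hp, PiLp.sub_apply, hek]
      have := (h.cube i (hS' hi) x hx k).2
      linarith
    · exact (hlow i hp x hx).trans haj1

/-- The coordinates are treated one after the other; a step changes positions in its own coordinate
only, so earlier slack is preserved. -/
theorem Separated.exists_slack {K : ι → Set (E d)} {t : ι → E d} {S : Finset ι}
    (h : Separated K t S) {w : ι → ℝ} (hw : ∀ i, 0 ≤ w i) {ε η : ℝ} {m : ℕ} (hε : 0 < ε)
    (hη : 0 < η) (hm : 2 ≤ m) (hmε : 1 ≤ 2 * ε * m) (hmη : (m - 1) * (2 * ε + η) + η ≤ 1)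
    (hK : ∀ i, ∀ x ∈ K i, ∀ y ∈ K i, ∀ k, x k - y k ≤ 2 * ε) (A : Finset (Fin d)) :
    ∃ t' : ι → E d, ∃ S' ⊆ S, Separated K t' S' ∧
      (∀ k ∈ A, ∀ i ∈ S', ∀ x ∈ K i, x k + t' i k ≤ 1 - η) ∧
      ∑ i ∈ S, w i ≤ (1 + 4 * ε) ^ A.card * ∑ i ∈ S', w i := by
  classical
  induction A using Finset.induction with
  | empty => exact ⟨t, S, subset_rfl, h, by simp, by simp⟩
  | insert k A hk ih =>
    obtain ⟨t₁, S₁, hS₁, h₁, hb₁, hw₁⟩ := ih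
    obtain ⟨t₂, S₂, hS₂, h₂, hb₂, htl, hw₂⟩ :=
      h₁.exists_slack_coord hw hε hη hm hmε hmη hK k
    refine ⟨t₂, S₂, hS₂.trans hS₁, h₂, fun l hl i hi x hx => ?_, ?_⟩
    · by_cases hlk : l = k
      · subst hlk; exact hb₂ i hi x hx
      · rw [htl i l hlk]
        exact hb₁ l ((Finset.mem_insert.1 hl).resolve_left hlk) i (hS₂ hi) x hx
    · rw [Finset.card_insert_of_notMem hk, pow_succ, mul_assoc]
      exact hw₁.trans (mul_le_mul_of_nonneg_left hw₂ (by positivity))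

/-- In the separating direction `u`, the center of the inner ball of `K i` stays `r i` below the
hyperplane, while that of `K j` is not below it. Dilating the positions of these centers by `1 + γ`,
without scaling the bodies, widens the gap by at least `γ * r i`. -/
theorem SepAt.le_dist {K : ι → Set (E d)} {t : ι → E d} {i j : ι} (h : SepAt K t i j)
    {z : ι → E d} {r : ι → ℝ} (hr : ∀ i, 0 ≤ r i)
    (hz : ∀ i, Metric.closedBall (z i) (r i) ⊆ K i) {γ : ℝ} (hγ : 0 ≤ γ) {x y : E d}
    (hx : x ∈ K i) (hy : y ∈ K j) :
    γ * r i ≤ dist (x + (t i + γ • (z i + t i))) (y + (t j + γ • (z j + t j))) := by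
  obtain ⟨u, hu, c, h1, h2⟩ := h
  have h3 : ⟪u, z i + t i⟫ + r i ≤ c := by
    have hm : z i + r i • u ∈ K i := hz i (by
      rw [mem_closedBall_iff_norm, add_sub_cancel_left, norm_smul, hu, mul_one,
        Real.norm_of_nonneg (hr i)])
    have := h1 _ hm
    rw [add_right_comm, inner_add_right, real_inner_smul_right, real_inner_self_eq_norm_sq, hu]
      at this
    linarith
  have h4 : c ≤ ⟪u, z j + t j⟫ := h2 _ (hz j (Metric.mem_closedBall_self (hr j)))
  have h5 := h1 x hx
  have h6 := h2 y hy
  have h7 : ⟪u, y + (t j + γ • (z j + t j)) - (x + (t i + γ • (z i + t i)))⟫ =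
      ⟪u, y + t j⟫ - ⟪u, x + t i⟫ + γ * (⟪u, z j + t j⟫ - ⟪u, z i + t i⟫) := by
    rw [inner_sub_right, ← add_assoc, ← add_assoc, inner_add_right u (y + t j),
      inner_add_right u (x + t i), real_inner_smul_right, real_inner_smul_right]
    ring
  have h8 := real_inner_le_norm u (y + (t j + γ • (z j + t j)) - (x + (t i + γ • (z i + t i))))
  rw [hu, one_mul, h7, ← dist_eq_norm, dist_comm] at h8
  refine le_trans ?_ h8
  nlinarith

/-- Slack in all directions: the bodies can be placed away from the boundary and from each
other. -/
theorem Separated.exists_spread {K : ι → Set (E d)} {t : ι → E d} {S : Finset ι}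
    (h : Separated K t S) {w : ι → ℝ} (hw : ∀ i, 0 ≤ w i) {ε η : ℝ} {m : ℕ} (hε : 0 < ε)
    (hη : 0 < η) (hm : 2 ≤ m) (hmε : 1 ≤ 2 * ε * m) (hmη : (m - 1) * (2 * ε + η) + η ≤ 1)
    (hK : ∀ i, ∀ x ∈ K i, ∀ y ∈ K i, ∀ k, x k - y k ≤ 2 * ε) {z : ι → E d} {r : ι → ℝ}
    (hr : ∀ i, 0 ≤ r i) (hz : ∀ i, Metric.closedBall (z i) (r i) ⊆ K i) :
    ∃ t' : ι → E d, ∃ S' ⊆ S,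
      (∀ i ∈ S', ∀ x ∈ K i, ∀ k, η / 4 ≤ x k + t' i k ∧ x k + t' i k ≤ 1 - η / 4) ∧
      (∀ i ∈ S', ∀ j ∈ S', i ≠ j → ∀ x ∈ K i, ∀ y ∈ K j,
        η / 2 * r i ≤ dist (x + t' i) (y + t' j)) ∧
      ∑ i ∈ S, w i ≤ (1 + 4 * ε) ^ d * ∑ i ∈ S', w i := by
  obtain ⟨t₁, S₁, hS₁, h₁, hb₁, hw₁⟩ :=
    h.exists_slack hw hε hη hm hmε hmη hK Finset.univ
  -- The dilation raises coordinates by at most `η / 2`, half of the slack; the translation by `η /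
  -- 4` divides the other half between the two sides.
  set v : E d := WithLp.toLp 2 fun _ => η / 4 with hv
  refine ⟨fun i => t₁ i + (η / 2) • (z i + t₁ i) + v, S₁, hS₁, fun i hi x hx k => ?_,
    fun i hi j hj hij x hx y hy => ?_, by simpa using hw₁⟩
  · have hzi := hz i (Metric.mem_closedBall_self (hr i))
    have h2 := h₁.cube i hi x hx k
    have h3 := h₁.cube i hi _ hzi k
    have h4 := hb₁ k (Finset.mem_univ _) i hi x hx
    have h5 := hb₁ k (Finset.mem_univ _) i hi _ hzi
    simp only [PiLp.add_apply, PiLp.smul_apply, smul_eq_mul, hv]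
    constructor <;> nlinarith
  · have := (h₁.sep i hi j hj hij).le_dist hr hz (γ := η / 2) (by linarith) hx hy
    simp only [← add_assoc] at this ⊢
    rwa [dist_add_right]

end Slack

/-! ### From well-separated positions to a grid packing -/

section GridPositions

variable {d : ℕ}

/-- The side length of the cells of a level. -/
def Params.side (P : Params d) : ℕ → ℚ
  | 0 => 1
  | l + 1 => P.res l

theorem Params.side_eq {P : Params d} {C : ℕ} (hP : P.Bounded C) (l : ℕ) :
    P.side l = P.ratioAt l * P.res l := by
  have e1 : (P.first : ℚ) ≠ 0 := by exact_mod_cast hP.first_pos.ne'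
  have e2 : (P.ratio : ℚ) ≠ 0 := by exact_mod_cast hP.ratio_pos.ne'
  cases l with
  | zero =>
    simp only [Params.side, Params.ratioAt, Params.res, if_true, pow_zero, mul_one]
    field_simp
  | succ l =>
    simp only [Params.side, Params.ratioAt, Params.res, Nat.succ_ne_zero, if_false]
    push_cast
    field_simp
    ring

/-- The cell of level `l` that contains a point. -/
noncomputable def Params.cell (P : Params d) (Y : E d) (l : ℕ) : Fin d → ℤ :=
  fun k => ⌊Y k / (P.side l : ℝ)⌋

variable {I : Instance d} {P : Params d} {O : Val → Bool} {q W Kf C : ℕ}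

theorem floor_div_ratioAt (hP : P.Bounded C) (l : ℕ) (v : ℝ) :
    ⌊v / (P.res l : ℝ)⌋ / (P.ratioAt l : ℤ) = ⌊v / (P.side l : ℝ)⌋ := by
  rw [← Int.floor_div_natCast, div_div, Params.side_eq hP, mul_comm]
  push_cast
  rfl

theorem cell_div (hP : P.Bounded C) (Y : E d) (l : ℕ) (k : Fin d) :
    P.cell Y (l + 1) k / (P.ratioAt l : ℤ) = P.cell Y l k :=
  floor_div_ratioAt hP l (Y k)

theorem cell_succ (hP : P.Bounded C) (Y : E d) (l : ℕ) (k : Fin d) :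
    |P.cell Y (l + 1) k * (P.res l : ℝ) - Y k| ≤ P.res l := by
  have hh : (0 : ℝ) < P.res l := by exact_mod_cast res_pos hP l
  have h1 := Int.floor_le (Y k / (P.res l : ℝ))
  have h2 := Int.lt_floor_add_one (Y k / (P.res l : ℝ))
  rw [le_div_iff₀ hh] at h1
  rw [div_lt_iff₀ hh] at h2
  change |(⌊Y k / (P.res l : ℝ)⌋ : ℝ) * (P.res l : ℝ) - Y k| ≤ P.res l
  rw [abs_le]
  constructor <;> linarith

/-- Cells that belong to the shape of an object are close to the object. -/
theorem near_of_mem_shape (hO : I.IsOracle O) (hG : IsGrid P q W Kf) (hP : P.Bounded C)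
    {i : Fin I.n} {l M : ℕ} {t : E d} {p : Fin d → ℤ} (hp : p ∈ shape P M (I.labelAt P O l i)) :
    ∃ y ∈ I.body i, ∀ k, |(P.cell (toPoint (I.center i) + t) (l + 1) k + p k) * (P.res l : ℝ) -
      (y k + t k)| ≤ 4 * P.res l := by
  obtain ⟨ans, hans, u, hu, hau, hpu⟩ := hp
  have ha : answer O P.prec (P.res l) (I.item i) u = true := by
    rw [← answersCode_inj hans u hu, hau]
  have hh := res_pos hP l
  have hh' : (0 : ℝ) < P.res l := by exact_mod_cast hh
  obtain ⟨y, hy, hn⟩ := (Instance.isTest hO i hG hh).near hG hh ha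
  refine ⟨y, hy, fun k => ?_⟩
  -- The error `4` is composed of `1` for rounding the reference point, `2` for the radius used in
  -- `shape` and `1` for the accepted test.
  have h1 := hn k
  rw [testPoint_apply] at h1
  have h2 := cell_succ hP (toPoint (I.center i) + t) l k
  have h3 : |(p k : ℝ) - u k| ≤ 2 := by exact_mod_cast hpu k
  have h4 : |((p k : ℝ) - u k) * P.res l| ≤ 2 * P.res l := by
    rw [abs_mul, abs_of_pos hh']
    exact mul_le_mul_of_nonneg_right h3 hh'.le
  have h5 : (toPoint (I.center i) + t) k = I.center i k + t k := by simp [toPoint]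
  rw [h5] at h2
  rw [abs_le] at h1 h2 h4 ⊢
  constructor <;> nlinarith

/-- Shapes exceed their objects by at most four units of resolution. Overlaps are excluded by the
distances `γ * r i`, since largeness makes `r i` a large multiple of the resolution; containment in
a cell is the robust condition `hin`; and `hext` keeps the accepted tests well inside the test cube,
so that the labels are good. -/
theorem gridPacking_of_positions (hO : I.IsOracle O) (hG : IsGrid P q W Kf) (hP : P.Bounded C)
    {F γ : ℝ} {r : Fin I.n → ℝ} (hF : ∀ i, FatWith F (r i) (I.body i : Set (E d)))
    (hγ : 8 * d * F < γ * (Kf - 1)) (hγ0 : 0 < γ) (hW : ∀ l, P.ratioAt l + 4 ≤ W)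
    {S : Finset (Fin I.n)} {lev : Fin I.n → ℕ} {t : Fin I.n → E d}
    (hl : ∀ i ∈ S, isLarge P O (P.res (lev i)) (I.item i) = true)
    (hnl : ∀ i ∈ S, ∀ l < lev i, isLarge P O (P.res l) (I.item i) = false)
    (h0 : ∀ i ∈ S, P.cell (toPoint (I.center i) + t i) 0 = 0)
    (hin : ∀ i ∈ S, ∀ x ∈ I.body i, ∀ k, ∀ v : ℝ, |v - (x k + t i k)| ≤ 4 * P.res (lev i) →
      ⌊v / (P.side (lev i) : ℝ)⌋ = P.cell (toPoint (I.center i) + t i) (lev i) k)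
    (hext : ∀ i ∈ S, ∀ x ∈ I.body i, ∀ k, |x k - I.center i k| ≤ P.side (lev i))
    (hdist : ∀ i ∈ S, ∀ j ∈ S, i ≠ j → ∀ x ∈ I.body i, ∀ y ∈ I.body j,
      γ * r i ≤ dist (x + t i) (y + t j)) :
    GridPacking I P O W S lev (fun i => P.cell (toPoint (I.center i) + t i)) := by
  have hc : ∀ i, toPoint (I.center i) ∈ I.body i := fun i =>
    I.ball_subset i (Metric.mem_closedBall_self (by exact_mod_cast (I.radius_pos i).le))
  -- Two points that close have distance at most `8 * d * h` with `h` the resolution, while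
  -- largeness gives `(Kf - 1) * h ≤ F * r i` and thus a distance of at least `γ * (Kf - 1) * h /
  -- F`; this contradicts `hγ`.
  have hfar : ∀ i ∈ S, ∀ j ∈ S, i ≠ j → ∀ x ∈ I.body i, ∀ y ∈ I.body j,
      ¬ ∀ k, |(x k + t i k) - (y k + t j k)| ≤ 8 * P.res (lev i) := by
    intro i hi j hj hij x hx y hy hk
    have h1 := hdist i hi j hj hij x hx y hy
    have h2 := dist_le_of_coord_le (x := x + t i) (y := y + t j) hk
    have hh := res_pos hP (lev i)
    have hh' : (0 : ℝ) < P.res (lev i) := by exact_mod_cast hh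
    have h3 := (Instance.isTest hO i hG hh).radius_of_large (hF i) (hc i) hG hh
      (isLarge_iff.1 (hl i hi))
    have hF0 : 0 < F := one_pos.trans_le (hF i).one_le
    have h4 : γ * ((Kf - 1) * P.res (lev i)) ≤ γ * (F * r i) :=
      mul_le_mul_of_nonneg_left h3 hγ0.le
    have h5 : 8 * d * F * P.res (lev i) < γ * (Kf - 1) * P.res (lev i) :=
      mul_lt_mul_of_pos_right hγ hh'
    have h6 : F * (γ * r i) ≤ F * (d * (8 * P.res (lev i))) :=
      mul_le_mul_of_nonneg_left (h1.trans h2) hF0.le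
    nlinarith
  refine ⟨h0, fun i _ a k => cell_div hP _ a k, hl, hnl, ?_, ?_, ?_, ?_⟩
  · intro i hi
    have hT := Instance.isTest hO i hG (res_pos hP (lev i))
    obtain ⟨u, hu, hau⟩ := isLarge_iff.1 (hl i hi)
    refine ⟨⟨_, rfl, u, ((hG.mem_far u).1 hu).1, hau⟩, fun ans hans u hu ha k => ?_⟩
    have ha' : answer O P.prec (P.res (lev i)) (I.item i) u = true := by
      rw [← answersCode_inj hans u hu, ha]
    have hh := res_pos hP (lev i)
    have hh' : (0 : ℝ) < P.res (lev i) := by exact_mod_cast hh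
    obtain ⟨y, hy, hn⟩ := hT.near hG hh ha'
    have h1 := hn k
    rw [testPoint_apply] at h1
    have h2 := hext i hi y hy k
    rw [Params.side_eq hP] at h2
    push_cast at h2
    have h3 : |(P.res (lev i) : ℝ) * u k| ≤ (P.ratioAt (lev i) + 1) * P.res (lev i) := by
      rw [abs_le] at h1 h2 ⊢
      constructor <;> nlinarith
    rw [abs_mul, abs_of_pos hh', mul_comm] at h3
    have h4 := le_of_mul_le_mul_right h3 hh'
    have h5 : ((P.ratioAt (lev i) : ℝ) + 4) ≤ W := by exact_mod_cast hW (lev i)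
    have h6 : |(u k : ℝ)| < W - 2 := by linarith
    exact_mod_cast h6
  · intro i hi p hp k
    have hh' : (0 : ℝ) < P.res (lev i) := by exact_mod_cast res_pos hP (lev i)
    obtain ⟨y, hy, hn⟩ := near_of_mem_shape hO hG hP (t := t i) hp
    have h1 := hin i hi y hy k _ (hn k)
    rw [← floor_div_ratioAt hP, mul_div_assoc, div_self hh'.ne', mul_one] at h1
    rw [← h1]
    congr 1
    rw [← Int.cast_add, Int.floor_intCast]
  · intro i hi j hj hij hlev p hp p' hp' e
    obtain ⟨x, hx, hnx⟩ := near_of_mem_shape hO hG hP (t := t i) hp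
    rw [hlev] at hp'
    obtain ⟨y, hy, hny⟩ := near_of_mem_shape hO hG hP (t := t j) hp'
    refine hfar i hi j hj hij x hx y hy fun k => ?_
    have h1 := hnx k
    have h2 := hny k
    rw [← hlev] at h2
    have h3 : ((P.cell (toPoint (I.center i) + t i) (lev i + 1) k : ℝ) + p k) =
        P.cell (toPoint (I.center j) + t j) (lev i + 1) k + p' k := by
      exact_mod_cast congrFun e k
    rw [h3] at h1
    rw [abs_le] at h1 h2 ⊢
    constructor <;> linarith
  · intro i hi j hj hlt p hp e
    obtain ⟨x, hx, hnx⟩ := near_of_mem_shape hO hG hP (t := t i) hp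
    refine hfar i hi j hj (by rintro rfl; exact lt_irrefl _ hlt) x hx _ (hc j) fun k => ?_
    have h1 := hnx k
    have h2 := cell_succ hP (toPoint (I.center j) + t j) (lev i) k
    have h3 : ((P.cell (toPoint (I.center i) + t i) (lev i + 1) k : ℝ) + p k) =
        P.cell (toPoint (I.center j) + t j) (lev i + 1) k := by
      exact_mod_cast congrFun e k
    have hh' : (0 : ℝ) < P.res (lev i) := by exact_mod_cast res_pos hP (lev i)
    rw [h3] at h1
    rw [PiLp.add_apply] at h2
    rw [abs_le] at h1 h2 ⊢
    constructor <;> linarith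

end GridPositions

/-! ### Choosing the offset of the levels and the shift of the placement -/

section Offsets

variable {d : ℕ} {ι : Type*}

/-- The extent of a set is comparable with `1 / D`. -/
def Critical (K : Set (E d)) (c : Vec d) (m Kf D : ℕ) : Prop :=
  (∃ x ∈ K, ∃ k, 1 / (D : ℝ) / (4 * m) < |x k - c k|) ∧
    ∀ x ∈ K, ∀ k, |x k - c k| ≤ (Kf + 1) * (1 / (D : ℝ))

/-- The range of critical extents spans a factor `4 * m * (Kf + 1) ≤ β`, so it cannot contain the
extent of one set for two different powers of `β`. -/
theorem Critical.not_lt {K : Set (E d)} {c : Vec d} {m Kf β e e' : ℕ} (hm : 0 < m)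
    (hβ0 : 0 < β) (hβ : 4 * m * (Kf + 1) ≤ β) (h : Critical K c m Kf (β ^ e))
    (h' : Critical K c m Kf (β ^ e')) : ¬ e < e' := by
  intro hlt
  obtain ⟨x, hx, k, h1⟩ := h.1
  have h2 := h'.2 x hx k
  have hb : (0 : ℝ) < β := by exact_mod_cast hβ0
  have hm' : (0 : ℝ) < m := by exact_mod_cast hm
  have hbe : (0 : ℝ) < (β : ℝ) ^ e := by positivity
  have h3 : (β : ℝ) ^ e * β ≤ (β : ℝ) ^ e' := by
    rw [← pow_succ]
    exact pow_le_pow_right₀ (by exact_mod_cast hβ0) hlt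
  have h4 : (4 * m * (Kf + 1) : ℝ) ≤ β := by exact_mod_cast hβ
  have h5 := h1.trans_le h2
  push_cast at h5
  rw [div_div, mul_one_div, div_lt_div_iff₀ (by positivity) (by positivity), one_mul] at h5
  nlinarith

/-- For some offset the extent of most objects is not critical. -/
theorem exists_offset (S : Finset ι) {w : ι → ℝ} (hw : ∀ i, 0 ≤ w i) (K : ι → Set (E d))
    (c : ι → Vec d) {m Kf β N : ℕ} (hm : 0 < m) (hβ0 : 0 < β) (hβ : 4 * m * (Kf + 1) ≤ β)
    (hN : 2 ≤ N) {ε : ℝ} (hNε : 1 ≤ 2 * ε * N) :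
    ∃ τ < N, ∃ S' ⊆ S, (∀ i ∈ S', ∀ l, ¬ Critical (K i) (c i) m Kf (β ^ (τ + 1) * (β ^ N) ^ l)) ∧
      ∑ i ∈ S, w i ≤ (1 + 4 * ε) * ∑ i ∈ S', w i := by
  obtain ⟨τ, hτ, S', hS', hgood, hsum⟩ := exists_good_choice S hw (N := N) (b := 1) (ε := ε)
    (bad := fun i τ => ∃ l, Critical (K i) (c i) m Kf (β ^ (τ + 1) * (β ^ N) ^ l))
    (by omega) (by omega) (by simpa using hNε) (by
      intro i _ T hT
      rw [Finset.card_le_one]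
      intro τ hτ τ' hτ'
      obtain ⟨h1, l, hl⟩ := hT τ hτ
      obtain ⟨h2, l', hl'⟩ := hT τ' hτ'
      -- The exponent `τ + 1 + N * l` determines `τ < N` by its residue modulo `N`, so an object is
      -- bad for at most one offset.
      rw [← pow_mul, ← pow_add] at hl hl'
      have h3 : τ + 1 + N * l = τ' + 1 + N * l' :=
        le_antisymm (not_lt.1 (hl'.not_lt hm hβ0 hβ hl)) (not_lt.1 (hl.not_lt hm hβ0 hβ hl'))
      have h4 : (τ + N * l) % N = (τ' + N * l') % N := by congr 1; omega
      rwa [Nat.add_mul_mod_self_left, Nat.add_mul_mod_self_left, Nat.mod_eq_of_lt h1,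
        Nat.mod_eq_of_lt h2] at h4)
  exact ⟨τ, hτ, S', hS', fun i hi l hl => hgood i hi ⟨l, hl⟩, hsum⟩

/-- Subtracting the two estimates and multiplying by `m` puts the integer `(j - j') * B - m * (z -
z')` strictly between `-1` and `1`, so it vanishes. Then `m` divides `j - j'`, as `B` is prime to
`m`. -/
theorem shift_unique {m B j j' : ℕ} (hB : B.Coprime m) (hj : j < m) (hj' : j' < m) {y : ℝ}
    {z z' : ℤ} (h : |y + j * B / m - z| < 1 / (2 * m)) (h' : |y + j' * B / m - z'| < 1 / (2 * m)) :
    j = j' := by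
  have hm : (0 : ℝ) < m := by exact_mod_cast (Nat.zero_le j).trans_lt hj
  have h1 : |((j : ℝ) - j') * B / m - (z - z')| < 1 / m := by
    have e : ((j : ℝ) - j') * B / m - (z - z') =
        (y + j * B / m - z) - (y + j' * B / m - z') := by ring
    have e2 : (1 : ℝ) / m = 1 / (2 * m) + 1 / (2 * m) := by field_simp; ring
    rw [e, e2]
    exact (abs_sub _ _).trans_lt (add_lt_add h h')
  have h2 : |((j : ℝ) - j') * B - m * (z - z')| < 1 := by
    have e : ((j : ℝ) - j') * B - m * (z - z') = (((j : ℝ) - j') * B / m - (z - z')) * m := by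
      field_simp
    rw [e, abs_mul, abs_of_pos hm]
    rwa [lt_div_iff₀ hm] at h1
  have h3 : |((j : ℤ) - j') * B - m * (z - z')| < 1 := by exact_mod_cast h2
  rw [Int.abs_lt_one_iff, sub_eq_zero] at h3
  have h4 : (m : ℤ) ∣ (j : ℤ) - j' := by
    refine IsCoprime.dvd_of_dvd_mul_right ?_ (Dvd.intro _ h3.symm)
    exact (Nat.isCoprime_iff_coprime.2 hB).symm
  have h5 : (j' : ℤ) ≡ j [ZMOD m] := (Int.modEq_iff_dvd).2 h4
  have h6 : j' ≡ j [MOD m] := (Int.natCast_modEq_iff).1 h5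
  exact (h6.eq_of_lt_of_lt hj' hj).symm

/-- For some shift most objects are far from the boundaries of the cells of their level. -/
theorem exists_shift (S : Finset ι) {w : ι → ℝ} (hw : ∀ i, 0 ≤ w i) (y : ι → Fin d → ℝ)
    (B : ι → ℕ) {m : ℕ} (hm : 0 < m) (hB : ∀ i, (B i).Coprime m) {ε : ℝ} (hd : 2 * d ≤ m)
    (hε : d ≤ 2 * ε * m) :
    ∃ j < m, ∃ S' ⊆ S, (∀ i ∈ S', ∀ k, ∀ z : ℤ, 1 / (2 * m) ≤ |y i k + j * B i / m - z|) ∧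
      ∑ i ∈ S, w i ≤ (1 + 4 * ε) * ∑ i ∈ S', w i := by
  classical
  obtain ⟨j, hj, S', hS', hgood, hsum⟩ := exists_good_choice S hw (N := m) (b := d) (ε := ε)
    (bad := fun i j => ∃ k, ∃ z : ℤ, |y i k + j * B i / m - z| < 1 / (2 * m)) hm hd hε (by
      intro i _ T hT
      rcases T.eq_empty_or_nonempty with rfl | ⟨j₀, hj₀⟩
      · simp
      have : Nonempty (Fin d) := ⟨(hT j₀ hj₀).2.choose⟩
      -- Each bad shift is sent to a coordinate in which it fails. This map is injective by
      -- `shift_unique`, so there are at most `d` bad shifts.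
      choose! g hg using fun j hj => (hT j hj).2
      have := Finset.card_le_card_of_injOn (s := T) (t := Finset.univ) g (by simp)
        (fun j hj j' hj' e => by
          obtain ⟨z, hz⟩ := hg j hj
          obtain ⟨z', hz'⟩ := hg j' hj'
          rw [← e] at hz'
          exact shift_unique (hB i) (hT j hj).1 (hT j' hj').1 hz hz')
      simpa using this)
  refine ⟨j, hj, S', hS', fun i hi k z => ?_, hsum⟩
  by_contra h
  exact hgood i hi ⟨k, z, not_le.1 h⟩

theorem floor_eq_of_far {a b e f : ℝ} (h : ∀ z : ℤ, f ≤ |a - z|) (hab : |b - a| ≤ e)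
    (hef : e < f) : ⌊b⌋ = ⌊a⌋ := by
  rw [Int.floor_eq_iff]
  have h1 := h ⌊a⌋
  have h2 := h (⌊a⌋ + 1)
  have h3 := Int.floor_le a
  have h4 := Int.lt_floor_add_one a
  push_cast at h2
  rw [abs_of_nonneg (by linarith)] at h1
  rw [abs_of_nonpos (by linarith)] at h2
  rw [abs_le] at hab
  constructor <;> linarith

end Offsets

/-! ### Constants, near-optimal grid packings, and the main result -/

section Approximation

/-- The constants that depend on the dimension, the fatness and the size of the objects. -/
structure Constants (d : ℕ) (f ε : ℝ) where
  N : ℕ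
  η : ℝ
  Kf : ℕ
  X : ℕ
  q : ℕ
  two_le_N : 2 ≤ N
  one_le_N : 1 ≤ 2 * ε * N
  η_pos : 0 < η
  strips : (N - 1) * (2 * ε + η) + η ≤ 1
  two_le_Kf : 2 ≤ Kf
  lt_Kf : 8 * d * (4 * f) < η / 2 * (Kf - 1)
  le_X : 16 ≤ X
  Kf_le_X : 4 * (Kf + 1) ≤ X
  lt_X : 20 / η < X
  two_le_q : 2 ≤ q
  le_q : 2 * (4 * f) * (d + 1) ≤ q

theorem Constants.nonempty (d : ℕ) (f : ℝ) {ε : ℝ} (hε : 0 < ε) (hε' : ε < 1 / 2) :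
    Nonempty (Constants d f ε) := by
  set N := ⌈1 / (2 * ε)⌉₊ with hN
  have h1 : 1 / (2 * ε) ≤ N := Nat.le_ceil _
  have h2 : (N : ℝ) < 1 / (2 * ε) + 1 := Nat.ceil_lt_add_one (by positivity)
  have h3 : 1 < 1 / (2 * ε) := by rw [lt_div_iff₀ (by positivity)]; linarith
  have h4 : 2 ≤ N := by
    have : (1 : ℝ) < N := h3.trans_le h1
    exact_mod_cast this
  have h5 : 1 ≤ 2 * ε * N := by
    rwa [div_le_iff₀ (by positivity), mul_comm] at h1
  have h6 : (N - 1) * (2 * ε) < 1 := by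
    rw [← lt_div_iff₀ (by positivity)]; linarith
  have hN0 : (0 : ℝ) < N := by linarith
  -- Since `N - 1 < 1 / (2 * ε)`, the `N - 1` gaps leave positive room, which is divided equally
  -- among the `N` strips.
  set η := (1 - (N - 1) * (2 * ε)) / N with hη
  have hη0 : 0 < η := div_pos (by linarith) hN0
  have hηN : N * η = 1 - (N - 1) * (2 * ε) := by rw [hη]; field_simp
  obtain ⟨Kf, hK⟩ := exists_nat_gt (8 * d * (4 * f) / (η / 2) + 1)
  obtain ⟨X, hX⟩ := exists_nat_gt (20 / η)
  obtain ⟨q, hq⟩ := exists_nat_ge (2 * (4 * f) * (d + 1))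
  refine ⟨⟨N, η, max Kf 2, max (max 16 (4 * (max Kf 2 + 1))) X, max q 2, h4, h5, hη0, by linarith,
    le_max_right _ _, ?_, ?_, ?_, ?_, le_max_right _ _, ?_⟩⟩
  · have h7 : 8 * d * (4 * f) / (η / 2) < Kf - 1 := by linarith
    rw [div_lt_iff₀ (half_pos hη0), mul_comm ((Kf : ℝ) - 1)] at h7
    refine h7.trans_le (mul_le_mul_of_nonneg_left ?_ (half_pos hη0).le)
    have : (Kf : ℝ) ≤ (max Kf 2 : ℕ) := by exact_mod_cast le_max_left _ _
    linarith
  · exact (le_max_left _ _).trans (le_max_left _ _)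
  · exact (le_max_right _ _).trans (le_max_left _ _)
  · refine hX.trans_le ?_
    exact_mod_cast le_max_right _ _
  · refine hq.trans ?_
    exact_mod_cast le_max_left _ _

namespace Constants

variable {d : ℕ} {f ε : ℝ} (c : Constants d f ε)

/-- The number of shifts. -/
def m : ℕ := d * c.N

/-- The base of the resolutions. -/
def β : ℕ := 1 + c.m * c.X

/-- Exceeds every ratio of consecutive levels by at least `4`, so that an object fitting in a cell
of its level stays within the tests, and exceeds `Kf` by at least `2`. -/
def W : ℕ := c.β ^ c.N + c.Kf + 4

/-- The constants of the algorithm for a given offset. -/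
noncomputable def params (τ : ℕ) : Params d :=
  Params.make d c.q c.W c.Kf (c.β ^ (τ + 1)) (c.β ^ c.N) (c.Kf + 1)

theorem β_pos : 0 < c.β := by rw [β]; omega

theorem m_pos (hd : 1 ≤ d) : 0 < c.m := Nat.mul_pos hd (by have := c.two_le_N; omega)

theorem mul_X_lt_β : c.m * c.X < c.β := by rw [β]; omega

theorem X_lt_β (hd : 1 ≤ d) : c.X < c.β :=
  (Nat.le_mul_of_pos_left _ (c.m_pos hd)).trans_lt c.mul_X_lt_β

theorem isGrid (τ : ℕ) : IsGrid (c.params τ) c.q c.W c.Kf :=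
  isGrid_make c.two_le_q c.two_le_Kf (by rw [W]; omega)

theorem bounded (τ : ℕ) : ∃ C, (c.params τ).Bounded C :=
  bounded_make (pow_pos c.β_pos _) (pow_pos c.β_pos _)

theorem res_eq (τ l : ℕ) :
    ((c.params τ).res l : ℝ) = 1 / ((c.β ^ (τ + 1) * (c.β ^ c.N) ^ l : ℕ) : ℝ) := by
  simp only [Params.res, params, Params.make, Params.bare]
  push_cast
  rfl

theorem res_mul (τ l : ℕ) :
    ((c.params τ).res l : ℝ) * ((c.β ^ c.N) ^ l : ℕ) = (c.params τ).res 0 := by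
  have : (0 : ℝ) < c.β := by exact_mod_cast c.β_pos
  rw [c.res_eq, c.res_eq]
  push_cast
  field_simp

theorem res_succ (τ l : ℕ) :
    ((c.params τ).res (l + 1) : ℝ) * (c.β ^ c.N : ℕ) = (c.params τ).res l := by
  have : (0 : ℝ) < c.β := by exact_mod_cast c.β_pos
  rw [c.res_eq, c.res_eq]
  push_cast
  field_simp
  ring

theorem le_β_pow {n : ℕ} (hn : n ≠ 0) : c.β ≤ c.β ^ n := Nat.le_self_pow hn _

theorem res_zero_lt (hd : 1 ≤ d) (τ : ℕ) : 20 * ((c.params τ).res 0 : ℝ) < c.η := by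
  have h1 : (c.X : ℝ) < c.β := by exact_mod_cast c.X_lt_β hd
  have h2 : ((c.β : ℕ) : ℝ) ≤ ((c.β ^ (τ + 1) : ℕ) : ℝ) := by
    exact_mod_cast c.le_β_pow (Nat.succ_ne_zero τ)
  have h3 := c.lt_X
  rw [c.res_eq, pow_zero, mul_one, mul_one_div, div_lt_comm₀ (by linarith [c.β_pos]) c.η_pos]
  linarith

theorem ratioAt_le {τ : ℕ} (hτ : τ < c.N) (l : ℕ) : (c.params τ).ratioAt l + 4 ≤ c.W := by
  have h1 : c.β ^ (τ + 1) ≤ c.β ^ c.N := Nat.pow_le_pow_right c.β_pos hτ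
  simp only [Params.ratioAt, params, Params.make, Params.bare, W]
  split_ifs <;> omega

variable {I : Instance d} {O : Val → Bool}

/-- Every object is large at some level. -/
theorem exists_large (hd : 1 ≤ d) (hO : I.IsOracle O) (τ : ℕ) (i : Fin I.n) :
    isLarge (c.params τ) O ((c.params τ).res (levelSpine (c.params τ) I.input).length)
      (I.item i) = true := by
  obtain ⟨C, hC⟩ := c.bounded τ
  have hG := c.isGrid τ
  have hh := res_pos hC (levelSpine (c.params τ) I.input).length
  refine isLarge_iff.2 ((Instance.isTest hO i hG hh).large_of_ball hd hG hh (I.ball_subset i) ?_)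
  have h1 := res_mul_le (P := c.params τ) (inp := I.input)
    (o := (I.profit i, I.radius i, I.center i)) ((List.mem_ofFn' _ _).2 ⟨i, rfl⟩) (I.radius_pos i)
    (pow_pos c.β_pos _) (((c.X_lt_β hd).le.trans (c.le_β_pow (by have := c.two_le_N; omega))).trans'
      (le_trans (by norm_num) c.le_X)) (A := c.Kf + 1) (Nat.lt_two_pow_self).le
  exact_mod_cast h1

/-- Slack costs `d` factors `1 + 4 * ε`, the choice of the offset and that of the shift one each.
Objects of level `0` fit in their cell because of the slack, which exceeds twenty times the first
resolution; objects of higher levels fit because they are small compared with their cell and their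
reference point is away from its walls. -/
theorem exists_gridPacking (hd : 1 ≤ d) (hf : 1 ≤ f) (hε : 0 < ε) (hO : I.IsOracle O)
    (hI : ∀ i, IsFat f (I.body i) ∧ circumradius (I.body i) ≤ ε) {pl : Fin I.n → Option (E d)}
    (hpl : I.Feasible pl) :
    ∃ τ < c.N, ∃ (S : Finset (Fin I.n)) (lev : Fin I.n → ℕ) (addr : Fin I.n → ℕ → Fin d → ℤ),
      GridPacking I (c.params τ) O c.W S lev addr ∧
      (∀ i ∈ S, lev i ≤ (levelSpine (c.params τ) I.input).length) ∧
      (I.totalProfit pl : ℝ) ≤ (1 + 4 * ε) ^ (d + 2) * ((∑ i ∈ S, I.profit i : ℚ) : ℝ) := by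
  classical
  set K : Fin I.n → Set (E d) := fun i => (I.body i : Set (E d)) with hK
  set w : Fin I.n → ℝ := fun i => (I.profit i : ℝ) with hwdef
  have hw : ∀ i, 0 ≤ w i := fun i => Rat.cast_nonneg.2 (I.profit_nonneg i)
  choose r hF using fun i => (hI i).1.fatWith hf
  choose z hz using fun i => (hF i).ball
  have hr : ∀ i, 0 ≤ r i := fun i => (hF i).pos.le
  have hmem : ∀ i, toPoint (I.center i) ∈ K i := fun i =>
    I.ball_subset i (Metric.mem_closedBall_self (by exact_mod_cast (I.radius_pos i).le))
  have hint : ∀ i, (interior (K i)).Nonempty := fun i =>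
    ⟨z i, mem_interior_iff_mem_nhds.2
      (Filter.mem_of_superset (Metric.closedBall_mem_nhds _ (hF i).pos) (hz i))⟩
  have hwidth : ∀ i, ∀ x ∈ K i, ∀ y ∈ K i, ∀ k, x k - y k ≤ 2 * ε := fun i x hx y hy k =>
    (le_abs_self _).trans ((abs_coord_sub_le_dist x y k).trans
      ((dist_le_two_mul_circumradius _ hx hy).trans (by linarith [(hI i).2])))
  set t₀ : Fin I.n → E d := fun i => (pl i).getD 0 with ht₀
  set S₀ : Finset (Fin I.n) := Finset.univ.filter fun i => (pl i).isSome with hS₀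
  have hpl₀ : ∀ i ∈ S₀, pl i = some (t₀ i) := by
    intro i hi
    obtain ⟨v, hv⟩ := Option.isSome_iff_exists.1 (Finset.mem_filter.1 hi).2
    simp [ht₀, hv]
  have hsep : Separated K t₀ S₀ := by
    refine ⟨fun i hi x hx k => ?_, fun i hi j hj hij => ?_⟩
    · have := hpl.1 i _ (hpl₀ i hi) (Set.vadd_mem_vadd_set (a := t₀ i) hx) k
      rwa [vadd_eq_add, add_comm, PiLp.add_apply] at this
    · exact sepAt_of_disjoint_interior (hF i).convex (hF j).convex (hint i) (hint j)
        (hpl.2 i j _ _ hij (hpl₀ i hi) (hpl₀ j hj))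
  have htot : (I.totalProfit pl : ℝ) = ∑ i ∈ S₀, w i := by
    rw [Instance.totalProfit, ← Finset.sum_filter]
    push_cast
    rfl
  obtain ⟨t₁, S₁, hS₁, hcube, hdist, hsum₁⟩ := hsep.exists_spread hw hε c.η_pos c.two_le_N
    c.one_le_N c.strips hwidth hr hz
  have hm := c.m_pos hd
  have hm' : (0 : ℝ) < c.m := by exact_mod_cast hm
  have hβ : 4 * c.m * (c.Kf + 1) ≤ c.β := by
    refine le_trans ?_ c.mul_X_lt_β.le
    calc 4 * c.m * (c.Kf + 1) = c.m * (4 * (c.Kf + 1)) := by ring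
      _ ≤ c.m * c.X := Nat.mul_le_mul_left _ c.Kf_le_X
  obtain ⟨τ, hτ, S₂, hS₂, hcrit, hsum₂⟩ := exists_offset S₁ hw K I.center hm c.β_pos hβ
    c.two_le_N c.one_le_N
  set P := c.params τ with hP
  obtain ⟨C, hC⟩ := c.bounded τ
  have hG := c.isGrid τ
  have hlarge : ∀ i, ∃ l, isLarge P O (P.res l) (I.item i) = true := fun i =>
    ⟨_, c.exists_large hd hO τ i⟩
  set lev : Fin I.n → ℕ := fun i => Nat.find (hlarge i) with hlev
  have hl : ∀ i, isLarge P O (P.res (lev i)) (I.item i) = true := fun i => Nat.find_spec (hlarge i)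
  have hnl : ∀ i, ∀ l < lev i, isLarge P O (P.res l) (I.item i) = false := fun i l h => by
    have := Nat.find_min (hlarge i) h
    simpa using this
  -- Not being large at level `l` bounds the extent by `(Kf + 1) * res l`; not being critical there
  -- improves this to `res l / (4 * m)`, a small part of the side `res l` of a cell of level `l +
  -- 1`.
  have hsmall : ∀ i ∈ S₂, ∀ l, lev i = l + 1 → ∀ x ∈ K i, ∀ k,
      |x k - I.center i k| ≤ P.res l / (4 * c.m) := by
    intro i hi l hil x hx k
    by_contra hlt
    refine hcrit i hi l ⟨⟨x, hx, k, ?_⟩, fun y hy k' => ?_⟩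
    · rw [← c.res_eq]; exact not_le.1 hlt
    · rw [← c.res_eq]
      refine (Instance.isTest hO i hG (res_pos hC l)).coord_le_of_not_large (hF i) (hmem i) hG
        c.le_q (res_pos hC l) (fun hL => ?_) hy k'
      have h1 := hnl i l (by omega)
      rw [← Bool.not_eq_true] at h1
      exact h1 (isLarge_iff.2 hL)
  -- In units of the cell side `res l`, the shift `j * res 0 / m` is `j * (β ^ N) ^ l / m`, and `β`
  -- is congruent to `1` modulo `m`. For objects of level `0` the truncated exponent `lev i - 1` is
  -- `0`; the conclusion is not used for them.
  obtain ⟨j, hj, S₃, hS₃, hshift, hsum₃⟩ := exists_shift S₂ hw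
    (fun i k => (toPoint (I.center i) + t₁ i) k / (P.side (lev i) : ℝ))
    (fun i => (c.β ^ c.N) ^ (lev i - 1)) hm (fun i => by
      refine Nat.Coprime.pow_left _ (Nat.Coprime.pow_left _ ?_)
      rw [β, Nat.coprime_add_mul_left_left]
      exact Nat.coprime_one_left _) (ε := ε) (by
      rw [m, mul_comm]; exact Nat.mul_le_mul_left _ c.two_le_N) (by
      rw [m]; push_cast
      calc (d : ℝ) = 1 * d := (one_mul _).symm
        _ ≤ 2 * ε * c.N * d := mul_le_mul_of_nonneg_right c.one_le_N (by positivity)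
        _ = _ := by ring)
  set v : E d := WithLp.toLp 2 fun _ => j * P.res 0 / c.m with hv
  set t : Fin I.n → E d := fun i => t₁ i + v with ht
  have h0pos : (0 : ℝ) < P.res 0 := by exact_mod_cast res_pos hC 0
  have h0 := c.res_zero_lt hd τ
  have hv0 : 0 ≤ (j * P.res 0 / c.m : ℝ) := by positivity
  have hv1 : (j * P.res 0 / c.m : ℝ) ≤ P.res 0 := by
    rw [div_le_iff₀ hm', mul_comm]
    exact mul_le_mul_of_nonneg_left (by exact_mod_cast hj.le) h0pos.le
  have htk : ∀ i k, t i k = t₁ i k + j * P.res 0 / c.m := fun i k => rfl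
  have hbox : ∀ i ∈ S₃, ∀ x ∈ K i, ∀ k, 5 * (P.res 0 : ℝ) ≤ x k + t i k ∧
      x k + t i k + 4 * P.res 0 < 1 := by
    intro i hi x hx k
    obtain ⟨h1, h2⟩ := hcube i (hS₂ (hS₃ hi)) x hx k
    rw [htk]
    constructor <;> linarith
  have hcell0 : ∀ i ∈ S₃, P.cell (toPoint (I.center i) + t i) 0 = 0 := by
    intro i hi
    funext k
    obtain ⟨h1, h2⟩ := hbox i hi _ (hmem i) k
    have : ⌊(toPoint (I.center i) + t i) k⌋ = 0 := by
      rw [Int.floor_eq_zero_iff, PiLp.add_apply]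
      exact ⟨by linarith, by linarith⟩
    simpa [Params.cell, Params.side] using this
  refine ⟨τ, hτ, S₃, lev, fun i => P.cell (toPoint (I.center i) + t i),
    gridPacking_of_positions hO hG hC hF c.lt_Kf (half_pos c.η_pos) (c.ratioAt_le hτ)
      (fun i _ => hl i) (fun i _ => hnl i) hcell0 (fun i hi x hx k u hu => ?_)
      (fun i hi x hx k => ?_) (fun i hi j hj hij x hx y hy => ?_),
    fun i _ => Nat.find_min' (hlarge i) (c.exists_large hd hO τ i), ?_⟩
  · rcases hil : lev i with _ | l
    · rw [hil] at hu
      rw [hcell0 i hi]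
      obtain ⟨h1, h2⟩ := hbox i hi x hx k
      rw [abs_le] at hu
      simp only [Params.side, Rat.cast_one, div_one, Pi.zero_apply]
      rw [Int.floor_eq_zero_iff]
      exact ⟨by linarith, by linarith⟩
    · rw [hil, ← hP] at hu
      have hs : (0 : ℝ) < P.res l := by exact_mod_cast res_pos hC l
      have hrs : (P.res (l + 1) : ℝ) * (c.β ^ c.N : ℕ) = P.res l := c.res_succ τ l
      have hrl : (P.res l : ℝ) * ((c.β ^ c.N) ^ l : ℕ) = P.res 0 := c.res_mul τ l
      have hβN : (16 * c.m : ℝ) < (c.β ^ c.N : ℕ) := by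
        have h1 : c.m * 16 ≤ c.m * c.X := Nat.mul_le_mul_left _ c.le_X
        have h2 := c.mul_X_lt_β
        have h3 := c.le_β_pow (n := c.N) (by have := c.two_le_N; omega)
        have h4 : 16 * c.m < c.β ^ c.N := by omega
        exact_mod_cast h4
      -- In units of the cell side, the reference point is at least `1 / (2 * m)` from the walls,
      -- the extent is at most `1 / (4 * m)`, and four units of resolution make less than `1 / (4 *
      -- m)` because `β ^ N > 16 * m`.
      refine floor_eq_of_far (e := 4 * (1 / (c.β ^ c.N : ℕ)) + 1 / (4 * c.m))
        (f := 1 / (2 * c.m)) (fun n => ?_) ?_ ?_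
      · have h1 := hshift i hi k n
        rw [hil] at h1
        have h2 : (toPoint (I.center i) + t₁ i) k / (P.res l : ℝ) +
            j * ((c.β ^ c.N) ^ l : ℕ) / c.m = (toPoint (I.center i) + t i) k / (P.res l : ℝ) := by
          rw [PiLp.add_apply, PiLp.add_apply, htk, ← hrl]
          field_simp
          ring
        change 1 / (2 * (c.m : ℝ)) ≤ |(toPoint (I.center i) + t i) k / (P.res l : ℝ) - n|
        rw [← h2]
        exact h1
      · have h1 := hsmall i (hS₃ hi) l hil x hx k
        have h2 : u / (P.res l : ℝ) - (toPoint (I.center i) + t i) k / (P.res l : ℝ) =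
            ((u - (x k + t i k)) + (x k - I.center i k)) / P.res l := by
          simp only [PiLp.add_apply, toPoint]
          ring
        change |u / (P.res l : ℝ) - (toPoint (I.center i) + t i) k / (P.res l : ℝ)| ≤ _
        rw [h2, abs_div, abs_of_pos hs, div_le_iff₀ hs]
        refine (abs_add_le _ _).trans ((add_le_add hu h1).trans (le_of_eq ?_))
        rw [← hrs]
        have : ((c.β ^ c.N : ℕ) : ℝ) ≠ 0 := by have := pow_pos c.β_pos c.N; positivity
        field_simp
      · have h1 : (1 : ℝ) / (c.β ^ c.N : ℕ) < 1 / (16 * c.m) :=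
          one_div_lt_one_div_of_lt (by positivity) hβN
        have h2 : (1 : ℝ) / (2 * c.m) = 4 * (1 / (16 * c.m)) + 1 / (4 * c.m) := by
          field_simp; norm_num
        rw [h2]
        linarith
  · rcases hil : lev i with _ | l
    · obtain ⟨h1, h2⟩ := hbox i hi x hx k
      obtain ⟨h3, h4⟩ := hbox i hi _ (hmem i) k
      have h5 : toPoint (I.center i) k = I.center i k := rfl
      simp only [Params.side, Rat.cast_one]
      rw [h5] at h3 h4
      rw [abs_le]
      constructor <;> linarith
    · have hs : (0 : ℝ) < P.res l := by exact_mod_cast res_pos hC l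
      refine (hsmall i (hS₃ hi) l hil x hx k).trans (div_le_self hs.le ?_)
      have : (1 : ℝ) ≤ c.m := by exact_mod_cast hm
      linarith
  · have := hdist i (hS₂ (hS₃ hi)) j (hS₂ (hS₃ hj)) hij x hx y hy
    simp only [ht, ← add_assoc]
    rwa [dist_add_right]
  · have h1 : ((∑ i ∈ S₃, I.profit i : ℚ) : ℝ) = ∑ i ∈ S₃, w i := by push_cast; rfl
    rw [htot, h1]
    have h4 : 0 ≤ 1 + 4 * ε := by linarith
    calc ∑ i ∈ S₀, w i ≤ (1 + 4 * ε) ^ d * ∑ i ∈ S₁, w i := hsum₁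
      _ ≤ (1 + 4 * ε) ^ d * ((1 + 4 * ε) * ((1 + 4 * ε) * ∑ i ∈ S₃, w i)) :=
        mul_le_mul_of_nonneg_left (hsum₂.trans (mul_le_mul_of_nonneg_left hsum₃ h4))
          (pow_nonneg h4 d)
      _ = _ := by ring

/-- The constants for all offsets. -/
noncomputable def allParams : List (Params d) := (List.range c.N).map c.params

theorem solution (hO : I.IsOracle O) (hf : 1 ≤ f)
    (hI : ∀ i, IsFat f (I.body i)) : I.Solution (solveAll O I.input c.allParams) := by
  refine I.solution_solveAll _ fun P hP => ?_
  obtain ⟨τ, -, rfl⟩ := List.mem_map.1 hP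
  obtain ⟨C, hC⟩ := c.bounded τ
  refine Instance.solution_solve (W := c.W) hC (regionInv hC (fun l κ hκ => mem_level_make.1 hκ)
    fun l i hl hg => ?_)
  obtain ⟨r, hr⟩ := (hI i).fatWith hf
  exact Instance.covered hO (c.isGrid τ) c.le_q hr
    (I.ball_subset i (Metric.mem_closedBall_self (by exact_mod_cast (I.radius_pos i).le)))
    (res_pos hC l) _ hl hg

theorem totalProfit_le (hd : 1 ≤ d) (hf : 1 ≤ f) (hε : 0 < ε) (hε' : ε < 1 / 2)
    (hO : I.IsOracle O) (hI : ∀ i, IsFat f (I.body i) ∧ circumradius (I.body i) ≤ ε)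
    {pl : Fin I.n → Option (E d)} (hpl : I.Feasible pl) :
    (I.totalProfit pl : ℝ) ≤
      (1 + 4 * 4 ^ (d + 2) * ε) * ((solveAll O I.input c.allParams).1 : ℝ) := by
  obtain ⟨τ, hτ, S, lev, addr, hG, hlev, hle⟩ := c.exists_gridPacking hd hf hε hO hI hpl
  obtain ⟨C, hC⟩ := c.bounded τ
  have h1 := (hG.sum_le_solve hC (fun l κ hκ => mem_level_make.2 hκ) hlev).trans
    (le_solveAll (O := O) (inp := I.input) (Ps := c.allParams)
      (List.mem_map.2 ⟨τ, List.mem_range.2 hτ, rfl⟩))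
  have h2 : ((∑ i ∈ S, I.profit i : ℚ) : ℝ) ≤ (solveAll O I.input c.allParams).1 := by
    exact_mod_cast h1
  have h3 : (0 : ℝ) ≤ ((∑ i ∈ S, I.profit i : ℚ) : ℝ) := by
    exact_mod_cast Finset.sum_nonneg fun i _ => I.profit_nonneg i
  have h4 := one_add_pow_le (d + 2) (x := 4 * ε) (by linarith) (by linarith)
  refine hle.trans (mul_le_mul (h4.trans (le_of_eq ?_)) h2 h3 ?_)
  · ring
  · positivity

end Constants

/-- The framework is applied with the admissible pairs of an instance and an oracle as indices and
the size of the input code as measure, so one program and one polynomial serve all of them. The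
output is read off by base `b = 0`, the input variable of the start state. -/
theorem hasPolyTimeApprox {d : ℕ} (hd : 1 ≤ d) {f : ℝ} (hf : 1 ≤ f) {ε : ℝ} (hε : 0 < ε)
    (hε' : ε < 1 / 2) :
    HasPolyTimeApprox d {I | ∀ i, IsFat f (I.body i) ∧ circumradius (I.body i) ≤ ε}
      (1 + 4 * 4 ^ (d + 2) * ε) := by
  obtain ⟨c⟩ := Constants.nonempty d f hε hε'
  set K : Ctx {p : Instance d × (Val → Bool) //
    (∀ i, IsFat f (p.1.body i) ∧ circumradius (p.1.body i) ≤ ε) ∧ p.1.IsOracle p.2} :=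
    ⟨fun p => p.1.1.code.size, fun p => p.1.2⟩ with hK
  have hinp : PT K (fun p => p.1.1.input) fun p => p.1.1.input := by
    refine .id ⟨.X, fun p => ?_⟩
    rw [Polynomial.eval_X]
    exact (congrArg Val.size p.1.1.enc_input).le
  have hrun := hinp.output (hinp.solveAll c.allParams fun P hP => by
    obtain ⟨τ, -, rfl⟩ := List.mem_map.1 hP
    exact c.bounded τ).snd
  obtain ⟨cmd, T, ⟨p, hp⟩, hcmd⟩ := hrun.run 0
  refine ⟨cmd, p, fun I hI O hO => ?_⟩
  obtain ⟨t, σ, hex, ht, hσ, -⟩ := hcmd ⟨(I, O), hI, hO⟩ (startState I.code)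
    (by simp [startState, I.enc_input])
  have hsol := c.solution hO hf fun i => (hI i).1
  refine ⟨t, σ, fun i => lookup (solveAll O I.input c.allParams).2 i, hex,
    ht.trans (hp ⟨(I, O), hI, hO⟩), hσ.trans (I.enc_output _), hsol.feasible, fun pl hpl => ?_⟩
  rw [hsol.totalProfit]
  exact c.totalProfit_le hd hf hε hε' hO hI hpl

end Approximation

end GeoKnapsack

theorem mainTheorem2 (d : ℕ) (hd : 1 ≤ d) :
    ∃ C : ℝ, 0 < C ∧ ∀ f : ℝ, 1 ≤ f → ∀ ε : ℝ, 0 < ε → ε < 1 / 2 →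
      GeoKnapsack.HasPolyTimeApprox d
        {I | ∀ i, GeoKnapsack.IsFat f (I.body i) ∧ GeoKnapsack.circumradius (I.body i) ≤ ε}
        (1 + C * ε) :=
  ⟨4 * 4 ^ (d + 2), by positivity, fun _ hf _ hε hε' =>
    GeoKnapsack.hasPolyTimeApprox hd hf hε hε'⟩
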